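/- **Setting.** Let $C$ be a finite set of candidates, $N=\{1,\dots,n\}$ with $n\ge 1$ a set of voters, and $P$ a preference profile, i.e. a strict total order $\succ_i$ on $C$ for every $i\in N$. For $S\subseteq C$ write $\mathrm{top}(i,S)$, $\mathrm{second}(i,S)$, $\mathrm{bottom}(i,S)$ for voter $i$'s best, second-best and worst candidate in $S$, and $\mathrm{top}(i)=\mathrm{top}(i,C)$. The profile $P$ is *single-peaked* on a tree $T$ with vertex set $C$ if, for all $i\in N$ and all distinct $a,b\in C$ such that $b$ lies on the path from $\mathrm{top}(i)$ to $a$ in $T$, we have $b\succ_i a$ (and $\mathrm{top}(i)\succ_i b$ unless $b=\mathrm{top}(i)$). Let $\mathcal T(P)$ be the set of all trees on $C$ on which $P$ is single-peaked. A *path decomposition* of a graph is a sequence of vertex sets (bags) such that every vertex lies in a bag, the two endpoints of every edge lie in a common bag, and the bags containing a given vertex form an interval of the sequence. Its *width* is the maximum size of a bag minus $1$; the *pathwidth* of a graph is the minimum width of its path decompositions. An *attachment digraph* $D=(C,A)$ of $P$ is built as follows. Start with $S=C$ and $A=\emptyset$. While $|S|\ge 3$: let $L=\{\mathrm{bottom}(i,S):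 i\in N\}$; for $a\in L$ let $B(a)=\bigcap_{i\in N}B(i,S,a)$, where $B(i,S,a)=\{c\in S: c\succ_i a\}$ if $\mathrm{top}(i,S)\ne a$ and $B(i,S,a)=\{\mathrm{second}(i,S)\}$ if $\mathrm{top}(i,S)=a$; fail if some $B(a)$ is empty, otherwise add all arcs $(a,b)$ with $a\in L$, $b\in B(a)$ and replace $S$ by $S\setminus L$. If finally $|S|=2$, add an arc between the two remaining candidates, directed arbitrarily. A vertex is *forced* if its out-degree in $D$ is at most $1$ and *free* if it is at least $2$. The *forced part* is the undirected graph underlying the subdigraph of $D$ induced by the forced vertices. **The algorithm.** Given $P$, take an attachment digraph $D$ and a path decomposition $S_1,\dots,S_r$ of the forced part that has minimum width $w$ and in which every edge has an endpoint lying in some bag of size at most $w$. For every forced vertex $a$ that is not a sink of $D$, let $f(a)$ be its unique out-neighbour. For every free vertex $a$, choose forced vertices $c_1,c_2$ with $(c_1,c_2),(a,c_1),(a,c_2)\in A$ and let $f(a)\in\{c_1,c_2\}$ be one of them that lies in a bag $S_j$ with $|S_j|\le w$. Return the graph $T^*$ on $C$ with edges $\{a,f(a)\}$, $a$ ranging over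 the non-sink vertices. **Proposition.** 1. If $\mathcal T(P)\ne\emptyset$, then the construction of $D$ does not fail; for every attachment digraph $D$, the forced part is a tree and has a path decomposition as required; for each such decomposition, choices as required for all vertices exist; and, whatever the choices, the returned graph $T^*$ is a tree in $\mathcal T(P)$ of minimum pathwidth among all trees in $\mathcal T(P)$, in which every free vertex is a leaf. 2. The algorithm can be carried out in polynomial time: there are a program and a polynomial $q$ such that, for every profile $P$ with $n\ge1$ voters, $m$ candidates and $\mathcal T(P)\neq\emptyset$, the program, given the list of the voters' rankings, outputs within $q(n+m)$ steps the edges of a tree $T^*$ that is a possible output of the algorithm, and hence is a tree in $\mathcal T(P)$ of minimum pathwidth. -/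

import Mathlib

/-! Preference profiles, single-peakedness on trees, attachment digraphs, path decompositions,
the attachment algorithm, and a programming language with a step count. -/

/-- A preference profile: each voter `i` has a strict total order on the candidates;
`P.prefers i a b` means that voter `i` prefers `a` to `b`. -/
structure Profile (n : ℕ) (C : Type*) where
  prefers : Fin n → C → C → Prop
  strictTotal : ∀ i, IsStrictTotalOrder C (prefers i)

namespace Profile

variable {n : ℕ} {C : Type*}

/-- `a = top(i, S)`: candidate `a` is voter `i`'s most-preferred candidate in `S`. -/
def IsTop (P : Profile n C) (i : Fin n) (S : Set C) (a : C) : Prop :=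
  a ∈ S ∧ ∀ b ∈ S, b ≠ a → P.prefers i a b

/-- `a = second(i, S)`: candidate `a` is voter `i`'s second-most-preferred candidate in `S`. -/
def IsSecond (P : Profile n C) (i : Fin n) (S : Set C) (a : C) : Prop :=
  ∃ x, P.IsTop i S x ∧ P.IsTop i (S \ {x}) a

/-- `a = bottom(i, S)`: candidate `a` is voter `i`'s least-preferred candidate in `S`. -/
def IsBottom (P : Profile n C) (i : Fin n) (S : Set C) (a : C) : Prop :=
  a ∈ S ∧ ∀ b ∈ S, b ≠ a → P.prefers i b a

/-- `P` is single-peaked on `T`: whenever `b ≠ a` lies on the path from `top(i)` to `a` in `T`,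
voter `i` prefers `b` to `a` (and `top(i)` to `b`, unless `b` is `top(i)` itself). -/
def SinglePeakedOn (P : Profile n C) (T : SimpleGraph C) : Prop :=
  ∀ (i : Fin n) (x a b : C), P.IsTop i Set.univ x → a ≠ b →
    ∀ p : T.Walk x a, p.IsPath → b ∈ p.support →
      (b = x ∨ P.prefers i x b) ∧ P.prefers i b a

/-- `𝒯(P)`: all trees on the candidate set on which `P` is single-peaked. -/
def treeSet (P : Profile n C) : Set (SimpleGraph C) :=
  {T | T.IsTree ∧ P.SinglePeakedOn T}

/-! ### The attachment digraph -/

/-- `L = {bottom(i, S) : i ∈ N}`. -/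
def bottoms (P : Profile n C) (S : Set C) : Set C :=
  {a | ∃ i, P.IsBottom i S a}

/-- `B(i, S, a)`: the candidates of `S` that `i` prefers to `a` if `top(i, S) ≠ a`, and
`{second(i, S)}` if `top(i, S) = a`. -/
def attachSetOf (P : Profile n C) (i : Fin n) (S : Set C) (a : C) : Set C :=
  {c | c ∈ S ∧ ((¬ P.IsTop i S a ∧ P.prefers i c a) ∨ (P.IsTop i S a ∧ P.IsSecond i S c))}

/-- `B(a) = ⋂ i, B(i, S, a)`, where `S` is the current set of candidates. -/
def attachSet (P : Profile n C) (S : Set C) (a : C) : Set C :=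
  ⋂ i, P.attachSetOf i S a

/-- `P.Builds S D`: the construction of the attachment digraph, started with the current candidate
set `S` and no arcs, terminates without failure and adds exactly the arcs of `D`.
As long as `S` has at least three elements, each bottom candidate `a` gets an arc to every element
of `B(a)` (failing if `B(a) = ∅`), and all bottom candidates are removed from `S`;
if two candidates are left at the end, they are joined by an arc, in either direction. -/
inductive Builds (P : Profile n C) : Set C → Digraph C → Prop
  | done (S : Set C) (h : S.ncard ≤ 1) : Builds P S ⟨fun _ _ => False⟩
  | two (x y : C) (h : x ≠ y) : Builds P {x, y} ⟨fun a b => a = x ∧ b = y⟩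
  | step (S : Set C) (D : Digraph C) (h : 3 ≤ S.ncard)
      (hB : ∀ a ∈ P.bottoms S, (P.attachSet S a).Nonempty)
      (hD : Builds P (S \ P.bottoms S) D) :
      Builds P S ⟨fun a b => (a ∈ P.bottoms S ∧ b ∈ P.attachSet S a) ∨ D.Adj a b⟩

/-- `D` is an attachment digraph of `P` (unique up to the direction of the last arc). -/
def IsAttachmentDigraph (P : Profile n C) (D : Digraph C) : Prop :=
  P.Builds Set.univ D

end Profile

section Digraphs

variable {C : Type*}

/-- The out-degree of a vertex. -/
noncomputable def outDeg (D : Digraph C) (a : C) : ℕ := {b | D.Adj a b}.ncard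

/-- A sink is a vertex without outgoing arcs. -/
def IsSink (D : Digraph C) (a : C) : Prop := ∀ b, ¬ D.Adj a b

/-- The forced vertices: out-degree at most 1. -/
def forced (D : Digraph C) : Set C := {a | outDeg D a ≤ 1}

/-- The free vertices: out-degree at least 2. -/
def free (D : Digraph C) : Set C := {a | 2 ≤ outDeg D a}

/-- The forced part: the graph obtained from the subdigraph induced by the forced vertices by
forgetting the orientations of its arcs. -/
def forcedGraph (D : Digraph C) : SimpleGraph (forced D) :=
  SimpleGraph.fromRel fun a b => D.Adj a.1 b.1

/-- `T(f)`: the graph with the edges `{a, f a}`, where `a` ranges over the non-sink vertices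
(the value of `f` at the sink is not used). -/
def attachmentGraph (D : Digraph C) (f : C → C) : SimpleGraph C :=
  SimpleGraph.fromRel fun a b => ¬ IsSink D a ∧ f a = b

end Digraphs

section Pathwidth

variable {V : Type*}

/-- A path decomposition: a sequence of bags that covers all vertices and edges and in which the
bags containing a given vertex form an interval. -/
structure IsPathDecomposition (G : SimpleGraph V) (S : List (Finset V)) : Prop where
  vertex : ∀ a, ∃ X ∈ S, a ∈ X
  edge : ∀ a b, G.Adj a b → ∃ X ∈ S, a ∈ X ∧ b ∈ X
  interval : ∀ (a : V) (i j k : Fin S.length), i < k → k < j →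
    a ∈ S.get i → a ∈ S.get j → a ∈ S.get k

/-- The width: the maximum size of a bag, minus 1. -/
def bagWidth (S : List (Finset V)) : ℕ := (S.map Finset.card).foldr max 0 - 1

/-- The pathwidth: the minimum width of a path decomposition. -/
noncomputable def pathwidth (G : SimpleGraph V) : ℕ :=
  sInf {w | ∃ S, IsPathDecomposition G S ∧ bagWidth S = w}

/-- A path decomposition of minimum width `w` such that every edge has an endpoint which lies in a
bag of size at most `w`. -/
structure IsSlackDecomposition (G : SimpleGraph V) (S : List (Finset V)) : Prop where
  isDecomposition : IsPathDecomposition G S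
  minimum : bagWidth S = pathwidth G
  slack : ∀ a b, G.Adj a b → ∃ X ∈ S, (a ∈ X ∨ b ∈ X) ∧ X.card ≤ bagWidth S

end Pathwidth

section Algorithm

variable {C : Type*}

/-- `f` results from the main loop of the algorithm, for the attachment digraph `D` and the path
decomposition `S` of its forced part: every forced vertex other than the sink is mapped to its only
out-neighbour; for every free vertex `a`, two forced vertices `c₁, c₂` with arcs
`(c₁, c₂), (a, c₁), (a, c₂)` are chosen, and `a` is mapped to one of them that lies in a bag of
size at most the width of `S`.
(The algorithm also extends that bag by `a` to keep track of a path decomposition of the tree under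
construction; this does not influence the choices or the tree that is returned.) -/
structure IsAttachmentRun (D : Digraph C) (S : List (Finset (forced D))) (f : C → C) : Prop where
  forced_adj : ∀ a ∈ forced D, ¬ IsSink D a → D.Adj a (f a)
  free_choice : ∀ a ∈ free D, ∃ c₁ c₂ c : forced D,
    D.Adj c₁ c₂ ∧ D.Adj a c₁ ∧ D.Adj a c₂ ∧ (c = c₁ ∨ c = c₂) ∧ f a = c ∧
      ∃ X ∈ S, c ∈ X ∧ X.card ≤ bagWidth S

/-- `T` is a possible return value of the algorithm on input `P`. -/
def IsAlgorithmOutput {n : ℕ} (P : Profile n C) (T : SimpleGraph C) : Prop :=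
  ∃ (D : Digraph C) (S : List (Finset (forced D))) (f : C → C),
    P.IsAttachmentDigraph D ∧ IsSlackDecomposition (forcedGraph D) S ∧
      IsAttachmentRun D S f ∧ T = attachmentGraph D f

/-- `T` is a tree in `𝒯(P)` of minimum pathwidth among the trees in `𝒯(P)`. -/
def IsMinPathwidthTree {n : ℕ} (P : Profile n C) (T : SimpleGraph C) : Prop :=
  T ∈ P.treeSet ∧ ∀ T' ∈ P.treeSet, pathwidth T ≤ pathwidth T'

end Algorithm

/-! ### Programs and running time

Structured programs on binary trees (the data type of pure LISP), as in the usual WHILE language: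
constants, projections, pairing, composition, case distinction on "is `nil`", and while loops.
Every elementary operation is charged the size of the tree it reads, so that copying is paid for and
values never outgrow the time spent; programs and (multi-tape) Turing machines simulate each other
with polynomial overhead. -/

/-- Binary trees, the data of programs. -/
inductive Data
  | nil : Data
  | cons (a b : Data) : Data

/-- The number of nodes of a tree (leaves included). -/
def Data.size : Data → ℕ
  | .nil => 1
  | .cons a b => a.size + b.size + 1

/-- Programs; each transforms a tree into a tree. -/
inductive Prog
  | skip : Prog
  | nil : Prog
  | fst : Prog
  | snd : Prog
  | pair (f g : Prog) : Prog
  | seq (f g : Prog) : Prog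
  | ite (p f g : Prog) : Prog
  | while (p f : Prog) : Prog

/-- `Runs c x y t`: program `c`, started on `x`, halts with result `y` after `t` steps. -/
inductive Runs : Prog → Data → Data → ℕ → Prop
  | skip (x) : Runs .skip x x x.size
  | nil (x) : Runs .nil x .nil 1
  | fst_nil : Runs .fst .nil .nil 1
  | fst_cons (a b) : Runs .fst (.cons a b) a (Data.cons a b).size
  | snd_nil : Runs .snd .nil .nil 1
  | snd_cons (a b) : Runs .snd (.cons a b) b (Data.cons a b).size
  | pair {f g x y z s t} : Runs f x y s → Runs g x z t → Runs (.pair f g) x (.cons y z) (s + t + 1)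
  | seq {f g x y z s t} : Runs f x y s → Runs g y z t → Runs (.seq f g) x z (s + t + 1)
  | ite_true {p f g x v y s t} : Runs p x v s → v ≠ .nil → Runs f x y t →
      Runs (.ite p f g) x y (s + t + 1)
  | ite_false {p f g x y s t} : Runs p x .nil s → Runs g x y t → Runs (.ite p f g) x y (s + t + 1)
  | while_done {p f x s} : Runs p x .nil s → Runs (.while p f) x x (s + x.size + 1)
  | while_step {p f x v y z s t u} : Runs p x v s → v ≠ .nil → Runs f x y t →
      Runs (.while p f) y z u → Runs (.while p f) x z (s + t + u + 1)

/-- Lists are coded as nested pairs. -/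
def Data.ofList : List Data → Data
  | [] => .nil
  | a :: l => .cons a (Data.ofList l)

/-- Numbers are coded in unary. -/
def Data.ofNat : ℕ → Data
  | 0 => .nil
  | k + 1 => .cons .nil (Data.ofNat k)

/-- The list `l` is voter `i`'s ranking: all candidates, from the best to the worst. -/
def Profile.IsRanking {n : ℕ} {C : Type*} (P : Profile n C) (i : Fin n) (l : List C) : Prop :=
  l.Pairwise (P.prefers i) ∧ ∀ c, c ∈ l

/-- The code of a profile, given by the list of the voters' rankings. -/
def encodeRankings {n m : ℕ} (rk : Fin n → List (Fin m)) : Data :=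
  Data.ofList (List.ofFn fun i => Data.ofList ((rk i).map fun c => Data.ofNat c))

/-- The code of a list of edges. -/
def encodeEdges {m : ℕ} (l : List (Fin m × Fin m)) : Data :=
  Data.ofList (l.map fun e => .cons (Data.ofNat e.1) (Data.ofNat e.2))

/-- `l` lists the edges of `T`. -/
def ListsEdges {m : ℕ} (l : List (Fin m × Fin m)) (T : SimpleGraph (Fin m)) : Prop :=
  ∀ u v, T.Adj u v ↔ (u, v) ∈ l ∨ (v, u) ∈ l

/-! ### Path decompositions of induced subgraphs -/

section Bags

variable {V : Type*}

/-! Along a tree path a single-peaked voter's preference falls once it has started to fall. So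
single-peakedness on a tree is a local condition: no candidate has two neighbours that one voter
prefers to it (`LocallyPeaked`). Consequently a voter's worst candidate `a` in a connected set `S`
is a leaf of the tree induced on `S`, its neighbour belongs to `B(a)`, and deleting all such leaves
keeps the rest connected. If `𝒯(P)` is nonempty, the construction of `D` therefore cannot fail, and
every tree in `𝒯(P)` joins each non-sink to one of its out-neighbours. Conversely, any choice of one
out-neighbour per non-sink gives a tree in `𝒯(P)` (`StagedOn.attachmentGraph_mem_treeSet`).

Arcs compose through free vertices, so out-neighbours of forced vertices are forced
(`StagedOn.forced_of_adj`). The forced part is thus a tree; it lies in every member of `𝒯(P)`, and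
its pathwidth `w` is a lower bound. The out-neighbourhood of a free vertex `a` is convex in any tree
of `𝒯(P)`, which yields an arc `(c₁, c₂)` between forced vertices inside it
(`StagedOn.exists_forced_pair`). One of the two lies in a bag of size at most `w`, and a copy of
that bag enlarged by `a` accommodates `a` as a leaf without raising the width. Decompositions with
such small bags exist: after the last bag containing both ends of an edge, one end has disappeared
for good, so that bag may be repeated without it (`DecomposesOn.exists_slack_edge`).

For the running time no decomposition is constructed. The program attaches the free vertices one by
one, each to whichever of `c₁, c₂` gives the smaller pathwidth; by the leaf argument the pathwidth
stays at most `w`. That the result is an output of the algorithm is seen afterwards: restrict a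
decomposition of width `w` of the final tree to the forced vertices; the bag that contained both `a`
and `f a` has lost `a`, hence is small and contains `f a` (`Profile.StagedOn.exists_run`).

The pathwidth of a tree is computed from labels of rooted trees that are updated when two trees are
joined (`HasTriple.joinLabel`). Upper bounds come from gluing decompositions at bags `{r}`, lower
bounds from three disjoint parts, any two joined outside the third (`not_hasBags_of_three`).
Polynomial time follows from closure under composition and under folds with polynomially bounded
accumulators (`PolyTime.foldl`). -/

theorem sublist_two_append {α : Type*} {X Y : α} {L R : List α} :
    [X, Y].Sublist (L ++ R) ↔ [X, Y].Sublist L ∨ (X ∈ L ∧ Y ∈ R) ∨ [X, Y].Sublist R := by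
  induction L with
  | nil => simp
  | cons A L ih =>
    rw [List.cons_append, List.cons_sublist_cons', List.cons_sublist_cons', ih]
    simp only [List.singleton_sublist, List.mem_append, List.mem_cons]
    tauto

/-- The interval condition will be phrased through sublists `[X, Y, Z]` instead of indices, so that
for concatenations and insertions it reduces to a case distinction on which piece each bag comes
from. -/
theorem sublist_three_append {α : Type*} {X Y Z : α} {L R : List α} :
    [X, Y, Z].Sublist (L ++ R) ↔ [X, Y, Z].Sublist L ∨ ([X, Y].Sublist L ∧ Z ∈ R) ∨
      (X ∈ L ∧ [Y, Z].Sublist R) ∨ [X, Y, Z].Sublist R := by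
  induction L with
  | nil => simp
  | cons A L ih =>
    rw [List.cons_append, List.cons_sublist_cons', List.cons_sublist_cons', List.cons_sublist_cons',
      ih, sublist_two_append]
    simp only [List.mem_cons]
    constructor
    · rintro ((h | ⟨h, h'⟩ | ⟨h, h'⟩ | h) | ⟨rfl, h | ⟨h, h'⟩ | h⟩)
      · exact Or.inl (Or.inl h)
      · exact Or.inr (Or.inl ⟨Or.inl h, h'⟩)
      · exact Or.inr (Or.inr (Or.inl ⟨Or.inr h, h'⟩))
      · exact Or.inr (Or.inr (Or.inr h))
      · exact Or.inl (Or.inr ⟨rfl, h⟩)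
      · exact Or.inr (Or.inl ⟨Or.inr ⟨rfl, List.singleton_sublist.2 h⟩, h'⟩)
      · exact Or.inr (Or.inr (Or.inl ⟨Or.inl rfl, h⟩))
    · rintro ((h | ⟨rfl, h⟩) | ⟨h | ⟨rfl, h⟩, h'⟩ | ⟨rfl | h, h'⟩ | h)
      · exact Or.inl (Or.inl h)
      · exact Or.inr ⟨rfl, Or.inl h⟩
      · exact Or.inl (Or.inr (Or.inl ⟨h, h'⟩))
      · exact Or.inr ⟨rfl, Or.inr (Or.inl ⟨List.singleton_sublist.1 h, h'⟩)⟩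
      · exact Or.inr ⟨rfl, Or.inr (Or.inr h')⟩
      · exact Or.inl (Or.inr (Or.inr (Or.inl ⟨h, h'⟩)))
      · exact Or.inl (Or.inr (Or.inr (Or.inr h)))

theorem sublist_two_cons {α : Type*} {X Y A : α} {R : List α} :
    [X, Y].Sublist (A :: R) ↔ (X = A ∧ Y ∈ R) ∨ [X, Y].Sublist R := by
  rw [List.cons_sublist_cons', List.singleton_sublist, or_comm]

theorem sublist_three_cons {α : Type*} {X Y Z A : α} {R : List α} :
    [X, Y, Z].Sublist (A :: R) ↔ (X = A ∧ [Y, Z].Sublist R) ∨ [X, Y, Z].Sublist R := by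
  rw [List.cons_sublist_cons', or_comm]

/-- `S` is a path decomposition of the subgraph of `G` induced by `A`. -/
structure DecomposesOn (G : SimpleGraph V) (A : Set V) (S : List (Finset V)) : Prop where
  sub : ∀ X ∈ S, ∀ a ∈ X, a ∈ A
  vertex : ∀ a ∈ A, ∃ X ∈ S, a ∈ X
  edge : ∀ a ∈ A, ∀ b ∈ A, G.Adj a b → ∃ X ∈ S, a ∈ X ∧ b ∈ X
  interval : ∀ X Y Z, [X, Y, Z].Sublist S → ∀ a, a ∈ X → a ∈ Z → a ∈ Y

/-- The subgraph of `G` induced by `A` has a path decomposition with bags of size at most `k`. -/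
def HasBags (G : SimpleGraph V) (A : Set V) (k : ℕ) : Prop :=
  ∃ S, DecomposesOn G A S ∧ ∀ X ∈ S, X.card ≤ k

theorem getElem_sublist_three {α : Type*} {S : List α} {i k j : ℕ} (hik : i < k) (hkj : k < j)
    (hj : j < S.length) : [S[i], S[k], S[j]].Sublist S := by
  have h := List.map_getElem_sublist (l := S)
    (is := [⟨i, by omega⟩, ⟨k, by omega⟩, ⟨j, hj⟩]) (by simp; omega)
  simpa using h

theorem exists_getElem_of_sublist_three {α : Type*} {S : List α} {X Y Z : α}
    (h : [X, Y, Z].Sublist S) : ∃ i k j : Fin S.length, i < k ∧ k < j ∧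
      X = S.get i ∧ Y = S.get k ∧ Z = S.get j := by
  obtain ⟨is, h1, h2⟩ := List.sublist_eq_map_getElem h
  match is, h1, h2 with
  | [i, k, j], h1, h2 =>
    simp only [List.map_cons, List.map_nil, List.cons.injEq, and_true] at h1
    simp only [List.pairwise_cons, List.mem_cons, List.not_mem_nil, or_false] at h2
    exact ⟨i, k, j, h2.1 k (Or.inl rfl), h2.2.1 j rfl, h1.1, h1.2.1, h1.2.2⟩

theorem isPathDecomposition_iff {G : SimpleGraph V} {S : List (Finset V)} :
    IsPathDecomposition G S ↔ DecomposesOn G Set.univ S := by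
  constructor
  · intro h
    refine ⟨fun _ _ _ _ => trivial, fun a _ => h.vertex a, fun a _ b _ => h.edge a b, ?_⟩
    intro X Y Z hs a hX hZ
    obtain ⟨i, k, j, hik, hkj, rfl, rfl, rfl⟩ := exists_getElem_of_sublist_three hs
    exact h.interval a i j k hik hkj hX hZ
  · intro h
    refine ⟨fun a => h.vertex a trivial, fun a b => h.edge a trivial b trivial, ?_⟩
    intro a i j k hik hkj hi hj
    exact h.interval _ _ _ (getElem_sublist_three hik hkj j.2) a hi hj

/-- The truncated subtraction in `bagWidth` is harmless: when all bags are empty both sides hold for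
every `w`. -/
theorem bagWidth_le_iff {S : List (Finset V)} {w : ℕ} :
    bagWidth S ≤ w ↔ ∀ X ∈ S, X.card ≤ w + 1 := by
  have key : ∀ (l : List ℕ) (k : ℕ), l.foldr max 0 ≤ k ↔ ∀ x ∈ l, x ≤ k := by
    intro l k
    induction l with
    | nil => simp
    | cons a l ih => simp [ih]
  unfold bagWidth
  rw [Nat.sub_le_iff_le_add, key]
  simp

theorem HasBags.mono {G : SimpleGraph V} {A : Set V} {k l : ℕ} (h : HasBags G A k) (hkl : k ≤ l) :
    HasBags G A l := by
  obtain ⟨S, h1, h2⟩ := h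
  exact ⟨S, h1, fun X hX => (h2 X hX).trans hkl⟩

/-- Transport of a decomposition along a preimage of bags. -/
theorem DecomposesOn.preimage {W : Type*} {G : SimpleGraph V} {A : Set V} {S : List (Finset V)}
    (h : DecomposesOn G A S) (H : SimpleGraph W) (φ : W → V) (B : Set W)
    (hB : ∀ x ∈ B, φ x ∈ A) (hadj : ∀ x ∈ B, ∀ y ∈ B, H.Adj x y → G.Adj (φ x) (φ y))
    (g : Finset V → Finset W) (hg : ∀ X x, x ∈ g X ↔ x ∈ B ∧ φ x ∈ X) :
    DecomposesOn H B (S.map g) := by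
  refine ⟨?_, ?_, ?_, ?_⟩
  · intro X hX a ha
    obtain ⟨Y, hY, rfl⟩ := List.mem_map.1 hX
    exact ((hg _ _).1 ha).1
  · intro a ha
    obtain ⟨X, hX, haX⟩ := h.vertex _ (hB a ha)
    exact ⟨g X, List.mem_map_of_mem hX, (hg _ _).2 ⟨ha, haX⟩⟩
  · intro a ha b hb hab
    obtain ⟨X, hX, haX, hbX⟩ := h.edge _ (hB a ha) _ (hB b hb) (hadj a ha b hb hab)
    exact ⟨g X, List.mem_map_of_mem hX, (hg _ _).2 ⟨ha, haX⟩, (hg _ _).2 ⟨hb, hbX⟩⟩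
  · intro X Y Z hs a hX hZ
    obtain ⟨l, hl, hl'⟩ := List.sublist_map_iff.1 hs
    match l, hl' with
    | [X', Y', Z'], hl' =>
      simp only [List.map_cons, List.map_nil, List.cons.injEq, and_true] at hl'
      obtain ⟨rfl, rfl, rfl⟩ := hl'
      rw [hg] at hX hZ ⊢
      exact ⟨hX.1, h.interval _ _ _ hl _ hX.2 hZ.2⟩

theorem DecomposesOn.restrict {G : SimpleGraph V} {A : Set V} {S : List (Finset V)}
    (h : DecomposesOn G A S) (H : SimpleGraph V) {B : Set V} [DecidablePred (· ∈ B)] (hBA : B ⊆ A)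
    (hadj : ∀ x ∈ B, ∀ y ∈ B, H.Adj x y → G.Adj x y) :
    DecomposesOn H B (S.map fun X => X.filter (· ∈ B)) :=
  h.preimage H id B hBA hadj _ (by simp [and_comm])

theorem HasBags.restrict {G : SimpleGraph V} {A : Set V} {k : ℕ} (h : HasBags G A k)
    {H : SimpleGraph V} {B : Set V} (hBA : B ⊆ A)
    (hadj : ∀ x ∈ B, ∀ y ∈ B, H.Adj x y → G.Adj x y) : HasBags H B k := by
  classical
  obtain ⟨S, h1, h2⟩ := h
  refine ⟨_, h1.restrict H hBA hadj, ?_⟩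
  intro X hX
  obtain ⟨Y, hY, rfl⟩ := List.mem_map.1 hX
  exact (Finset.card_le_card (Finset.filter_subset _ _)).trans (h2 Y hY)

theorem HasBags.subset {G : SimpleGraph V} {A B : Set V} {k : ℕ} (h : HasBags G A k)
    (hBA : B ⊆ A) : HasBags G B k :=
  h.restrict hBA fun _ _ _ _ => id

theorem DecomposesOn.reverse {G : SimpleGraph V} {A : Set V} {S : List (Finset V)}
    (h : DecomposesOn G A S) : DecomposesOn G A S.reverse := by
  refine ⟨by simpa using h.sub, by simpa using h.vertex, by simpa using h.edge, ?_⟩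
  intro X Y Z hs a hX hZ
  have h' : [Z, Y, X].Sublist S := by simpa using hs.reverse
  exact h.interval _ _ _ h' a hZ hX

theorem DecomposesOn.append {G : SimpleGraph V} {A B : Set V} {S S' : List (Finset V)}
    (h : DecomposesOn G A S) (h' : DecomposesOn G B S') (hd : Disjoint A B)
    (hadj : ∀ x ∈ A, ∀ y ∈ B, ¬ G.Adj x y) : DecomposesOn G (A ∪ B) (S ++ S') := by
  have hd' : ∀ a, a ∈ A → a ∉ B := fun a ha hb => Set.disjoint_left.1 hd ha hb
  refine ⟨?_, ?_, ?_, ?_⟩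
  · intro X hX a ha
    rcases List.mem_append.1 hX with hX | hX
    · exact Or.inl (h.sub X hX a ha)
    · exact Or.inr (h'.sub X hX a ha)
  · rintro a (ha | ha)
    · obtain ⟨X, hX, haX⟩ := h.vertex a ha
      exact ⟨X, List.mem_append_left _ hX, haX⟩
    · obtain ⟨X, hX, haX⟩ := h'.vertex a ha
      exact ⟨X, List.mem_append_right _ hX, haX⟩
  · rintro a (ha | ha) b (hb | hb) hab
    · obtain ⟨X, hX, haX⟩ := h.edge a ha b hb hab
      exact ⟨X, List.mem_append_left _ hX, haX⟩
    · exact absurd hab (hadj a ha b hb)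
    · exact absurd hab.symm (hadj b hb a ha)
    · obtain ⟨X, hX, haX⟩ := h'.edge a ha b hb hab
      exact ⟨X, List.mem_append_right _ hX, haX⟩
  · intro X Y Z hs a hX hZ
    rcases sublist_three_append.1 hs with hs | ⟨hs, hZ'⟩ | ⟨hX', hs⟩ | hs
    · exact h.interval _ _ _ hs a hX hZ
    · exact absurd (h'.sub _ hZ' a hZ) (hd' a (h.sub _ (hs.subset (by simp)) a hX))
    · exact absurd (h'.sub _ (hs.subset (by simp)) a hZ) (hd' a (h.sub _ hX' a hX))
    · exact h'.interval _ _ _ hs a hX hZ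

theorem HasBags.union {G : SimpleGraph V} {A B : Set V} {k : ℕ} (h : HasBags G A k)
    (h' : HasBags G B k) (hd : Disjoint A B) (hadj : ∀ x ∈ A, ∀ y ∈ B, ¬ G.Adj x y) :
    HasBags G (A ∪ B) k := by
  obtain ⟨S, h1, h2⟩ := h
  obtain ⟨S', h1', h2'⟩ := h'
  refine ⟨S ++ S', h1.append h1' hd hadj, fun X hX => ?_⟩
  rcases List.mem_append.1 hX with hX | hX
  · exact h2 X hX
  · exact h2' X hX

/-- The extra bag `{r}` covers `r` even when `S` is empty, and ends the list with a bag at which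
further decompositions can be glued. -/
theorem DecomposesOn.insertAll [DecidableEq V] {G : SimpleGraph V} {A : Set V}
    {S : List (Finset V)} (h : DecomposesOn G A S) {r : V} :
    DecomposesOn G (insert r A) (S.map (insert r) ++ [{r}]) := by
  refine ⟨?_, ?_, ?_, ?_⟩
  · intro X hX a ha
    rcases List.mem_append.1 hX with hX | hX
    · obtain ⟨Y, hY, rfl⟩ := List.mem_map.1 hX
      rcases Finset.mem_insert.1 ha with rfl | ha
      · exact Or.inl rfl
      · exact Or.inr (h.sub Y hY a ha)
    · simp only [List.mem_singleton] at hX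
      subst hX
      exact Or.inl (by simpa using ha)
  · rintro a (rfl | ha)
    · exact ⟨{a}, by simp, by simp⟩
    · obtain ⟨X, hX, haX⟩ := h.vertex a ha
      exact ⟨insert r X, by simp; exact Or.inl ⟨X, hX, rfl⟩, by simp [haX]⟩
  · rintro a (rfl | ha) b (rfl | hb) hab
    · exact absurd hab G.irrefl
    · obtain ⟨X, hX, haX⟩ := h.vertex b hb
      exact ⟨insert a X, by simp; exact Or.inl ⟨X, hX, rfl⟩, by simp [haX]⟩
    · obtain ⟨X, hX, haX⟩ := h.vertex a ha
      exact ⟨insert b X, by simp; exact Or.inl ⟨X, hX, rfl⟩, by simp [haX]⟩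
    · obtain ⟨X, hX, haX, hbX⟩ := h.edge a ha b hb hab
      exact ⟨insert r X, by simp; exact Or.inl ⟨X, hX, rfl⟩, by simp [haX, hbX]⟩
  · intro X Y Z hs a hX hZ
    have hr : ∀ W ∈ S.map (insert r) ++ [{r}], r ∈ W := by
      intro W hW
      rcases List.mem_append.1 hW with hW | hW
      · obtain ⟨Y, hY, rfl⟩ := List.mem_map.1 hW
        simp
      · simp only [List.mem_singleton] at hW
        simp [hW]
    by_cases har : a = r
    · subst har
      exact hr _ (hs.subset (by simp))
    rcases sublist_three_append.1 hs with hs | ⟨hs, hZ'⟩ | ⟨hX', hs⟩ | hs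
    · obtain ⟨l, hl, hl'⟩ := List.sublist_map_iff.1 hs
      match l, hl' with
      | [X', Y', Z'], hl' =>
        simp only [List.map_cons, List.map_nil, List.cons.injEq, and_true] at hl'
        obtain ⟨rfl, rfl, rfl⟩ := hl'
        simp only [Finset.mem_insert, har, false_or] at hX hZ ⊢
        exact h.interval _ _ _ hl _ hX hZ
    · simp only [List.mem_singleton] at hZ'
      subst hZ'
      exact absurd (by simpa using hZ) har
    · simpa using hs.length_le
    · simpa using hs.length_le

theorem HasBags.insert {G : SimpleGraph V} {A : Set V} {k : ℕ} (h : HasBags G A k) (r : V) :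
    HasBags G (insert r A) (k + 1) := by
  classical
  obtain ⟨S, h1, h2⟩ := h
  refine ⟨_, h1.insertAll (r := r), fun X hX => ?_⟩
  rcases List.mem_append.1 hX with hX | hX
  · obtain ⟨Y, hY, rfl⟩ := List.mem_map.1 hX
    exact (Finset.card_insert_le _ _).trans (Nat.succ_le_succ (h2 Y hY))
  · simp only [List.mem_singleton] at hX
    simp [hX]

/-- Insertion of a decomposition all of whose bags contain `u` next to the bag `{u}`. -/
theorem DecomposesOn.insertMiddle {G : SimpleGraph V} {A B : Set V}
    {L R M : List (Finset V)} {u : V} (h : DecomposesOn G A (L ++ {u} :: R))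
    (h' : DecomposesOn G B M) (hu : ∀ X ∈ M, u ∈ X) (hd : ∀ a, a ∈ A → a ∈ B → a = u)
    (hadj : ∀ x ∈ A, ∀ y ∈ B, y ≠ u → G.Adj x y → x = u) (huB : u ∈ B) :
    DecomposesOn G (A ∪ B) (L ++ {u} :: (M ++ R)) := by
  have huA : u ∈ A := h.sub {u} (by simp) u (by simp)
  have key : ∀ X ∈ L ++ {u} :: R, X ∈ L ++ {u} :: (M ++ R) := by
    intro X hX
    simp only [List.mem_append, List.mem_cons] at hX ⊢
    tauto
  have key' : ∀ X ∈ M, X ∈ L ++ {u} :: (M ++ R) := by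
    intro X hX
    simp only [List.mem_append, List.mem_cons] at hX ⊢
    tauto
  refine ⟨?_, ?_, ?_, ?_⟩
  · intro X hX a ha
    have hX' : X ∈ L ++ {u} :: R ∨ X ∈ M := by
      simp only [List.mem_append, List.mem_cons] at hX ⊢
      tauto
    rcases hX' with hX | hX
    · exact Or.inl (h.sub X hX a ha)
    · exact Or.inr (h'.sub X hX a ha)
  · rintro a (ha | ha)
    · obtain ⟨X, hX, haX⟩ := h.vertex a ha
      exact ⟨X, key X hX, haX⟩
    · obtain ⟨X, hX, haX⟩ := h'.vertex a ha
      exact ⟨X, key' X hX, haX⟩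
  · have aux : ∀ a ∈ A, ∀ b ∈ B, G.Adj a b → ∃ X ∈ L ++ {u} :: (M ++ R), a ∈ X ∧ b ∈ X := by
      intro a ha b hb hab
      by_cases hbu : b = u
      · obtain ⟨X, hX, haX⟩ := h.edge a ha b (hbu ▸ huA) hab
        exact ⟨X, key X hX, haX⟩
      obtain rfl := hadj a ha b hb hbu hab
      obtain ⟨X, hX, hbX⟩ := h'.vertex b hb
      exact ⟨X, key' X hX, hu X hX, hbX⟩
    rintro a (ha | ha) b (hb | hb) hab
    · obtain ⟨X, hX, haX⟩ := h.edge a ha b hb hab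
      exact ⟨X, key X hX, haX⟩
    · exact aux a ha b hb hab
    · obtain ⟨X, h1, h2, h3⟩ := aux b hb a ha hab.symm
      exact ⟨X, h1, h3, h2⟩
    · obtain ⟨X, hX, haX⟩ := h'.edge a ha b hb hab
      exact ⟨X, key' X hX, haX⟩
  · intro X Y Z hs a hX hZ
    -- The interval condition of the original list, split by the positions of the three bags; `i1`
    -- to `i7` are its individual cases.
    have hi : ∀ X Y Z : Finset V, ([X, Y, Z].Sublist L ∨ ([X, Y].Sublist L ∧ (Z = {u} ∨ Z ∈ R)) ∨
      (X ∈ L ∧ (Y = {u} ∧ Z ∈ R ∨ [Y, Z].Sublist R)) ∨ ((X = {u} ∧ [Y, Z].Sublist R) ∨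
        [X, Y, Z].Sublist R)) → a ∈ X → a ∈ Z → a ∈ Y := by
      intro X Y Z h'
      refine fun hX hZ => h.interval X Y Z ?_ a hX hZ
      rw [sublist_three_append, sublist_three_cons, sublist_two_cons]
      simpa only [List.mem_cons] using h'
    have i1 := fun X Y Z h => hi X Y Z (Or.inl h)
    have i2 := fun X Y Z h h' => hi X Y Z (Or.inr (Or.inl ⟨h, Or.inr h'⟩))
    have i3 := fun X Y h => hi X Y {u} (Or.inr (Or.inl ⟨h, Or.inl rfl⟩))
    have i4 := fun X Z h h' => hi X {u} Z (Or.inr (Or.inr (Or.inl ⟨h, Or.inl ⟨rfl, h'⟩⟩)))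
    have i5 := fun X Y Z h h' => hi X Y Z (Or.inr (Or.inr (Or.inl ⟨h, Or.inr h'⟩)))
    have i6 := fun Y Z h => hi {u} Y Z (Or.inr (Or.inr (Or.inr (Or.inl ⟨rfl, h⟩))))
    have i7 := fun X Y Z h => hi X Y Z (Or.inr (Or.inr (Or.inr (Or.inr h))))
    have hm2 : ∀ (l : List (Finset V)) (X Y : Finset V), [X, Y].Sublist l → X ∈ l ∧ Y ∈ l :=
      fun l X Y h => ⟨h.subset (by simp), h.subset (by simp)⟩
    have hm3 : ∀ (l : List (Finset V)) (X Y Z : Finset V), [X, Y, Z].Sublist l → Y ∈ l :=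
      fun l X Y Z h => h.subset (by simp)
    have hLA : ∀ X ∈ L, a ∈ X → a ∈ A := fun X hX => h.sub X (by simp [hX]) a
    have hRA : ∀ X ∈ R, a ∈ X → a ∈ A := fun X hX => h.sub X (by simp [hX]) a
    have hMB : ∀ X ∈ M, a ∈ X → a ∈ B := fun X hX => h'.sub X hX a
    rw [sublist_three_append, sublist_three_cons, sublist_three_append, sublist_two_cons,
      sublist_two_append] at hs
    simp only [List.mem_append, List.mem_cons] at hs
    -- Every bag of `M` contains `u`, so for `u` the bags of `M` behave like the bag `{u}`. Any
    -- other vertex lies in at most one of `A` and `B`, and the bag `{u}` separates `L` from `R` for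
    -- it.
    by_cases hau : a = u
    · subst hau
      have hu' : a ∈ ({a} : Finset V) := Finset.mem_singleton_self a
      rcases hs with hs | ⟨hs, hs' | hs' | hs'⟩ | ⟨hs, ⟨rfl, hs'⟩ | hs' | hs' | hs'⟩ |
        ⟨rfl, hs' | hs' | hs'⟩ | hs | hs | hs | hs
      · exact i1 _ _ _ hs hX hZ
      · exact i3 _ _ hs hX hu'
      · exact i3 _ _ hs hX hu'
      · exact i2 _ _ _ hs hs' hX hZ
      · exact hu'
      · exact hu _ (hm2 _ _ _ hs').1
      · exact hu _ hs'.1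
      · exact i5 _ _ _ hs hs' hX hZ
      · exact hu _ (hm2 _ _ _ hs').1
      · exact hu _ hs'.1
      · exact i6 _ _ hs' hu' hZ
      · exact hu _ (hm3 _ _ _ _ hs)
      · exact hu _ (hm2 _ _ _ hs.1).2
      · exact i6 _ _ hs.2 hu' hZ
      · exact i7 _ _ _ hs hX hZ
    · have hau' : a ∉ ({u} : Finset V) := by simpa using hau
      have hAB : a ∈ A → a ∈ B → a ∈ Y := fun h1 h2 => absurd (hd a h1 h2) hau
      rcases hs with hs | ⟨hs, rfl | hs' | hs'⟩ | ⟨hs, ⟨rfl, hs' | hs'⟩ | hs' | hs' | hs'⟩ |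
        ⟨rfl, hs' | hs' | hs'⟩ | hs | hs | hs | hs
      · exact i1 _ _ _ hs hX hZ
      · exact absurd hZ hau'
      · exact hAB (hLA _ (hm2 _ _ _ hs).1 hX) (hMB _ hs' hZ)
      · exact i2 _ _ _ hs hs' hX hZ
      · exact hAB (hLA _ hs hX) (hMB _ hs' hZ)
      · exact i4 _ _ hs hs' hX hZ
      · exact hAB (hLA _ hs hX) (hMB _ (hm2 _ _ _ hs').2 hZ)
      · exact absurd (i4 _ _ hs hs'.2 hX hZ) hau'
      · exact i5 _ _ _ hs hs' hX hZ
      · exact absurd hX hau'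
      · exact absurd hX hau'
      · exact absurd hX hau'
      · exact h'.interval _ _ _ hs _ hX hZ
      · exact hAB (hRA _ hs.2 hZ) (hMB _ (hm2 _ _ _ hs.1).1 hX)
      · exact hAB (hRA _ (hm2 _ _ _ hs.2).2 hZ) (hMB _ hs.1 hX)
      · exact i7 _ _ _ hs hX hZ

end Bags

/-! ### Refining decompositions: inserted bags, leaves, slack, and the pathwidth as a minimum. -/

section Bags

variable {V : Type*}

/-- Insertion of a bag `Y` right after the bag `X`. -/
theorem interval_insert {A : Set V} {L R : List (Finset V)} {X Y : Finset V}
    (hsub : ∀ Z ∈ L ++ X :: R, ∀ a ∈ Z, a ∈ A)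
    (h : ∀ P Q T, [P, Q, T].Sublist (L ++ X :: R) → ∀ a, a ∈ P → a ∈ T → a ∈ Q)
    (hY : ∀ v ∈ Y, v ∈ X ∨ v ∉ A) (hX : ∀ v ∈ X, v ∉ Y → ∀ Z ∈ R, v ∉ Z) :
    ∀ P Q T, [P, Q, T].Sublist (L ++ X :: Y :: R) → ∀ a, a ∈ P → a ∈ T → a ∈ Q := by
  intro P Q T hs a hP hT
  have hi : ∀ P Q T : Finset V, ([P, Q, T].Sublist L ∨ ([P, Q].Sublist L ∧ (T = X ∨ T ∈ R)) ∨
    (P ∈ L ∧ (Q = X ∧ T ∈ R ∨ [Q, T].Sublist R)) ∨ ((P = X ∧ [Q, T].Sublist R) ∨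
      [P, Q, T].Sublist R)) → a ∈ P → a ∈ T → a ∈ Q := by
    intro P Q T h' hP hT
    refine h P Q T ?_ a hP hT
    rw [sublist_three_append, sublist_three_cons, sublist_two_cons]
    simpa only [List.mem_cons] using h'
  have hm2 : ∀ (l : List (Finset V)) (X Y : Finset V), [X, Y].Sublist l → X ∈ l ∧ Y ∈ l :=
    fun l X Y h => ⟨h.subset (by simp), h.subset (by simp)⟩
  have hLA : ∀ Z ∈ L, a ∈ Z → a ∈ A := fun Z hZ => hsub Z (by simp [hZ]) a
  have hRA : ∀ Z ∈ R, a ∈ Z → a ∈ A := fun Z hZ => hsub Z (by simp [hZ]) a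
  have hXA : a ∈ X → a ∈ A := hsub X (by simp) a
  have hYX : a ∈ Y → a ∈ A → a ∈ X := fun h1 h2 => (hY a h1).resolve_right (by simpa using h2)
  have hXY : a ∈ X → ∀ Z ∈ R, a ∈ Z → a ∈ Y := by
    intro h1 Z hZ h2
    by_contra h3
    exact hX a h1 h3 Z hZ h2
  rw [sublist_three_append, sublist_three_cons, sublist_two_cons, sublist_three_cons,
    sublist_two_cons] at hs
  simp only [List.mem_cons] at hs
  rcases hs with hs | ⟨hs, rfl | rfl | hs'⟩ | ⟨hs, ⟨rfl, rfl | hs'⟩ | ⟨rfl, hs'⟩ | hs'⟩ |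
    ⟨rfl, ⟨rfl, hs'⟩ | hs'⟩ | ⟨rfl, hs'⟩ | hs'
  · exact hi _ _ _ (Or.inl hs) hP hT
  · exact hi _ _ _ (Or.inr (Or.inl ⟨hs, Or.inl rfl⟩)) hP hT
  · exact hi _ _ _ (Or.inr (Or.inl ⟨hs, Or.inl rfl⟩)) hP (hYX hT (hLA _ (hm2 _ _ _ hs).1 hP))
  · exact hi _ _ _ (Or.inr (Or.inl ⟨hs, Or.inr hs'⟩)) hP hT
  · exact hYX hT (hLA _ hs hP)
  · exact hi _ _ _ (Or.inr (Or.inr (Or.inl ⟨hs, Or.inl ⟨rfl, hs'⟩⟩))) hP hT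
  · exact hXY (hi _ _ _ (Or.inr (Or.inr (Or.inl ⟨hs, Or.inl ⟨rfl, hs'⟩⟩))) hP hT) _ hs' hT
  · exact hi _ _ _ (Or.inr (Or.inr (Or.inl ⟨hs, Or.inr hs'⟩))) hP hT
  · exact hXY hP _ hs' hT
  · exact hi _ _ _ (Or.inr (Or.inr (Or.inr (Or.inl ⟨rfl, hs'⟩)))) hP hT
  · exact hi _ _ _ (Or.inr (Or.inr (Or.inr (Or.inl ⟨rfl, hs'⟩))))
      (hYX hP (hRA _ (hm2 _ _ _ hs').2 hT)) hT
  · exact hi _ _ _ (Or.inr (Or.inr (Or.inr (Or.inr hs')))) hP hT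

/-- Only the interval condition is at stake: the vertices dropped from `X` must not return in a
later bag. -/
theorem DecomposesOn.insertSubbag {G : SimpleGraph V} {A : Set V} {L R : List (Finset V)}
    {X Y : Finset V} (h : DecomposesOn G A (L ++ X :: R)) (hYX : Y ⊆ X)
    (hX : ∀ v ∈ X, v ∉ Y → ∀ Z ∈ R, v ∉ Z) : DecomposesOn G A (L ++ X :: Y :: R) := by
  have hmem : ∀ Z ∈ L ++ X :: R, Z ∈ L ++ X :: Y :: R := by
    intro Z hZ
    simp only [List.mem_append, List.mem_cons] at hZ ⊢
    tauto
  refine ⟨?_, ?_, ?_, interval_insert h.sub h.interval (fun v hv => Or.inl (hYX hv)) hX⟩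
  · intro Z hZ a ha
    by_cases hZY : Z = Y
    · subst hZY
      exact h.sub X (by simp) a (hYX ha)
    · refine h.sub Z ?_ a ha
      simp only [List.mem_append, List.mem_cons] at hZ ⊢
      tauto
  · intro a ha
    obtain ⟨Z, hZ, haZ⟩ := h.vertex a ha
    exact ⟨Z, hmem Z hZ, haZ⟩
  · intro a ha b hb hab
    obtain ⟨Z, hZ, haZ⟩ := h.edge a ha b hb hab
    exact ⟨Z, hmem Z hZ, haZ⟩

/-- Attaching a leaf `a` to a vertex `c` of the bag `X`. -/
theorem DecomposesOn.insertLeaf [DecidableEq V] {G G' : SimpleGraph V} {A : Set V}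
    {L R : List (Finset V)} {X : Finset V} {a c : V} (h : DecomposesOn G A (L ++ X :: R))
    (ha : a ∉ A) (hc : c ∈ X) (hadj : ∀ b ∈ A, G'.Adj a b → b = c)
    (hG : ∀ x ∈ A, ∀ y ∈ A, G'.Adj x y → G.Adj x y) :
    DecomposesOn G' (insert a A) (L ++ X :: insert a X :: R) := by
  have hmem : ∀ Z ∈ L ++ X :: R, Z ∈ L ++ X :: insert a X :: R := by
    intro Z hZ
    simp only [List.mem_append, List.mem_cons] at hZ ⊢
    tauto
  refine ⟨?_, ?_, ?_, interval_insert h.sub h.interval ?_ ?_⟩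
  · intro Z hZ v hv
    by_cases hZY : Z = insert a X
    · subst hZY
      rcases Finset.mem_insert.1 hv with rfl | hv
      · exact Or.inl rfl
      · exact Or.inr (h.sub X (by simp) v hv)
    · refine Or.inr (h.sub Z ?_ v hv)
      simp only [List.mem_append, List.mem_cons] at hZ ⊢
      tauto
  · rintro v (rfl | hv)
    · exact ⟨insert v X, by simp, by simp⟩
    · obtain ⟨Z, hZ, haZ⟩ := h.vertex v hv
      exact ⟨Z, hmem Z hZ, haZ⟩
  · rintro x (rfl | hx) y (rfl | hy) hxy
    · exact absurd hxy G'.irrefl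
    · obtain rfl := hadj y hy hxy
      exact ⟨insert x X, by simp, by simp, by simp [hc]⟩
    · obtain rfl := hadj x hx hxy.symm
      exact ⟨insert y X, by simp, by simp [hc], by simp⟩
    · obtain ⟨Z, hZ, haZ⟩ := h.edge x hx y hy (hG x hx y hy hxy)
      exact ⟨Z, hmem Z hZ, haZ⟩
  · intro v hv
    rcases Finset.mem_insert.1 hv with rfl | hv
    · exact Or.inr ha
    · exact Or.inl hv
  · intro v hv hv'
    exact absurd (Finset.mem_insert_of_mem hv) hv'

theorem sublist_two_of_mem {α : Type*} {X Y : α} {L : List α} (hX : X ∈ L) (hY : Y ∈ L) :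
    X = Y ∨ [X, Y].Sublist L ∨ [Y, X].Sublist L := by
  obtain ⟨P, Q, rfl⟩ := List.append_of_mem hX
  simp only [List.mem_append, List.mem_cons] at hY
  rcases hY with h | h | h
  · exact Or.inr (Or.inr (sublist_two_append.2 (Or.inr (Or.inl ⟨h, by simp⟩))))
  · exact Or.inl h.symm
  · exact Or.inr (Or.inl (sublist_two_append.2 (Or.inr (Or.inr (sublist_two_cons.2 (Or.inl ⟨rfl, h⟩))))))

theorem exists_append_last {α : Type*} {p : α → Prop} {S : List α} (h : ∃ X ∈ S, p X) :
    ∃ L X R, S = L ++ X :: R ∧ p X ∧ ∀ Y ∈ R, ¬ p Y := by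
  induction S with
  | nil => simp at h
  | cons A S ih =>
    by_cases hS : ∃ X ∈ S, p X
    · obtain ⟨L, X, R, rfl, h1, h2⟩ := ih hS
      exact ⟨A :: L, X, R, rfl, h1, h2⟩
    · obtain ⟨X, hX, hpX⟩ := h
      rcases List.mem_cons.1 hX with rfl | hX
      · exact ⟨[], X, S, rfl, hpX, fun Y hY hpY => hS ⟨Y, hY, hpY⟩⟩
      · exact absurd ⟨X, hX, hpX⟩ hS

/-- Any decomposition can be refined so that a given edge has an endpoint in a small bag. -/
theorem DecomposesOn.exists_slack_edge {G : SimpleGraph V} {A : Set V} {S : List (Finset V)}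
    {k : ℕ} (h : DecomposesOn G A S) (hk : ∀ X ∈ S, X.card ≤ k + 1) {a b : V} (ha : a ∈ A)
    (hb : b ∈ A) (hab : G.Adj a b) :
    ∃ S', DecomposesOn G A S' ∧ (∀ X ∈ S', X.card ≤ k + 1) ∧ (∀ X ∈ S, X ∈ S') ∧
      ∃ X ∈ S', (a ∈ X ∨ b ∈ X) ∧ X.card ≤ k := by
  classical
  have key : ∀ (L R : List (Finset V)) (X : Finset V) (a b : V), S = L ++ X :: R → a ∈ X →
      b ∈ X → a ≠ b → (∀ Z ∈ R, a ∉ Z) → ∃ S', DecomposesOn G A S' ∧ (∀ X ∈ S', X.card ≤ k + 1) ∧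
        (∀ X ∈ S, X ∈ S') ∧ ∃ X ∈ S', b ∈ X ∧ X.card ≤ k := by
    rintro L R X a b rfl haX hbX hne hR
    have hcard : (X.erase a).card ≤ k := by
      rw [Finset.card_erase_of_mem haX]
      have := hk X (by simp)
      omega
    refine ⟨L ++ X :: X.erase a :: R, h.insertSubbag (Finset.erase_subset _ _) ?_, ?_, ?_,
      X.erase a, by simp, by simp [hbX, hne.symm], hcard⟩
    · intro v hv hv' Z hZ
      simp only [Finset.mem_erase, hv, and_true, not_not] at hv'
      subst hv'
      exact hR Z hZ
    · intro Z hZ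
      by_cases hZX : Z = X.erase a
      · rw [hZX]
        omega
      · refine hk Z ?_
        simp only [List.mem_append, List.mem_cons] at hZ ⊢
        tauto
    · intro Z hZ
      simp only [List.mem_append, List.mem_cons] at hZ ⊢
      tauto
  -- Take the last bag containing both endpoints. One endpoint is absent from all later bags;
  -- repeating the bag without it gives a bag of size at most `k` that contains the other endpoint.
  obtain ⟨L, X, R, hS, ⟨haX, hbX⟩, hlast⟩ := exists_append_last (h.edge a ha b hb hab)
  by_cases haR : ∀ Z ∈ R, a ∉ Z
  · obtain ⟨S', h1, h2, h3, Y, h4, h5, h6⟩ := key L R X a b hS haX hbX hab.ne haR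
    exact ⟨S', h1, h2, h3, Y, h4, Or.inr h5, h6⟩
  by_cases hbR : ∀ Z ∈ R, b ∉ Z
  · obtain ⟨S', h1, h2, h3, Y, h4, h5, h6⟩ := key L R X b a hS hbX haX hab.ne.symm hbR
    exact ⟨S', h1, h2, h3, Y, h4, Or.inl h5, h6⟩
  -- If both endpoints reappeared later, the interval condition would put both into the earlier of
  -- the two bags, contradicting the choice of the last common bag.
  exfalso
  push Not at haR hbR
  obtain ⟨Z, hZ, haZ⟩ := haR
  obtain ⟨W, hW, hbW⟩ := hbR
  have hX : ∀ P Q, [P, Q].Sublist R → [X, P, Q].Sublist S := by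
    intro P Q hPQ
    rw [hS, sublist_three_append, sublist_three_cons]
    exact Or.inr (Or.inr (Or.inr (Or.inl ⟨rfl, hPQ⟩)))
  rcases sublist_two_of_mem hZ hW with rfl | hZW | hWZ
  · exact hlast Z hZ ⟨haZ, hbW⟩
  · exact hlast Z hZ ⟨haZ, h.interval _ _ _ (hX _ _ hZW) b hbX hbW⟩
  · exact hlast W hW ⟨h.interval _ _ _ (hX _ _ hWZ) a haX haZ, hbW⟩

/-- Any decomposition can be refined so that every edge has an endpoint in a small bag. -/
theorem DecomposesOn.exists_slack [Finite V] {G : SimpleGraph V} {A : Set V} {S : List (Finset V)}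
    {k : ℕ} (h : DecomposesOn G A S) (hk : ∀ X ∈ S, X.card ≤ k + 1) :
    ∃ S', DecomposesOn G A S' ∧ (∀ X ∈ S', X.card ≤ k + 1) ∧ (∀ X ∈ S, X ∈ S') ∧
      ∀ a ∈ A, ∀ b ∈ A, G.Adj a b → ∃ X ∈ S', (a ∈ X ∨ b ∈ X) ∧ X.card ≤ k := by
  -- The edges are treated one at a time. Each refinement keeps all existing bags, so small bags
  -- found earlier survive.
  have key : ∀ l : List (V × V), ∃ S', DecomposesOn G A S' ∧ (∀ X ∈ S', X.card ≤ k + 1) ∧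
      (∀ X ∈ S, X ∈ S') ∧ ∀ p ∈ l, p.1 ∈ A → p.2 ∈ A → G.Adj p.1 p.2 →
        ∃ X ∈ S', (p.1 ∈ X ∨ p.2 ∈ X) ∧ X.card ≤ k := by
    intro l
    induction l with
    | nil => exact ⟨S, h, hk, fun _ => id, by simp⟩
    | cons p l ih =>
      obtain ⟨S', h1, h2, h3, h4⟩ := ih
      by_cases hp : p.1 ∈ A ∧ p.2 ∈ A ∧ G.Adj p.1 p.2
      · obtain ⟨T, t1, t2, t3, t4⟩ := h1.exists_slack_edge h2 hp.1 hp.2.1 hp.2.2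
        refine ⟨T, t1, t2, fun X hX => t3 X (h3 X hX), ?_⟩
        intro q hq hq1 hq2 hq3
        rcases List.mem_cons.1 hq with rfl | hq
        · exact t4
        · obtain ⟨X, hX, hX'⟩ := h4 q hq hq1 hq2 hq3
          exact ⟨X, t3 X hX, hX'⟩
      · refine ⟨S', h1, h2, h3, ?_⟩
        intro q hq hq1 hq2 hq3
        rcases List.mem_cons.1 hq with rfl | hq
        · exact absurd ⟨hq1, hq2, hq3⟩ hp
        · exact h4 q hq hq1 hq2 hq3
  have := Fintype.ofFinite V
  obtain ⟨S', h1, h2, h3, h4⟩ := key Finset.univ.toList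
  exact ⟨S', h1, h2, h3, fun a ha b hb hab => h4 (a, b) (by simp) ha hb hab⟩

/-- The decomposition with the single bag `V` shows that the infimum is over a nonempty set, hence
attained. -/
theorem exists_decomposition_pathwidth [Finite V] (G : SimpleGraph V) :
    ∃ S, DecomposesOn G Set.univ S ∧ bagWidth S = pathwidth G := by
  have := Fintype.ofFinite V
  have hne : {w | ∃ S, IsPathDecomposition G S ∧ bagWidth S = w}.Nonempty := by
    refine ⟨_, [Finset.univ], isPathDecomposition_iff.2 ⟨?_, ?_, ?_, ?_⟩, rfl⟩
    · simp
    · simp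
    · simp
    · intro X Y Z hs
      simpa using hs.length_le
  obtain ⟨S, h1, h2⟩ := Nat.sInf_mem hne
  exact ⟨S, isPathDecomposition_iff.1 h1, h2⟩

theorem pathwidth_le_iff [Finite V] {G : SimpleGraph V} {w : ℕ} :
    pathwidth G ≤ w ↔ HasBags G Set.univ (w + 1) := by
  constructor
  · intro h
    obtain ⟨S, h1, h2⟩ := exists_decomposition_pathwidth G
    exact ⟨S, h1, bagWidth_le_iff.1 (h2.trans_le h)⟩
  · rintro ⟨S, h1, h2⟩
    have hS : pathwidth G ≤ bagWidth S := Nat.sInf_le ⟨S, isPathDecomposition_iff.2 h1, rfl⟩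
    exact hS.trans (bagWidth_le_iff.2 h2)

/-- That the bags of `S` survive matters later: small bags already known to contain prescribed
vertices remain available. -/
theorem exists_isSlackDecomposition [Finite V] (G : SimpleGraph V) {S : List (Finset V)}
    (h : DecomposesOn G Set.univ S) (hS : bagWidth S = pathwidth G) :
    ∃ S', IsSlackDecomposition G S' ∧ ∀ X ∈ S, X ∈ S' := by
  obtain ⟨S', h1, h2, h3, h4⟩ := h.exists_slack (bagWidth_le_iff.1 hS.le)
  have hw : bagWidth S' = pathwidth G :=
    le_antisymm (bagWidth_le_iff.2 h2)
      (pathwidth_le_iff.2 (show HasBags G Set.univ _ from ⟨S', h1, bagWidth_le_iff.1 le_rfl⟩))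
  refine ⟨S', ⟨isPathDecomposition_iff.2 h1, hw, ?_⟩, h3⟩
  intro a b hab
  rw [hw]
  exact h4 a trivial b trivial hab

/-! ### A lower bound for the pathwidth -/

/-- Any two elements of `W` are joined by a walk inside `W`. -/
def ConnOn (G : SimpleGraph V) (W : Set V) : Prop :=
  ∀ a ∈ W, ∀ b ∈ W, Relation.ReflTransGen (fun x y => G.Adj x y ∧ y ∈ W) a b

theorem ConnOn.singleton (G : SimpleGraph V) (u : V) : ConnOn G {u} := by
  rintro a rfl b rfl
  exact .refl

theorem ConnOn.union {G : SimpleGraph V} {A B : Set V} (hA : ConnOn G A) (hB : ConnOn G B)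
    {x y : V} (hx : x ∈ A) (hy : y ∈ B) (hxy : x = y ∨ G.Adj x y) : ConnOn G (A ∪ B) := by
  have hA' : ∀ a ∈ A, ∀ b ∈ A, Relation.ReflTransGen (fun x y => G.Adj x y ∧ y ∈ A ∪ B) a b :=
    fun a ha b hb => (hA a ha b hb).lift id fun _ _ h => ⟨h.1, Or.inl h.2⟩
  have hB' : ∀ a ∈ B, ∀ b ∈ B, Relation.ReflTransGen (fun x y => G.Adj x y ∧ y ∈ A ∪ B) a b :=
    fun a ha b hb => (hB a ha b hb).lift id fun _ _ h => ⟨h.1, Or.inr h.2⟩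
  rintro a (ha | ha) b (hb | hb)
  · exact hA' a ha b hb
  · refine (hA' a ha x hx).trans (.trans ?_ (hB' y hy b hb))
    rcases hxy with rfl | hxy
    · exact .refl
    · exact .single ⟨hxy, Or.inr hy⟩
  · refine (hB' a ha y hy).trans (.trans ?_ (hA' x hx b hb))
    rcases hxy with rfl | hxy
    · exact .refl
    · exact .single ⟨hxy.symm, Or.inl hx⟩
  · exact hB' a ha b hb

/-- A connected set that meets two bags meets every bag between them. -/
theorem ConnOn.meets_middle {G : SimpleGraph V} {A W : Set V} {S : List (Finset V)}
    (hS : DecomposesOn G A S) (hW : ConnOn G W) (hWA : W ⊆ A) {X Y Z : Finset V}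
    (hs : [X, Y, Z].Sublist S) {x z : V} (hx : x ∈ X) (hz : z ∈ Z) (hxW : x ∈ W) (hzW : z ∈ W) :
    ∃ y ∈ Y, y ∈ W := by
  by_contra hcon
  push Not at hcon
  obtain ⟨L, R, rfl, hXL, hZR⟩ : ∃ L R, S = L ++ Y :: R ∧ X ∈ L ∧ Z ∈ R := by
    have hs' : ([X] ++ [Y, Z]).Sublist S := hs
    obtain ⟨L, R', rfl, h1, h2⟩ := List.append_sublist_iff.1 hs'
    have h2' : ([Y] ++ [Z]).Sublist R' := h2
    obtain ⟨M, R, rfl, h3, h4⟩ := List.append_sublist_iff.1 h2'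
    obtain ⟨M1, M2, rfl⟩ := List.append_of_mem (List.singleton_sublist.1 h3)
    exact ⟨L ++ M1, M2 ++ R, by simp, by simp [List.singleton_sublist.1 h1],
      by simp [List.singleton_sublist.1 h4]⟩
  -- Suppose `Y` misses `W`. Then no vertex of `W` has bags on both sides of `Y`. Each edge lies in
  -- a common bag, so a walk inside `W` that starts on the left can never reach the right.
  have hsep : ∀ w ∈ W, ∀ P ∈ L, ∀ Q ∈ R, w ∈ P → w ∈ Q → False := by
    intro w hw P hP Q hQ hwP hwQ
    refine hcon w (hS.interval P Y Q ?_ w hwP hwQ) hw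
    rw [sublist_three_append, sublist_two_cons]
    exact Or.inr (Or.inr (Or.inl ⟨hP, Or.inl ⟨rfl, hQ⟩⟩))
  have hleft : ∀ w, Relation.ReflTransGen (fun x y => G.Adj x y ∧ y ∈ W) x w →
      w ∈ W ∧ ∃ P ∈ L, w ∈ P := by
    intro w hw
    induction hw with
    | refl => exact ⟨hxW, X, hXL, hx⟩
    | tail _ hbc ih =>
      obtain ⟨hbW, P, hP, hbP⟩ := ih
      obtain ⟨T, hT, hbT, hcT⟩ := hS.edge _ (hWA hbW) _ (hWA hbc.2) hbc.1
      simp only [List.mem_append, List.mem_cons] at hT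
      rcases hT with hT | rfl | hT
      · exact ⟨hbc.2, T, hT, hcT⟩
      · exact absurd hbW (hcon _ hbT)
      · exact (hsep _ hbW P hP T hT hbP hbT).elim
  obtain ⟨-, P, hP, hzP⟩ := hleft z (hW x hxW z hzW)
  exact hsep z hzW P hP Z hZR hzP hz

theorem not_hasBags_zero {G : SimpleGraph V} {A : Set V} (hA : A.Nonempty) : ¬ HasBags G A 0 := by
  rintro ⟨S, h1, h2⟩
  obtain ⟨a, ha⟩ := hA
  obtain ⟨X, hX, haX⟩ := h1.vertex a ha
  have := h2 X hX
  rw [Nat.le_zero, Finset.card_eq_zero] at this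
  simp [this] at haX

/-- Three disjoint parts of pathwidth at least `k`, any two of which are joined outside the third,
force pathwidth at least `k + 1`. -/
theorem not_hasBags_of_three {G : SimpleGraph V} {A X₁ X₂ X₃ : Set V} {k : ℕ}
    (h₁ : X₁ ⊆ A) (h₂ : X₂ ⊆ A) (h₃ : X₃ ⊆ A) (w₁ : ¬ HasBags G X₁ k) (w₂ : ¬ HasBags G X₂ k)
    (w₃ : ¬ HasBags G X₃ k)
    (c₁ : ∃ W ⊆ A, ConnOn G W ∧ Disjoint W X₁ ∧ X₂ ⊆ W ∧ X₃ ⊆ W)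
    (c₂ : ∃ W ⊆ A, ConnOn G W ∧ Disjoint W X₂ ∧ X₁ ⊆ W ∧ X₃ ⊆ W)
    (c₃ : ∃ W ⊆ A, ConnOn G W ∧ Disjoint W X₃ ∧ X₁ ⊆ W ∧ X₂ ⊆ W) :
    ¬ HasBags G A (k + 1) := by
  classical
  rintro ⟨S, hS, hk⟩
  -- Restrict all bags to `X`. Bags not contained in `X` lose a vertex and get size at most `k`, so
  -- some nonempty bag must lie entirely inside `X`.
  have big : ∀ X ⊆ A, ¬ HasBags G X k → ∃ B ∈ S, (∀ b ∈ B, b ∈ X) ∧ B.Nonempty := by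
    intro X hXA hX
    by_contra hcon
    push Not at hcon
    refine hX ⟨_, hS.restrict G hXA fun _ _ _ _ => id, ?_⟩
    intro Y hY
    obtain ⟨B, hB, rfl⟩ := List.mem_map.1 hY
    have hle : (B.filter (· ∈ X)).card ≤ B.card := Finset.card_le_card (Finset.filter_subset _ _)
    by_cases hall : ∀ b ∈ B, b ∈ X
    · have := hcon B hB hall
      simp [this]
    · push Not at hall
      obtain ⟨b, hb, hbX⟩ := hall
      have hlt : (B.filter (· ∈ X)).card < B.card :=
        Finset.card_lt_card (Finset.filter_ssubset.2 ⟨b, hb, hbX⟩)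
      have := hk B hB
      omega
  obtain ⟨B₁, hB₁, s₁, b₁, m₁⟩ := big X₁ h₁ w₁
  obtain ⟨B₂, hB₂, s₂, b₂, m₂⟩ := big X₂ h₂ w₂
  obtain ⟨B₃, hB₃, s₃, b₃, m₃⟩ := big X₃ h₃ w₃
  have mid : ∀ (X Y Z : Finset V) (Q : Set V) (x z : V), [X, Y, Z].Sublist S →
      (∀ y ∈ Y, y ∈ Q) → x ∈ X → z ∈ Z →
      (∃ W ⊆ A, ConnOn G W ∧ Disjoint W Q ∧ x ∈ W ∧ z ∈ W) → False := by
    rintro X Y Z Q x z hs hQ hx hz ⟨W, hWA, hW, hd, hxW, hzW⟩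
    obtain ⟨y, hy, hyW⟩ := hW.meets_middle hS hWA hs hx hz hxW hzW
    exact Set.disjoint_left.1 hd hyW (hQ y hy)
  obtain ⟨W₁, k₁, l₁, d₁, e₁, f₁⟩ := c₁
  obtain ⟨W₂, k₂, l₂, d₂, e₂, f₂⟩ := c₂
  obtain ⟨W₃, k₃, l₃, d₃, e₃, f₃⟩ := c₃
  have n₁₂ : B₁ ≠ B₂ := by
    rintro rfl
    exact Set.disjoint_left.1 d₁ (e₁ (s₂ _ m₁)) (s₁ _ m₁)
  have n₁₃ : B₁ ≠ B₃ := by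
    rintro rfl
    exact Set.disjoint_left.1 d₁ (f₁ (s₃ _ m₁)) (s₁ _ m₁)
  have n₂₃ : B₂ ≠ B₃ := by
    rintro rfl
    exact Set.disjoint_left.1 d₂ (f₂ (s₃ _ m₂)) (s₂ _ m₂)
  -- One of the three bags lies between the other two. The connected set joining the outer two parts
  -- must meet it, yet avoids the part that contains it.
  have cases3 : [B₁, B₂, B₃].Sublist S ∨ [B₁, B₃, B₂].Sublist S ∨ [B₂, B₁, B₃].Sublist S ∨
      [B₂, B₃, B₁].Sublist S ∨ [B₃, B₁, B₂].Sublist S ∨ [B₃, B₂, B₁].Sublist S := by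
    obtain ⟨P, R, rfl⟩ := List.append_of_mem hB₁
    simp only [List.mem_append, List.mem_cons, n₁₂.symm, n₁₃.symm, false_or] at hB₂ hB₃
    simp only [sublist_three_append, sublist_three_cons, sublist_two_cons,
      List.mem_cons]
    rcases hB₂ with hB₂ | hB₂ <;> rcases hB₃ with hB₃ | hB₃
    · rcases sublist_two_of_mem hB₂ hB₃ with h | h | h
      · exact absurd h n₂₃
      · simp [h]
      · simp [h]
    · simp [hB₂, hB₃]
    · simp [hB₂, hB₃]
    · rcases sublist_two_of_mem hB₂ hB₃ with h | h | h
      · exact absurd h n₂₃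
      · simp [h]
      · simp [h]
  rcases cases3 with h | h | h | h | h | h
  · exact mid _ _ _ _ _ _ h s₂ m₁ m₃ ⟨W₂, k₂, l₂, d₂, e₂ (s₁ _ m₁), f₂ (s₃ _ m₃)⟩
  · exact mid _ _ _ _ _ _ h s₃ m₁ m₂ ⟨W₃, k₃, l₃, d₃, e₃ (s₁ _ m₁), f₃ (s₂ _ m₂)⟩
  · exact mid _ _ _ _ _ _ h s₁ m₂ m₃ ⟨W₁, k₁, l₁, d₁, e₁ (s₂ _ m₂), f₁ (s₃ _ m₃)⟩
  · exact mid _ _ _ _ _ _ h s₃ m₂ m₁ ⟨W₃, k₃, l₃, d₃, f₃ (s₂ _ m₂), e₃ (s₁ _ m₁)⟩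
  · exact mid _ _ _ _ _ _ h s₁ m₃ m₂ ⟨W₁, k₁, l₁, d₁, f₁ (s₃ _ m₃), e₁ (s₂ _ m₂)⟩
  · exact mid _ _ _ _ _ _ h s₂ m₃ m₁ ⟨W₂, k₂, l₂, d₂, f₂ (s₃ _ m₃), e₂ (s₁ _ m₁)⟩

end Bags

/-! ### Single-peakedness on trees as a local condition -/

/-- Following parents increases the bounded rank `st` and so ends in `z`, which gives connectedness.
Each edge is `{a, f a}` for some `a ≠ z`, so there are at most `|V| - 1` edges. -/
theorem isTree_of_parent {V : Type*} [Finite V] {G : SimpleGraph V} (z : V) (f : V → V)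
    (st : V → ℕ) (hst : ∀ a, a ≠ z → st a < st (f a))
    (hG : ∀ a b, G.Adj a b ↔ (a ≠ z ∧ f a = b) ∨ (b ≠ z ∧ f b = a)) : G.IsTree := by
  obtain ⟨M, hM⟩ := (Set.finite_range st).bddAbove
  have hM' : ∀ a, st a ≤ M := fun a => hM ⟨a, rfl⟩
  have hreach : ∀ k a, M - st a = k → G.Reachable a z := by
    intro k
    induction k using Nat.strong_induction_on with
    | _ k ih =>
      intro a ha
      by_cases haz : a = z
      · subst haz
        exact .refl _
      · have h1 := hst a haz
        have h2 := hM' (f a)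
        exact (SimpleGraph.Adj.reachable ((hG _ _).2 (Or.inl ⟨haz, rfl⟩))).trans
          (ih _ (by omega) (f a) rfl)
  have hconn : G.Connected := by
    have : Nonempty V := ⟨z⟩
    exact ⟨fun a b => (hreach _ a rfl).trans (hreach _ b rfl).symm⟩
  refine SimpleGraph.isTree_iff_connected_and_card.2
    ⟨hconn, le_antisymm ?_ hconn.card_vert_le_card_edgeSet_add_one⟩
  have hsub : G.edgeSet ⊆ (fun a => s(a, f a)) '' {z}ᶜ := by
    intro e
    induction e with
    | _ a b =>
      intro he
      rcases (hG a b).1 he with ⟨h1, h2⟩ | ⟨h1, h2⟩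
      · exact ⟨a, h1, by simp [h2]⟩
      · exact ⟨b, h1, by simp [h2, Sym2.eq_swap]⟩
  have h1 : G.edgeSet.ncard ≤ ({z}ᶜ : Set V).ncard :=
    (Set.ncard_le_ncard hsub (Set.toFinite _)).trans (Set.ncard_image_le (Set.toFinite _))
  have h2 : ({z} : Set V).ncard + ({z}ᶜ : Set V).ncard = Nat.card V := Set.ncard_add_ncard_compl _
  rw [Set.ncard_singleton] at h2
  change G.edgeSet.ncard + 1 ≤ _
  omega

namespace Profile

variable {n : ℕ} {C : Type*} {P : Profile n C} {i : Fin n} {T : SimpleGraph C} {S : Set C}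

theorem prefers_trans {a b c : C} (h : P.prefers i a b) (h' : P.prefers i b c) :
    P.prefers i a c :=
  (P.strictTotal i).toIsStrictOrder.toIsTrans.trans _ _ _ h h'

theorem prefers_irrefl (a : C) : ¬ P.prefers i a a :=
  (P.strictTotal i).toIsStrictOrder.toIrrefl.irrefl a

theorem prefers_asymm {a b : C} (h : P.prefers i a b) : ¬ P.prefers i b a :=
  fun h' => prefers_irrefl a (prefers_trans h h')

theorem prefers_total {a b : C} (h : a ≠ b) : P.prefers i a b ∨ P.prefers i b a := by
  by_contra hcon
  push Not at hcon
  exact h ((P.strictTotal i).toTrichotomous.trichotomous a b hcon.1 hcon.2)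

theorem exists_isTop [Finite C] (hS : S.Nonempty) : ∃ a, P.IsTop i S a := by
  have := (P.strictTotal i).toIsStrictOrder.toIsTrans
  have := (P.strictTotal i).toIsStrictOrder.toIrrefl
  obtain ⟨a, ha, h⟩ := (Finite.wellFounded_of_trans_of_irrefl (P.prefers i)).has_min S hS
  exact ⟨a, ha, fun b hb hba => (prefers_total hba).resolve_left (h b hb)⟩

theorem exists_isBottom [Finite C] (hS : S.Nonempty) : ∃ a, P.IsBottom i S a := by
  have := (P.strictTotal i).toIsStrictOrder.toIsTrans
  have := (P.strictTotal i).toIsStrictOrder.toIrrefl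
  obtain ⟨a, ha, h⟩ :=
    (Finite.wellFounded_of_trans_of_irrefl (Function.swap (P.prefers i))).has_min S hS
  exact ⟨a, ha, fun b hb hba => (prefers_total hba).resolve_right (h b hb)⟩

theorem IsTop.unique {a b : C} (ha : P.IsTop i S a) (hb : P.IsTop i S b) : a = b := by
  by_contra h
  exact prefers_asymm (ha.2 b hb.1 (Ne.symm h)) (hb.2 a ha.1 h)

theorem bottoms_subset : P.bottoms S ⊆ S := fun _ ⟨_, h⟩ => h.1

theorem bottoms_nonempty [Finite C] (hn : 0 < n) (hS : S.Nonempty) : (P.bottoms S).Nonempty := by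
  obtain ⟨a, ha⟩ := exists_isBottom (P := P) (i := ⟨0, hn⟩) hS
  exact ⟨a, _, ha⟩

theorem mem_and_ne_of_mem_attachSet (hn : 0 < n) {a b : C} (h : b ∈ P.attachSet S a) :
    b ∈ S ∧ b ≠ a := by
  obtain ⟨h1, h2⟩ := Set.mem_iInter.1 h ⟨0, hn⟩
  refine ⟨h1, ?_⟩
  rintro rfl
  rcases h2 with ⟨-, h2⟩ | ⟨h2, x, hx, hb⟩
  · exact prefers_irrefl _ h2
  · exact hb.1.2 (h2.unique hx)

/-- No candidate has two neighbours which a voter both prefers to it. -/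
def LocallyPeaked (P : Profile n C) (T : SimpleGraph C) : Prop :=
  ∀ (i : Fin n) (a b b' : C), T.Adj a b → T.Adj a b' → b ≠ b' → P.prefers i b a →
    ¬ P.prefers i b' a

/-- After one step down, a step up would give the vertex in between two neighbours that are
preferred to it. So the preference decreases along the entire path. -/
theorem LocallyPeaked.pairwise_support (h : P.LocallyPeaked T) {a b c : C} (hab : T.Adj a b)
    (q : T.Walk b c) (hq : (SimpleGraph.Walk.cons hab q).IsPath) (hpref : P.prefers i a b) :
    (SimpleGraph.Walk.cons hab q).support.Pairwise (P.prefers i) := by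
  induction q generalizing a with
  | nil => simpa using hpref
  | @cons b d c hbd q ih =>
    have hq' := hq.of_cons
    have had : a ≠ d := by
      rintro rfl
      rw [SimpleGraph.Walk.cons_isPath_iff] at hq
      exact hq.2 (by simp)
    have hbd' : P.prefers i b d := by
      refine (prefers_total hbd.ne).resolve_right fun hdb => ?_
      exact h i b a d hab.symm hbd had hpref hdb
    have := ih hbd hq' hbd'
    rw [SimpleGraph.Walk.support_cons, List.pairwise_cons]
    refine ⟨fun v hv => ?_, this⟩
    rw [SimpleGraph.Walk.support_cons, List.pairwise_cons] at this
    rw [SimpleGraph.Walk.support_cons, List.mem_cons] at hv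
    rcases hv with rfl | hv
    · exact hpref
    · exact prefers_trans hpref (this.1 v hv)

/-- The first step away from a voter's top goes down, so the whole path does. -/
theorem LocallyPeaked.singlePeakedOn (h : P.LocallyPeaked T) : P.SinglePeakedOn T := by
  intro i x a b hx hab p hp hb
  refine ⟨(eq_or_ne b x).imp_right fun hbx => hx.2 b trivial hbx, ?_⟩
  cases p with
  | nil => simp at hb; exact absurd hb.symm hab
  | @cons _ c _ hxc q =>
    have hpw := h.pairwise_support hxc q hp (hx.2 c trivial hxc.ne.symm)
    have hne : (SimpleGraph.Walk.cons hxc q).support ≠ [] := by simp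
    rw [← List.dropLast_append_getLast hne, SimpleGraph.Walk.getLast_support] at hpw hb
    rw [List.pairwise_append] at hpw
    rcases List.mem_append.1 hb with hb | hb
    · exact hpw.2.2 b hb a (by simp)
    · exact absurd (by simpa using hb) hab.symm

theorem SinglePeakedOn.locallyPeaked [Finite C] (hT : T.IsTree) (h : P.SinglePeakedOn T) :
    P.LocallyPeaked T := by
  intro i a b b' hab hab' hne hba hba'
  obtain ⟨x, hx⟩ := exists_isTop (P := P) (i := i) (S := Set.univ) ⟨a, trivial⟩
  obtain ⟨p, hp, -⟩ := hT.existsUnique_path x a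
  -- If `b` were not on the path from the top to `a`, that path could be extended to `b`, and then
  -- `a` would be preferred to `b`. Both neighbours are therefore the penultimate vertex of the same
  -- path.
  have key : ∀ b, T.Adj a b → P.prefers i b a → b ∈ p.support := by
    intro b hab hba
    by_contra hb
    have := (h i x b a hx hab.ne.symm (p.concat hab) (hp.concat hb hab) (by simp)).2
    exact prefers_asymm hba this
  exact hne ((hT.isAcyclic.eq_penultimate_of_adj_end hp hab (key b hab hba)).trans
    (hT.isAcyclic.eq_penultimate_of_adj_end hp hab' (key b' hab' hba')).symm)

/-- Any two vertices of `S` are joined by a path inside `S`. -/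
def ConnIn (T : SimpleGraph C) (S : Set C) : Prop :=
  ∀ a ∈ S, ∀ c ∈ S, ∃ p : T.Walk a c, p.IsPath ∧ ∀ v ∈ p.support, v ∈ S

theorem connIn_univ (hT : T.Connected) : ConnIn T Set.univ := by
  intro a _ c _
  obtain ⟨p, hp⟩ := hT.exists_isPath a c
  exact ⟨p, hp, fun _ _ => trivial⟩

/-- All neighbours within `S` beat the bottom candidate, so there is at most one: bottoms are
leaves. -/
theorem LocallyPeaked.eq_of_bottom (h : P.LocallyPeaked T) {a b b' : C} (ha : P.IsBottom i S a)
    (hb : b ∈ S) (hb' : b' ∈ S) (hab : T.Adj a b) (hab' : T.Adj a b') : b = b' := by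
  by_contra hne
  exact h i a b b' hab hab' hne (ha.2 b hb hab.ne.symm) (ha.2 b' hb' hab'.ne.symm)

/-- All paths inside `S` from the leaf `a` start with the same neighbour `b`. A voter with top `a`
decreases along them, so `b` is second; a voter who preferred `a` to `b` would likewise prefer `a`
to all of `S`, hence have top `a`. -/
theorem LocallyPeaked.exists_attach (h : P.LocallyPeaked T) (hS : ConnIn T S) {a c : C}
    (ha : a ∈ P.bottoms S) (hc : c ∈ S) (hca : c ≠ a) :
    ∃ b ∈ P.attachSet S a, T.Adj a b := by
  obtain ⟨j, hj⟩ := ha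
  have path : ∀ c ∈ S, c ≠ a → ∃ (b : C) (hab : T.Adj a b) (q : T.Walk b c), b ∈ S ∧
      (SimpleGraph.Walk.cons hab q).IsPath := by
    intro c hc hca
    obtain ⟨p, hp, hp'⟩ := hS a hj.1 c hc
    cases p with
    | nil => exact absurd rfl hca
    | @cons _ b _ hab q => exact ⟨b, hab, q, hp' b (by simp), hp⟩
  obtain ⟨b, hab, q, hb, hq⟩ := path c hc hca
  have path' : ∀ d ∈ S, d ≠ a → ∃ q : T.Walk b d, (SimpleGraph.Walk.cons hab q).IsPath := by
    intro d hd hda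
    obtain ⟨b', hab', q', hb', hq'⟩ := path d hd hda
    obtain rfl := h.eq_of_bottom hj hb hb' hab hab'
    exact ⟨q', hq'⟩
  refine ⟨b, Set.mem_iInter.2 fun i => ⟨hb, ?_⟩, hab⟩
  by_cases htop : P.IsTop i S a
  · refine Or.inr ⟨htop, a, htop, ⟨hb, hab.ne.symm⟩, ?_⟩
    rintro d ⟨hd, hda⟩ hdb
    obtain ⟨q', hq'⟩ := path' d hd hda
    have := h.pairwise_support hab q' hq' (htop.2 b hb hab.ne.symm)
    rw [SimpleGraph.Walk.support_cons, List.pairwise_cons, ← SimpleGraph.Walk.cons_tail_support,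
      List.pairwise_cons] at this
    refine this.2.1 d ?_
    have hd' := q'.end_mem_support
    rw [← SimpleGraph.Walk.cons_tail_support, List.mem_cons] at hd'
    exact hd'.resolve_left hdb
  · refine Or.inl ⟨htop, ?_⟩
    have hd : ∃ d ∈ S, d ≠ a ∧ ¬ P.prefers i a d := by
      by_contra hcon
      push Not at hcon
      exact htop ⟨hj.1, hcon⟩
    obtain ⟨d, hd, hda, had⟩ := hd
    obtain ⟨q', hq'⟩ := path' d hd hda
    refine (prefers_total hab.ne).resolve_left fun hpref => had ?_
    have := h.pairwise_support hab q' hq' hpref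
    rw [SimpleGraph.Walk.support_cons, List.pairwise_cons] at this
    exact this.1 d q'.end_mem_support

/-- A voter with top `a` has `b` second, and a third candidate of `S` is worse than `b`; this is
where three candidates are needed. Other voters prefer `b` to `a`. So arcs never stay inside a
stage. -/
theorem notMem_bottoms_of_mem_attachSet (h3 : 3 ≤ S.ncard) {a b : C} (ha : a ∈ S)
    (hb : b ∈ P.attachSet S a) : b ∉ P.bottoms S := by
  rintro ⟨i, hbot⟩
  obtain ⟨hbS, h | ⟨htop, x, hx, hsec⟩⟩ := Set.mem_iInter.1 hb i
  · refine prefers_asymm h.2 (hbot.2 a ha ?_)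
    rintro rfl
    exact prefers_irrefl _ h.2
  · obtain rfl := htop.unique hx
    obtain ⟨c, hc, hc'⟩ := Set.exists_mem_notMem_of_ncard_lt_ncard (s := {a, b}) (t := S)
      ((Set.ncard_insert_le _ _).trans_lt (by rw [Set.ncard_singleton]; omega))
    simp only [Set.mem_insert_iff, Set.mem_singleton_iff, not_or] at hc'
    exact prefers_asymm (hbot.2 c hc hc'.2) (hsec.2 c ⟨hc, hc'.1⟩ hc'.2)

theorem exists_two_adj_of_mem_support {a c v : C} (p : T.Walk a c) (hp : p.IsPath)
    (hv : v ∈ p.support) (hva : v ≠ a) (hvc : v ≠ c) :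
    ∃ w ∈ p.support, ∃ w' ∈ p.support, w ≠ w' ∧ T.Adj v w ∧ T.Adj v w' := by
  induction p with
  | nil => simp at hv; exact absurd hv hva
  | @cons a b c hab q ih =>
    rw [SimpleGraph.Walk.support_cons, List.mem_cons] at hv
    by_cases hvb : v = b
    · subst hvb
      cases q with
      | nil => exact absurd rfl hvc
      | @cons _ d _ hbd q' =>
        refine ⟨a, by simp, d, by simp, ?_, hab.symm, hbd⟩
        rintro rfl
        rw [SimpleGraph.Walk.cons_isPath_iff] at hp
        exact hp.2 (by simp)
    · obtain ⟨w, hw, w', hw', h⟩ := ih hp.of_cons (hv.resolve_left hva) hvb hvc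
      exact ⟨w, by simp [hw], w', by simp [hw'], h⟩

/-- An inner vertex of a path has two neighbours on it, whereas a bottom has at most one in `S`.
Hence paths between remaining candidates avoid the removed ones. -/
theorem LocallyPeaked.connIn_diff (h : P.LocallyPeaked T) (hS : ConnIn T S) :
    ConnIn T (S \ P.bottoms S) := by
  intro a ha c hc
  obtain ⟨p, hp, hp'⟩ := hS a ha.1 c hc.1
  refine ⟨p, hp, fun v hv => ⟨hp' v hv, ?_⟩⟩
  rintro ⟨i, hi⟩
  have hva : v ≠ a := fun h => ha.2 ⟨i, h ▸ hi⟩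
  have hvc : v ≠ c := fun h => hc.2 ⟨i, h ▸ hi⟩
  obtain ⟨w, hw, w', hw', hne, h1, h2⟩ := exists_two_adj_of_mem_support p hp hv hva hvc
  exact hne (h.eq_of_bottom hi (hp' w hw) (hp' w' hw') h1 h2)

theorem exists_mem_ne {k : ℕ} (h : 2 ≤ k) (hk : k ≤ S.ncard) (a : C) : ∃ c ∈ S, c ≠ a := by
  obtain ⟨c, hc, hc'⟩ := Set.exists_mem_notMem_of_ncard_lt_ncard (s := {a}) (t := S)
    (by rw [Set.ncard_singleton]; omega)
  exact ⟨c, hc, hc'⟩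

theorem LocallyPeaked.exists_builds [Finite C] (hn : 0 < n) (h : P.LocallyPeaked T)
    (hS : ConnIn T S) : ∃ D, P.Builds S D := by
  induction hk : S.ncard using Nat.strong_induction_on generalizing S with
  | _ k ih =>
    by_cases h1 : S.ncard ≤ 1
    · exact ⟨_, .done S h1⟩
    by_cases h2 : S.ncard = 2
    · obtain ⟨x, y, hxy, rfl⟩ := Set.ncard_eq_two.1 h2
      exact ⟨_, .two x y hxy⟩
    have hne : S.Nonempty := (Set.ncard_pos (Set.toFinite S)).1 (by omega)
    obtain ⟨D, hD⟩ := ih (S \ P.bottoms S).ncard (by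
      rw [← hk]
      refine Set.ncard_lt_ncard ?_ (Set.toFinite S)
      obtain ⟨a, ha⟩ := bottoms_nonempty (P := P) hn hne
      exact ⟨Set.sdiff_subset, fun hsub => (hsub (bottoms_subset ha)).2 ha⟩)
      (h.connIn_diff hS) rfl
    refine ⟨_, .step S D (by omega) (fun a ha => ?_) hD⟩
    obtain ⟨c, hc, hca⟩ := exists_mem_ne (S := S) (k := 3) (by omega) (by omega) a
    obtain ⟨b, hb, -⟩ := h.exists_attach hS ha hc hca
    exact ⟨b, hb⟩

/-- The stages of the construction of an attachment digraph: `st a` is the round in which `a` is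
removed, and `z` is the last remaining candidate. -/
structure StagedOn (P : Profile n C) (S : Set C) (D : Digraph C) (st : C → ℕ) (z : C) : Prop where
  sink_mem : z ∈ S
  attach : ∀ a ∈ S, ∀ b, D.Adj a b ↔ b ∈ P.attachSet {c | c ∈ S ∧ st a ≤ st c} a
  arc : ∀ a b, D.Adj a b → a ∈ S ∧ b ∈ S ∧ st a < st b
  sink : ∀ b, ¬ D.Adj z b
  conn : ∀ T, P.LocallyPeaked T → ConnIn T S → ∀ k, ConnIn T {c | c ∈ S ∧ k ≤ st c}
  parent : ∀ T, P.LocallyPeaked T → ConnIn T S → ∀ a ∈ S, a ≠ z → ∃ b, D.Adj a b ∧ T.Adj a b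
  edge : ∀ T, P.LocallyPeaked T → ConnIn T S → ∀ a ∈ S, ∀ b ∈ S, T.Adj a b →
    D.Adj a b ∨ D.Adj b a
  nonsink : ∀ a ∈ S, a ≠ z → ∃ b, D.Adj a b

theorem attachSet_singleton (hn : 0 < n) (z b : C) : b ∉ P.attachSet {z} z := by
  intro hb
  obtain ⟨h1, h2⟩ := mem_and_ne_of_mem_attachSet hn hb
  exact h2 h1

theorem ConnIn.empty : ConnIn T ∅ := fun _ h => h.elim

theorem ConnIn.singleton (z : C) : ConnIn T {z} := by
  rintro a rfl c rfl
  exact ⟨.nil, by simp, by simp⟩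

/-- With two candidates left, `B(x) = {y}` whatever the voters think. So the arbitrary last arc fits
the description of all other arcs, with `x` put one stage before `y`. -/
theorem mem_attachSet_pair (hn : 0 < n) {x y b : C} (hxy : x ≠ y) :
    b ∈ P.attachSet {x, y} x ↔ b = y := by
  constructor
  · intro hb
    obtain ⟨h1, h2⟩ := mem_and_ne_of_mem_attachSet hn hb
    exact h1.resolve_left h2
  · rintro rfl
    refine Set.mem_iInter.2 fun i => ⟨by simp, ?_⟩
    rcases prefers_total (P := P) (i := i) hxy with h | h
    · have htop : P.IsTop i {x, b} x := ⟨by simp, by rintro c (rfl | rfl) hc <;> simp_all⟩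
      refine Or.inr ⟨htop, x, htop, ⟨by simp, hxy.symm⟩, ?_⟩
      rintro c ⟨rfl | rfl, hc⟩ hc' <;> simp_all
    · exact Or.inl ⟨fun htop => prefers_asymm h (htop.2 b (by simp) hxy.symm), h⟩

/-- Translates the recursive construction into stage numbers, so that later arguments can compare
stages directly; the current set at the removal of `a` is recovered as the candidates of stage at
least `st a`. -/
theorem Builds.exists_stagedOn [Finite C] (hn : 0 < n) {D : Digraph C} (h : P.Builds S D)
    (hS : S.Nonempty) : ∃ st z, P.StagedOn S D st z := by
  induction h with
  | done S h =>
    obtain ⟨z, rfl⟩ := Set.ncard_eq_one.1 (le_antisymm h ((Set.ncard_pos (Set.toFinite S)).2 hS))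
    refine ⟨fun _ => 0, z, rfl, ?_, by simp, by simp, ?_, ?_, ?_, ?_⟩
    · rintro a rfl b
      simpa using attachSet_singleton hn a b
    · intro T hT hc k
      by_cases hk : k = 0
      · simpa [hk] using hc
      · simpa [hk] using ConnIn.empty
    · rintro T - - a rfl h
      exact absurd rfl h
    · rintro T - - a rfl b rfl h
      exact absurd h T.irrefl
    · rintro a rfl h
      exact absurd rfl h
  | two x y hxy =>
    classical
    refine ⟨fun c => if c = x then 0 else 1, y, by simp, ?_, ?_, ?_, ?_, ?_, ?_, ?_⟩
    · rintro a (rfl | rfl) b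
      · have : {c | c ∈ ({a, y} : Set C) ∧ (if a = a then 0 else 1) ≤ if c = a then 0 else 1} =
            {a, y} := by ext; simp
        rw [this, mem_attachSet_pair hn hxy]
        simp
      · have : {c | c ∈ ({x, a} : Set C) ∧ (if a = x then 0 else 1) ≤ if c = x then 0 else 1} =
            {a} := by
          ext c
          simp only [hxy.symm, if_false, Set.mem_ofPred_eq, Set.mem_insert_iff,
            Set.mem_singleton_iff]
          split_ifs with hc <;> simp [hc, hxy]
        rw [this]
        simpa [hxy.symm] using attachSet_singleton hn a b
    · rintro a b ⟨rfl, rfl⟩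
      simp [hxy.symm]
    · rintro b ⟨h, -⟩
      exact hxy h.symm
    · intro T hT hc k
      rcases Nat.eq_zero_or_pos k with rfl | hk
      · have : {c | c ∈ ({x, y} : Set C) ∧ 0 ≤ if c = x then 0 else 1} = {x, y} := by ext; simp
        rwa [this]
      · have : {c | c ∈ ({x, y} : Set C) ∧ k ≤ if c = x then 0 else 1} ⊆ {y} := by
          rintro c ⟨rfl | rfl, hc⟩
          · rw [if_pos rfl] at hc
            omega
          · rfl
        rcases Set.subset_singleton_iff_eq.1 this with h | h
        · rw [h]
          exact ConnIn.empty
        · rw [h]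
          exact ConnIn.singleton y
    · intro T hT hc a ha hay
      obtain rfl : a = x := ha.resolve_right hay
      obtain ⟨p, hp, hp'⟩ := hc a (by simp) y (by simp)
      cases p with
      | nil => exact absurd rfl hxy
      | @cons _ b _ hab q =>
        have hb : b = y := (hp' b (by simp)).resolve_left hab.ne.symm
        exact ⟨b, ⟨rfl, hb⟩, hab⟩
    · rintro T - - a (rfl | rfl) b (rfl | rfl) hab
      · exact absurd hab T.irrefl
      · exact Or.inl ⟨rfl, rfl⟩
      · exact Or.inr ⟨rfl, rfl⟩
      · exact absurd hab T.irrefl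
    · intro a ha hay
      exact ⟨y, ha.resolve_right hay, rfl⟩
  | step S D h3 hB hD ih =>
    classical
    have hne : (S \ P.bottoms S).Nonempty := by
      obtain ⟨a, ha⟩ := bottoms_nonempty (P := P) hn hS
      obtain ⟨b, hb⟩ := hB a ha
      exact ⟨b, (mem_and_ne_of_mem_attachSet hn hb).1,
        notMem_bottoms_of_mem_attachSet h3 (bottoms_subset ha) hb⟩
    obtain ⟨st, z, hst⟩ := ih hne
    have harc : ∀ a ∈ P.bottoms S, ∀ b, ¬ D.Adj a b := fun a ha b hab => (hst.arc a b hab).1.2 ha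
    have hset : ∀ a, a ∉ P.bottoms S → ∀ k, {c | c ∈ S ∧ (k + 1) ≤ if c ∈ P.bottoms S then 0 else
        st c + 1} = {c | c ∈ S \ P.bottoms S ∧ k ≤ st c} := by
      intro a ha k
      ext c
      simp only [Set.mem_ofPred_eq, Set.mem_sdiff]
      split_ifs with hc <;> simp [hc]
    -- The bottoms of the current round get stage `0`; all later stages shift by one.
    refine ⟨fun c => if c ∈ P.bottoms S then 0 else st c + 1, z, hst.sink_mem.1, ?_, ?_, ?_, ?_,
      ?_, ?_, ?_⟩
    · intro a ha b
      by_cases haL : a ∈ P.bottoms S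
      · simp [haL, harc a haL]
      · simp only [haL, false_and, false_or, if_false]
        rw [hset a haL, hst.attach a ⟨ha, haL⟩]
    · rintro a b (⟨haL, hb⟩ | hab)
      · have hbS := (mem_and_ne_of_mem_attachSet hn hb).1
        have hbL := notMem_bottoms_of_mem_attachSet h3 (bottoms_subset haL) hb
        exact ⟨bottoms_subset haL, hbS, by simp [haL, hbL]⟩
      · obtain ⟨h1, h2, h4⟩ := hst.arc a b hab
        exact ⟨h1.1, h2.1, by simp [h1.2, h2.2, h4]⟩
    · rintro b (⟨hz, -⟩ | hz)
      · exact hst.sink_mem.2 hz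
      · exact hst.sink b hz
    · intro T hT hc k
      cases k with
      | zero => simpa using hc
      | succ k =>
        rw [hset z hst.sink_mem.2]
        exact hst.conn T hT (hT.connIn_diff hc) k
    · intro T hT hc a ha haz
      by_cases haL : a ∈ P.bottoms S
      · obtain ⟨b, hb, hab⟩ := hT.exists_attach hc haL hst.sink_mem.1 haz.symm
        exact ⟨b, Or.inl ⟨haL, hb⟩, hab⟩
      · obtain ⟨b, hb, hab⟩ := hst.parent T hT (hT.connIn_diff hc) a ⟨ha, haL⟩ haz
        exact ⟨b, Or.inr hb, hab⟩
    · intro T hT hc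
      -- A bottom has only one neighbour in `S`, namely the one found in `B(a)`.
      have leaf : ∀ a ∈ P.bottoms S, ∀ b ∈ S, T.Adj a b → b ∈ P.attachSet S a := by
        intro a ha b hb hab
        obtain ⟨b', hb', hab'⟩ := hT.exists_attach hc ha hb hab.ne.symm
        obtain ⟨i, hi⟩ := ha
        rwa [hT.eq_of_bottom hi hb (mem_and_ne_of_mem_attachSet hn hb').1 hab hab']
      intro a ha b hb hab
      by_cases haL : a ∈ P.bottoms S
      · exact Or.inl (Or.inl ⟨haL, leaf a haL b hb hab⟩)
      by_cases hbL : b ∈ P.bottoms S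
      · exact Or.inr (Or.inl ⟨hbL, leaf b hbL a ha hab.symm⟩)
      · exact (hst.edge T hT (hT.connIn_diff hc) a ⟨ha, haL⟩ b ⟨hb, hbL⟩ hab).imp Or.inr Or.inr
    · intro a ha haz
      by_cases haL : a ∈ P.bottoms S
      · obtain ⟨b, hb⟩ := hB a haL
        exact ⟨b, Or.inl ⟨haL, hb⟩⟩
      · obtain ⟨b, hb⟩ := hst.nonsink a ⟨ha, haL⟩ haz
        exact ⟨b, Or.inr hb⟩

end Profile

/-! ### Forced and free vertices -/

namespace Profile

variable {n : ℕ} {C : Type*} {P : Profile n C} {D : Digraph C} {st : C → ℕ} {z : C}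

theorem IsAttachmentDigraph.exists_stagedOn [Finite C] (hn : 0 < n) (h : P.IsAttachmentDigraph D)
    (a : C) : ∃ st z, P.StagedOn Set.univ D st z :=
  Builds.exists_stagedOn hn h ⟨a, trivial⟩

theorem locallyPeaked_of_mem_treeSet [Finite C] {T : SimpleGraph C} (hT : T ∈ P.treeSet) :
    P.LocallyPeaked T ∧ ConnIn T Set.univ :=
  ⟨hT.2.locallyPeaked hT.1, connIn_univ hT.1.connected⟩

theorem exists_isAttachmentDigraph [Finite C] (hn : 0 < n) {T : SimpleGraph C}
    (hT : T ∈ P.treeSet) : ∃ D, P.IsAttachmentDigraph D :=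
  (locallyPeaked_of_mem_treeSet hT).1.exists_builds hn (locallyPeaked_of_mem_treeSet hT).2

theorem StagedOn.adj_iff (h : P.StagedOn Set.univ D st z) (a b : C) :
    D.Adj a b ↔ b ∈ P.attachSet {c | st a ≤ st c} a := by
  simpa using h.attach a trivial b

theorem StagedOn.lt (h : P.StagedOn Set.univ D st z) {a b : C} (hab : D.Adj a b) :
    st a < st b := (h.arc a b hab).2.2

theorem free_iff_not_forced {a : C} : a ∈ free D ↔ a ∉ forced D := by
  simp only [free, forced, Set.mem_ofPred_eq]
  omega

theorem exists_adj_ne_of_free [Finite C] {a : C} (h : a ∈ free D) :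
    ∃ b c, D.Adj a b ∧ D.Adj a c ∧ b ≠ c := by
  obtain ⟨b, hb, c, hc, hne⟩ := (Set.one_lt_ncard (Set.toFinite {b | D.Adj a b})).1 h
  exact ⟨b, c, hb, hc, hne⟩

theorem free_of_adj_ne [Finite C] {a b c : C} (hb : D.Adj a b) (hc : D.Adj a c) (hne : b ≠ c) :
    a ∈ free D :=
  (Set.one_lt_ncard (Set.toFinite {b | D.Adj a b})).2 ⟨b, hb, c, hc, hne⟩

theorem eq_of_forced [Finite C] {a b c : C} (ha : a ∈ forced D) (hb : D.Adj a b)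
    (hc : D.Adj a c) : b = c := by
  by_contra hne
  exact free_iff_not_forced.1 (free_of_adj_ne hb hc hne) ha

/-- If a voter had top `a`, then `B(a)` would be contained in the singleton of that voter's second
candidate. -/
theorem StagedOn.not_isTop_of_free [Finite C] (h : P.StagedOn Set.univ D st z) {a : C}
    (ha : a ∈ free D) (i : Fin n) : ¬ P.IsTop i {c | st a ≤ st c} a := by
  intro htop
  obtain ⟨b, c, hb, hc, hne⟩ := exists_adj_ne_of_free ha
  have key : ∀ b, D.Adj a b → P.IsTop i ({c | st a ≤ st c} \ {a}) b := by
    intro b hb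
    rw [h.adj_iff] at hb
    obtain ⟨-, hb | ⟨-, x, hx, hb⟩⟩ := Set.mem_iInter.1 hb i
    · exact absurd htop hb.1
    · obtain rfl := htop.unique hx
      exact hb
  exact hne ((key b hb).unique (key c hc))

theorem StagedOn.adj_iff_of_free [Finite C] (hn : 0 < n) (h : P.StagedOn Set.univ D st z) {a : C}
    (ha : a ∈ free D) (b : C) : D.Adj a b ↔ st a ≤ st b ∧ ∀ i, P.prefers i b a := by
  rw [h.adj_iff]
  constructor
  · intro hb
    refine ⟨(mem_and_ne_of_mem_attachSet hn hb).1, fun i => ?_⟩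
    obtain ⟨-, hb | hb⟩ := Set.mem_iInter.1 hb i
    · exact hb.2
    · exact absurd hb.1 (h.not_isTop_of_free ha i)
  · rintro ⟨h1, h2⟩
    exact Set.mem_iInter.2 fun i => ⟨h1, Or.inl ⟨h.not_isTop_of_free ha i, h2 i⟩⟩

/-- As `b` is free, all voters prefer `c` to `b`. No voter can have top `a` at the stage of `a`,
since `b` would then be second there and beat `c`; the remaining condition on arcs is transitive. -/
theorem StagedOn.adj_trans_of_free [Finite C] (hn : 0 < n) (h : P.StagedOn Set.univ D st z)
    {a b c : C} (hab : D.Adj a b) (hb : b ∈ free D) (hbc : D.Adj b c) : D.Adj a c := by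
  have hlt := h.lt hab
  have hlt' := h.lt hbc
  have hcb := ((h.adj_iff_of_free hn hb c).1 hbc).2
  rw [h.adj_iff] at hab ⊢
  refine Set.mem_iInter.2 fun i => ⟨show st a ≤ st c by omega, ?_⟩
  obtain ⟨-, hab | ⟨htop, x, hx, hsec⟩⟩ := Set.mem_iInter.1 hab i
  · exact Or.inl ⟨hab.1, prefers_trans (hcb i) hab.2⟩
  · obtain rfl := htop.unique hx
    refine absurd (hcb i) (prefers_asymm (hsec.2 c ⟨show st a ≤ st c by omega, ?_⟩ ?_))
    · rintro rfl
      omega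
    · rintro rfl
      omega

/-- A free out-neighbour would pass its own two out-neighbours on to `a`. -/
theorem StagedOn.forced_of_adj [Finite C] (hn : 0 < n) (h : P.StagedOn Set.univ D st z)
    {a b : C} (ha : a ∈ forced D) (hab : D.Adj a b) : b ∈ forced D := by
  by_contra hb
  have hb := free_iff_not_forced.2 hb
  obtain ⟨c, d, hc, hd, hne⟩ := exists_adj_ne_of_free hb
  exact hne (eq_of_forced ha (h.adj_trans_of_free hn hab hb hc) (h.adj_trans_of_free hn hab hb hd))

/-- The out-neighbours of `a` are the candidates of its stage or later that all voters prefer to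
`a`, a convex set in `T`. A tree edge inside it is an arc of `D`. If the tail `c₁` of this arc is
free, the pair found for `c₁` at its later stage also serves `a`, by transitivity. -/
theorem StagedOn.exists_forced_pair [Finite C] (hn : 0 < n) (h : P.StagedOn Set.univ D st z)
    {T : SimpleGraph C} (hT : T ∈ P.treeSet) {a : C} (ha : a ∈ free D) :
    ∃ c₁ ∈ forced D, ∃ c₂ ∈ forced D, D.Adj c₁ c₂ ∧ D.Adj a c₁ ∧ D.Adj a c₂ := by
  obtain ⟨hL, hc⟩ := locallyPeaked_of_mem_treeSet hT
  obtain ⟨M, hM⟩ := (Set.finite_range st).bddAbove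
  have hM' : ∀ a, st a ≤ M := fun a => hM ⟨a, rfl⟩
  induction hk : M - st a using Nat.strong_induction_on generalizing a with
  | _ k ih =>
    obtain ⟨b₁, b₂, hb₁, hb₂, hne⟩ := exists_adj_ne_of_free ha
    have h₁ := (h.adj_iff_of_free hn ha b₁).1 hb₁
    have h₂ := (h.adj_iff_of_free hn ha b₂).1 hb₂
    have pair : ∃ c₁ c₂, D.Adj c₁ c₂ ∧ D.Adj a c₁ ∧ D.Adj a c₂ := by
      obtain ⟨p, hp, hp'⟩ := h.conn T hL hc (st a) b₁ ⟨trivial, h₁.1⟩ b₂ ⟨trivial, h₂.1⟩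
      cases p with
      | nil => exact absurd rfl hne
      | @cons _ v _ hb₁v q =>
        -- A voter who prefers `b₁` to `v` decreases along the path, so `v` is at least as good as
        -- `b₂`; otherwise `v` beats `b₁`. In both cases `v` beats `a`.
        have hav : D.Adj a v := by
          refine (h.adj_iff_of_free hn ha v).2 ⟨(hp' v (by simp)).2, fun i => ?_⟩
          rcases prefers_total (P := P) (i := i) hb₁v.ne with hpref | hpref
          · have := hL.pairwise_support hb₁v q hp hpref
            rw [SimpleGraph.Walk.support_cons, List.pairwise_cons,
              ← SimpleGraph.Walk.cons_tail_support, List.pairwise_cons] at this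
            have hmem := q.end_mem_support
            rw [← SimpleGraph.Walk.cons_tail_support, List.mem_cons] at hmem
            rcases hmem with rfl | hmem
            · exact h₂.2 i
            · exact prefers_trans (this.2.1 b₂ hmem) (h₂.2 i)
          · exact prefers_trans hpref (h₁.2 i)
        rcases h.edge T hL hc b₁ trivial v trivial hb₁v with h' | h'
        · exact ⟨b₁, v, h', hb₁, hav⟩
        · exact ⟨v, b₁, h', hav, hb₁⟩
    obtain ⟨c₁, c₂, h12, ha1, ha2⟩ := pair
    by_cases hf : c₁ ∈ forced D
    · exact ⟨c₁, hf, c₂, h.forced_of_adj hn hf h12, h12, ha1, ha2⟩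
    · have hf := free_iff_not_forced.2 hf
      have hlt := h.lt ha1
      have := hM' c₁
      obtain ⟨d₁, hd₁, d₂, hd₂, h12, h1, h2⟩ := ih _ (by omega) hf rfl
      exact ⟨d₁, hd₁, d₂, hd₂, h12, h.adj_trans_of_free hn ha1 hf h1,
        h.adj_trans_of_free hn ha1 hf h2⟩

theorem StagedOn.isSink_iff (h : P.StagedOn Set.univ D st z) {a : C} : IsSink D a ↔ a = z := by
  constructor
  · intro ha
    by_contra haz
    obtain ⟨b, hb⟩ := h.nonsink a trivial haz
    exact ha b hb
  · rintro rfl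
    exact h.sink

theorem StagedOn.sink_mem_forced (h : P.StagedOn Set.univ D st z) : z ∈ forced D := by
  have : {b | D.Adj z b} = ∅ := Set.eq_empty_of_forall_notMem h.sink
  simp [forced, outDeg, this]

theorem StagedOn.attachmentGraph_adj (h : P.StagedOn Set.univ D st z) {f : C → C}
    (hf : ∀ a, a ≠ z → D.Adj a (f a)) (a b : C) :
    (attachmentGraph D f).Adj a b ↔ (a ≠ z ∧ f a = b) ∨ (b ≠ z ∧ f b = a) := by
  simp only [attachmentGraph, SimpleGraph.fromRel_adj, h.isSink_iff]
  constructor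
  · exact And.right
  · refine fun hab => ⟨?_, hab⟩
    rintro rfl
    have haz : a ≠ z ∧ f a = a := by tauto
    have := h.lt (hf a haz.1)
    rw [haz.2] at this
    omega

/-- Every choice of out-neighbours gives a tree on which the profile is single-peaked. -/
theorem StagedOn.attachmentGraph_mem_treeSet [Finite C]
    (h : P.StagedOn Set.univ D st z) {f : C → C} (hf : ∀ a, a ≠ z → D.Adj a (f a)) :
    attachmentGraph D f ∈ P.treeSet := by
  refine ⟨isTree_of_parent z f st (fun a ha => h.lt (hf a ha)) (h.attachmentGraph_adj hf), ?_⟩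
  refine LocallyPeaked.singlePeakedOn ?_
  -- a child that a voter prefers to its parent is the voter's top candidate at its stage
  have child : ∀ (i : Fin n) (a c : C), c ≠ z → f c = a → P.prefers i c a →
      ∀ d, st c ≤ st d → d ≠ c → d ≠ a → P.prefers i a d := by
    rintro i a c hcz rfl hpref d hd hdc hda
    have hadj := hf c hcz
    rw [h.adj_iff] at hadj
    obtain ⟨-, h1 | ⟨htop, x, hx, hsec⟩⟩ := Set.mem_iInter.1 hadj i
    · exact absurd hpref (prefers_asymm h1.2)
    · obtain rfl := htop.unique hx
      exact hsec.2 d ⟨hd, hdc⟩ hda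
  intro i a b b' hab hab' hne hba hba'
  rw [h.attachmentGraph_adj hf] at hab hab'
  -- Parent against child: if the child `b'` is preferred to `a`, then `a` is second at the stage of
  -- `b'` and beats its own parent.
  have mixed : ∀ b b', b ≠ b' → (a ≠ z ∧ f a = b) → (b' ≠ z ∧ f b' = a) → P.prefers i b a →
      ¬ P.prefers i b' a := by
    rintro b b' hne ⟨haz, rfl⟩ ⟨hbz, hb⟩ hpref hpref'
    have h1 := h.lt (hf a haz)
    have h2 := h.lt (hf b' hbz)
    rw [hb] at h2
    refine prefers_asymm hpref (child i a b' hbz hb hpref' (f a) (by omega) hne ?_)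
    intro heq
    rw [heq] at h1
    omega
  rcases hab with hab | hab <;> rcases hab' with hab' | hab'
  · exact hne (hab.2.symm.trans hab'.2)
  · exact mixed b b' hne hab hab' hba hba'
  · exact mixed b' b hne.symm hab' hab hba' hba
  · have hb : b ≠ a := by
      rintro rfl
      exact prefers_irrefl _ hba
    have hb' : b' ≠ a := by
      rintro rfl
      exact prefers_irrefl _ hba'
    -- Two children: if the one removed first is preferred to `a`, then `a` is second at that stage
    -- and beats the other child.
    rcases le_total (st b) (st b') with hle | hle
    · exact prefers_asymm hba' (child i a b hab.1 hab.2 hba b' hle hne.symm hb')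
    · exact prefers_asymm hba (child i a b' hab'.1 hab'.2 hba' b hle hne hb)

theorem StagedOn.forcedGraph_adj (h : P.StagedOn Set.univ D st z) (a b : forced D) :
    (forcedGraph D).Adj a b ↔ D.Adj a b ∨ D.Adj b a := by
  simp only [forcedGraph, SimpleGraph.fromRel_adj]
  refine ⟨And.right, fun hab => ⟨?_, hab⟩⟩
  rintro rfl
  have := h.lt (hab.elim id id)
  omega

theorem StagedOn.forcedGraph_isTree [Finite C] (hn : 0 < n) (h : P.StagedOn Set.univ D st z) :
    (forcedGraph D).IsTree := by
  classical
  have hex : ∀ a : forced D, ∃ b : forced D, (a : C) ≠ z → D.Adj a b := by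
    intro a
    by_cases haz : (a : C) = z
    · exact ⟨a, fun h => absurd haz h⟩
    · obtain ⟨b, hb⟩ := h.nonsink a trivial haz
      exact ⟨⟨b, h.forced_of_adj hn a.2 hb⟩, fun _ => hb⟩
  choose f hf using hex
  have hne : ∀ a : forced D, a ≠ ⟨z, h.sink_mem_forced⟩ ↔ (a : C) ≠ z := fun a => by
    rw [Ne, Subtype.ext_iff]
  have key : ∀ a b : forced D, D.Adj a b ↔ a ≠ ⟨z, h.sink_mem_forced⟩ ∧ f a = b := by
    intro a b
    rw [hne]
    constructor
    · intro hab
      have haz : (a : C) ≠ z := by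
        intro haz
        rw [haz] at hab
        exact h.sink b hab
      exact ⟨haz, Subtype.ext (eq_of_forced a.2 (hf a haz) hab)⟩
    · rintro ⟨haz, rfl⟩
      exact hf a haz
  refine isTree_of_parent ⟨z, h.sink_mem_forced⟩ f (fun a => st a)
    (fun a ha => h.lt (hf a ((hne a).1 ha))) fun a b => ?_
  rw [h.forcedGraph_adj, key, key]

/-- The forced part is contained in every tree on which the profile is single-peaked. -/
theorem StagedOn.forcedGraph_le [Finite C] (h : P.StagedOn Set.univ D st z) {T : SimpleGraph C}
    (hT : T ∈ P.treeSet) (a b : forced D) (hab : (forcedGraph D).Adj a b) : T.Adj a b := by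
  obtain ⟨hL, hc⟩ := locallyPeaked_of_mem_treeSet hT
  have key : ∀ a b : forced D, D.Adj a b → T.Adj a b := by
    intro a b hab
    have haz : (a : C) ≠ z := by
      intro haz
      rw [haz] at hab
      exact h.sink b hab
    -- Every tree in `𝒯(P)` joins `a` to one of its out-neighbours, and a forced vertex has only
    -- one.
    obtain ⟨c, hac, hac'⟩ := h.parent T hL hc a trivial haz
    rwa [eq_of_forced a.2 hab hac]
  rcases (h.forcedGraph_adj a b).1 hab with hab | hab
  · exact key a b hab
  · exact (key b a hab).symm

end Profile

/-! ### Passing between decompositions of the forced part and of the whole tree. -/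

section ForcedBags

variable {C : Type*} {D : Digraph C}

theorem hasBags_forcedGraph {G : SimpleGraph C} {k : ℕ} (h : HasBags G (forced D) k)
    (hG : ∀ a b : forced D, (forcedGraph D).Adj a b → G.Adj a b) :
    HasBags (forcedGraph D) Set.univ k := by
  classical
  obtain ⟨S, h1, h2⟩ := h
  refine ⟨S.map fun X => X.subtype (· ∈ forced D), h1.preimage _ Subtype.val _ (fun a _ => a.2)
    (fun a _ b _ => hG a b) _ (by simp), ?_⟩
  intro X hX
  obtain ⟨Y, hY, rfl⟩ := List.mem_map.1 hX
  rw [Finset.card_subtype]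
  exact (Finset.card_filter_le _ _).trans (h2 Y hY)

theorem decomposesOn_forced {G : SimpleGraph C} {S : List (Finset (forced D))}
    (h : DecomposesOn (forcedGraph D) Set.univ S)
    (hG : ∀ a b : forced D, G.Adj a b → (forcedGraph D).Adj a b) :
    DecomposesOn G (forced D) (S.map (Finset.map (Function.Embedding.subtype _))) := by
  refine ⟨?_, ?_, ?_, ?_⟩
  · intro X hX a ha
    obtain ⟨Y, hY, rfl⟩ := List.mem_map.1 hX
    obtain ⟨b, -, rfl⟩ := Finset.mem_map.1 ha
    exact b.2
  · intro a ha
    obtain ⟨X, hX, haX⟩ := h.vertex ⟨a, ha⟩ trivial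
    exact ⟨_, List.mem_map_of_mem hX, Finset.mem_map.2 ⟨_, haX, rfl⟩⟩
  · intro a ha b hb hab
    obtain ⟨X, hX, haX, hbX⟩ := h.edge ⟨a, ha⟩ trivial ⟨b, hb⟩ trivial (hG ⟨a, ha⟩ ⟨b, hb⟩ hab)
    exact ⟨_, List.mem_map_of_mem hX, Finset.mem_map.2 ⟨_, haX, rfl⟩, Finset.mem_map.2 ⟨_, hbX, rfl⟩⟩
  · intro X Y Z hs a hX hZ
    obtain ⟨l, hl, hl'⟩ := List.sublist_map_iff.1 hs
    match l, hl' with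
    | [X', Y', Z'], hl' =>
      simp only [List.map_cons, List.map_nil, List.cons.injEq, and_true] at hl'
      obtain ⟨rfl, rfl, rfl⟩ := hl'
      obtain ⟨b, hb, rfl⟩ := Finset.mem_map.1 hX
      obtain ⟨c, hc, hcb⟩ := Finset.mem_map.1 hZ
      obtain rfl := Subtype.ext hcb
      exact Finset.mem_map.2 ⟨c, h.interval _ _ _ hl c hb hc, rfl⟩

/-- Attaching leaves to vertices in small bags does not increase the pathwidth. -/
theorem hasBags_of_leaves [Finite C] {G : SimpleGraph C} {A : Set C} {S : List (Finset C)} {k : ℕ}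
    (h : DecomposesOn G A S) (hk : ∀ X ∈ S, X.card ≤ k + 1) (f : C → C)
    (hf : ∀ a, a ∉ A → ∀ b, G.Adj a b → b = f a)
    (hsmall : ∀ a, a ∉ A → ∃ X ∈ S, f a ∈ X ∧ X.card ≤ k) : HasBags G Set.univ (k + 1) := by
  classical
  -- Leaves are added one after the other. The small bag `X` is kept beside its enlarged copy, so it
  -- can serve any number of leaves.
  have key : ∀ l : List C, ∃ S', DecomposesOn G (A ∪ {a | a ∈ l}) S' ∧
      (∀ X ∈ S', X.card ≤ k + 1) ∧ ∀ X ∈ S, X ∈ S' := by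
    intro l
    induction l with
    | nil => exact ⟨S, by simpa using h, hk, fun _ => id⟩
    | cons a l ih =>
      obtain ⟨S', h1, h2, h3⟩ := ih
      have hset : A ∪ {c | c ∈ a :: l} = insert a (A ∪ {c | c ∈ l}) := by
        ext c
        simp only [List.mem_cons, Set.mem_union, Set.mem_insert_iff, Set.mem_ofPred_eq]
        tauto
      by_cases ha : a ∈ A ∪ {c | c ∈ l}
      · refine ⟨S', ?_, h2, h3⟩
        rwa [hset, Set.insert_eq_of_mem ha]
      · have haA : a ∉ A := fun h => ha (Or.inl h)
        obtain ⟨X, hX, hfX, hXk⟩ := hsmall a haA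
        obtain ⟨L, R, rfl⟩ := List.append_of_mem (h3 X hX)
        have hmem : ∀ Z ∈ L ++ X :: R, Z ∈ L ++ X :: insert a X :: R := by
          intro Z hZ
          simp only [List.mem_append, List.mem_cons] at hZ ⊢
          tauto
        refine ⟨L ++ X :: insert a X :: R, ?_, ?_, fun Z hZ => hmem Z (h3 Z hZ)⟩
        · rw [hset]
          exact h1.insertLeaf ha hfX (fun b _ => hf a haA b) fun _ _ _ _ => id
        · intro Z hZ
          by_cases hZX : Z = insert a X
          · rw [hZX]
            exact (Finset.card_insert_le _ _).trans (by omega)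
          · refine h2 Z ?_
            simp only [List.mem_append, List.mem_cons] at hZ ⊢
            tauto
  have := Fintype.ofFinite C
  obtain ⟨S', h1, h2, -⟩ := key Finset.univ.toList
  refine ⟨S', ?_, h2⟩
  have hset : A ∪ {a | a ∈ (Finset.univ : Finset C).toList} = Set.univ := by ext; simp
  rwa [hset] at h1

end ForcedBags

/-! ### Existence and optimality of runs of the algorithm. -/

namespace Profile

variable {n : ℕ} {C : Type*} {P : Profile n C} {D : Digraph C} {st : C → ℕ} {z : C}

theorem StagedOn.exists_isAttachmentRun [Finite C] (hn : 0 < n) (h : P.StagedOn Set.univ D st z)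
    {T : SimpleGraph C} (hT : T ∈ P.treeSet) {S : List (Finset (forced D))}
    (hS : IsSlackDecomposition (forcedGraph D) S) : ∃ f, IsAttachmentRun D S f := by
  have hex : ∀ a : C, ∃ b : C, (a ∈ forced D → ¬ IsSink D a → D.Adj a b) ∧
      (a ∈ free D → ∃ c₁ c₂ c : forced D, D.Adj c₁ c₂ ∧ D.Adj a c₁ ∧ D.Adj a c₂ ∧
        (c = c₁ ∨ c = c₂) ∧ b = c ∧ ∃ X ∈ S, c ∈ X ∧ X.card ≤ bagWidth S) := by
    intro a
    by_cases ha : a ∈ forced D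
    · have ha' : a ∉ free D := fun h => free_iff_not_forced.1 h ha
      by_cases hs : IsSink D a
      · exact ⟨a, fun _ h => absurd hs h, fun h => absurd h ha'⟩
      · simp only [IsSink, not_forall, not_not] at hs
        obtain ⟨b, hb⟩ := hs
        exact ⟨b, fun _ _ => hb, fun h => absurd h ha'⟩
    · obtain ⟨c₁, hc₁, c₂, hc₂, h12, h1, h2⟩ :=
        h.exists_forced_pair hn hT (free_iff_not_forced.2 ha)
      -- The arc `(c₁, c₂)` is an edge of the forced part, so the slack condition provides the small
      -- bag.
      obtain ⟨X, hX, hcX, hXw⟩ := hS.slack ⟨c₁, hc₁⟩ ⟨c₂, hc₂⟩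
        ((h.forcedGraph_adj _ _).2 (Or.inl h12))
      rcases hcX with hcX | hcX
      · exact ⟨c₁, fun h => absurd h ha, fun _ => ⟨⟨c₁, hc₁⟩, ⟨c₂, hc₂⟩, ⟨c₁, hc₁⟩, h12, h1, h2,
          Or.inl rfl, rfl, X, hX, hcX, hXw⟩⟩
      · exact ⟨c₂, fun h => absurd h ha, fun _ => ⟨⟨c₁, hc₁⟩, ⟨c₂, hc₂⟩, ⟨c₂, hc₂⟩, h12, h1, h2,
          Or.inr rfl, rfl, X, hX, hcX, hXw⟩⟩
  choose f hf using hex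
  exact ⟨f, fun a ha => (hf a).1 ha, fun a ha => (hf a).2 ha⟩

theorem StagedOn.adj_of_run (h : P.StagedOn Set.univ D st z) {S : List (Finset (forced D))}
    {f : C → C} (hf : IsAttachmentRun D S f) (a : C) (ha : a ≠ z) : D.Adj a (f a) := by
  by_cases hfo : a ∈ forced D
  · exact hf.forced_adj a hfo fun hs => ha (h.isSink_iff.1 hs)
  · obtain ⟨c₁, c₂, c, -, h1, h2, rfl | rfl, hfa, -⟩ := hf.free_choice a (free_iff_not_forced.2 hfo)
    · rwa [hfa]
    · rwa [hfa]

theorem StagedOn.run_forced [Finite C] (hn : 0 < n) (h : P.StagedOn Set.univ D st z)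
    {S : List (Finset (forced D))} {f : C → C} (hf : IsAttachmentRun D S f) {a : C}
    (ha : a ≠ z) : f a ∈ forced D := by
  by_cases hfo : a ∈ forced D
  · exact h.forced_of_adj hn hfo (h.adj_of_run hf a ha)
  · obtain ⟨c₁, c₂, c, -, -, -, -, hfa, -⟩ := hf.free_choice a (free_iff_not_forced.2 hfo)
    rw [hfa]
    exact c.2

/-- All values of `f` at non-sinks are forced, so no vertex is attached to a free one: free vertices
are leaves. -/
theorem StagedOn.adj_free_iff [Finite C] (hn : 0 < n) (h : P.StagedOn Set.univ D st z)
    {S : List (Finset (forced D))} {f : C → C} (hf : IsAttachmentRun D S f) {a : C}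
    (ha : a ∉ forced D) (b : C) : (attachmentGraph D f).Adj a b ↔ b = f a := by
  have haz : a ≠ z := fun haz => ha (haz ▸ h.sink_mem_forced)
  rw [h.attachmentGraph_adj (h.adj_of_run hf)]
  constructor
  · rintro (h' | h')
    · exact h'.2.symm
    · exact absurd (h'.2 ▸ h.run_forced hn hf h'.1) ha
  · rintro rfl
    exact Or.inl ⟨haz, rfl⟩

theorem StagedOn.pathwidth_run_le [Finite C] (hn : 0 < n) (h : P.StagedOn Set.univ D st z)
    {S : List (Finset (forced D))} (hS : IsSlackDecomposition (forcedGraph D) S) {f : C → C}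
    (hf : IsAttachmentRun D S f) :
    pathwidth (attachmentGraph D f) ≤ pathwidth (forcedGraph D) := by
  rw [pathwidth_le_iff, ← hS.minimum]
  have hD := decomposesOn_forced (G := attachmentGraph D f)
    (isPathDecomposition_iff.1 hS.isDecomposition) (by
      intro a b hab
      rw [h.forcedGraph_adj]
      rcases (h.attachmentGraph_adj (h.adj_of_run hf) a b).1 hab with ⟨h1, h2⟩ | ⟨h1, h2⟩
      · exact Or.inl (h2 ▸ h.adj_of_run hf a h1)
      · exact Or.inr (h2 ▸ h.adj_of_run hf b h1))
  refine hasBags_of_leaves hD ?_ f (fun a ha b => (h.adj_free_iff hn hf ha b).1) ?_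
  · intro X hX
    obtain ⟨Y, hY, rfl⟩ := List.mem_map.1 hX
    rw [Finset.card_map]
    exact bagWidth_le_iff.1 le_rfl Y hY
  · intro a ha
    obtain ⟨c₁, c₂, c, -, -, -, -, hfa, X, hX, hcX, hXw⟩ :=
      hf.free_choice a (free_iff_not_forced.2 ha)
    exact ⟨_, List.mem_map_of_mem hX, Finset.mem_map.2 ⟨c, hcX, hfa.symm⟩, by
      rwa [Finset.card_map]⟩

theorem StagedOn.pathwidth_forcedGraph_le [Finite C] (h : P.StagedOn Set.univ D st z)
    {T : SimpleGraph C} (hT : T ∈ P.treeSet) : pathwidth (forcedGraph D) ≤ pathwidth T := by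
  rw [pathwidth_le_iff]
  exact hasBags_forcedGraph ((pathwidth_le_iff.1 le_rfl).subset (Set.subset_univ _))
    (h.forcedGraph_le hT)

theorem StagedOn.isMinPathwidthTree [Finite C] (hn : 0 < n) (h : P.StagedOn Set.univ D st z)
    {S : List (Finset (forced D))} (hS : IsSlackDecomposition (forcedGraph D) S) {f : C → C}
    (hf : IsAttachmentRun D S f) : IsMinPathwidthTree P (attachmentGraph D f) :=
  ⟨h.attachmentGraph_mem_treeSet (h.adj_of_run hf), fun _ hT =>
    (h.pathwidth_run_le hn hS hf).trans (h.pathwidth_forcedGraph_le hT)⟩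

end Profile

/-- Correctness of the attachment algorithm. -/
theorem attachment_algorithm_correct {n : ℕ} {C : Type*} [Finite C] (P : Profile n C) (hn : 0 < n)
    (hP : P.treeSet.Nonempty) :
    (∃ D, P.IsAttachmentDigraph D) ∧
    ∀ D, P.IsAttachmentDigraph D →
      (forcedGraph D).IsTree ∧
      (∃ S, IsSlackDecomposition (forcedGraph D) S) ∧
      ∀ S, IsSlackDecomposition (forcedGraph D) S →
        (∃ f, IsAttachmentRun D S f) ∧
        ∀ f, IsAttachmentRun D S f →
          IsMinPathwidthTree P (attachmentGraph D f) ∧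
          ∀ a ∈ free D, ((attachmentGraph D f).neighborSet a).ncard = 1 := by
  obtain ⟨T, hT⟩ := hP
  refine ⟨Profile.exists_isAttachmentDigraph hn hT, fun D hD => ?_⟩
  have : Nonempty C := hT.1.connected.nonempty
  obtain ⟨st, z, h⟩ := hD.exists_stagedOn hn (Classical.arbitrary C)
  obtain ⟨S, hS, hSw⟩ := exists_decomposition_pathwidth (forcedGraph D)
  obtain ⟨S', hS', -⟩ := exists_isSlackDecomposition _ hS hSw
  refine ⟨h.forcedGraph_isTree hn, ⟨S', hS'⟩, fun S hS => ⟨h.exists_isAttachmentRun hn hT hS,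
    fun f hf => ⟨h.isMinPathwidthTree hn hS hf, fun a ha => ?_⟩⟩⟩
  have : (attachmentGraph D f).neighborSet a = {f a} := by
    ext b
    exact h.adj_free_iff hn hf (Profile.free_iff_not_forced.1 ha) b
  rw [this, Set.ncard_singleton]

/-! ### Computing the pathwidth of a tree

The label `(e, a, C)` of a rooted tree lists in `C`, in decreasing order, the levels of the critical
subtrees that are pruned one after the other; what remains has pathwidth `e`, and `a` counts the
branches at the root that have pathwidth `e`. -/

section Labels

/-- The pathwidth recorded by a label. -/
def topLevel (l : ℕ × ℕ × List ℕ) : ℕ := l.2.2.headD l.1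

/-- Adding a critical subtree of level `c`. -/
def pushLevel (c : ℕ) (l : ℕ × ℕ × List ℕ) : ℕ × ℕ × List ℕ :=
  if topLevel l < c then (l.1, l.2.1, c :: l.2.2)
  else if topLevel l = c then (c + 1, 0, []) else l

/-- Attaching to a root with label `(e, a, [])` a branch with label `(k, a', [])`, `a' < 2`. -/
def absorbLevel (e a k : ℕ) : ℕ × ℕ × List ℕ :=
  if k < e then (e, a, []) else if e < k then (k, 1, []) else
    if e = 0 then (1, 0, []) else if a < 2 then (e, a + 1, []) else (e + 1, 0, [])

def pushIf (b : Bool) (c : ℕ) (l : ℕ × ℕ × List ℕ) : ℕ × ℕ × List ℕ :=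
  if b then pushLevel c l else l

/-- Levels are merged from below, as an overflow at level `k` can collide with one at level `k + 1`.
A membership test per level suffices for lists that are strictly decreasing. -/
def pushLevels (N : ℕ) (l : ℕ × ℕ × List ℕ) (C₁ C₂ : List ℕ) : ℕ × ℕ × List ℕ :=
  (List.range N).foldl (fun l k => pushIf (C₂.contains k) k (pushIf (C₁.contains k) k l)) l

/-- The label of the tree that arises by joining two rooted trees by an edge between their roots;
the root of the first becomes the root of the whole tree. -/
def joinLabel (N : ℕ) (l₁ l₂ : ℕ × ℕ × List ℕ) : ℕ × ℕ × List ℕ :=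
  if l₂.2.1 = 2 then pushLevels N (l₁.1, l₁.2.1, []) l₁.2.2 (l₂.2.2 ++ [l₂.1])
  else pushLevels N (absorbLevel l₁.1 l₁.2.1 l₂.1) l₁.2.2 l₂.2.2

theorem pushLevels_succ (N : ℕ) (l : ℕ × ℕ × List ℕ) (C₁ C₂ : List ℕ) :
    pushLevels (N + 1) l C₁ C₂ =
      pushIf (C₂.contains N) N (pushIf (C₁.contains N) N (pushLevels N l C₁ C₂)) := by
  simp [pushLevels, List.range_succ]

theorem pushLevels_cons_left {N c : ℕ} (h : N ≤ c) (l : ℕ × ℕ × List ℕ) (C₁ C₂ : List ℕ) :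
    pushLevels N l (c :: C₁) C₂ = pushLevels N l C₁ C₂ := by
  induction N with
  | zero => rfl
  | succ N ih =>
    rw [pushLevels_succ, pushLevels_succ, ih (by omega)]
    have : (c :: C₁).contains N = C₁.contains N := by
      rw [List.contains_cons, beq_false_of_ne (by omega), Bool.false_or]
    rw [this]

theorem pushLevels_cons_right {N c : ℕ} (h : N ≤ c) (l : ℕ × ℕ × List ℕ) (C₁ C₂ : List ℕ) :
    pushLevels N l C₁ (c :: C₂) = pushLevels N l C₁ C₂ := by
  induction N with
  | zero => rfl
  | succ N ih =>
    rw [pushLevels_succ, pushLevels_succ, ih (by omega)]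
    have : (c :: C₂).contains N = C₂.contains N := by
      rw [List.contains_cons, beq_false_of_ne (by omega), Bool.false_or]
    rw [this]

/-- Critical subtrees of level below the current top no longer influence the label. -/
theorem pushLevels_of_lt {N : ℕ} {l : ℕ × ℕ × List ℕ} {C₁ C₂ : List ℕ}
    (h₁ : ∀ c ∈ C₁, c < topLevel l) (h₂ : ∀ c ∈ C₂, c < topLevel l) :
    pushLevels N l C₁ C₂ = l := by
  have key : ∀ (C : List ℕ) (k : ℕ), (∀ c ∈ C, c < topLevel l) →
      pushIf (C.contains k) k l = l := by
    intro C k hC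
    unfold pushIf pushLevel
    split_ifs with h1 h2 h3
    · have := hC k (by simpa using h1)
      omega
    · have := hC k (by simpa using h1)
      omega
    · rfl
    · rfl
  induction N with
  | zero => rfl
  | succ N ih => rw [pushLevels_succ, ih, key C₁ N h₁, key C₂ N h₂]

end Labels

/-! ### What labels certify, and how the part at the root changes when a branch is attached. -/

section Semantics

variable {V : Type*} {G : SimpleGraph V}

/-- A critical subtree of level `c` with root `u`: it has pathwidth at most `c`, two branches of
pathwidth at least `c` at its root, and a bag `{u}` can be used in a decomposition. -/
structure IsBlock (G : SimpleGraph V) (Y : Set V) (u : V) (c : ℕ) : Prop where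
  mem : u ∈ Y
  pos : 1 ≤ c
  conn : ConnOn G Y
  decomp : ∃ L R, DecomposesOn G Y (L ++ {u} :: R) ∧ ∀ X ∈ L ++ {u} :: R, X.card ≤ c + 1
  arms : ∃ X₁ X₂, X₁ ⊆ Y \ {u} ∧ X₂ ⊆ Y \ {u} ∧ Disjoint X₁ X₂ ∧ ConnOn G (insert u X₁) ∧
    ConnOn G (insert u X₂) ∧ ¬ HasBags G X₁ c ∧ ¬ HasBags G X₂ c

/-- `(e, a, C)` is a label of the part of `G` induced by `A`, with root `r`. -/
inductive HasLabel (G : SimpleGraph V) (r : V) : Set V → ℕ → ℕ → List ℕ → Prop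
  | zero {A : Set V} {e : ℕ} (hr : r ∈ A) (hc : ConnOn G A) (hl : ¬ HasBags G A e)
      (hu : HasBags G (A \ {r}) e) : HasLabel G r A e 0 []
  | one {A : Set V} {e : ℕ} (hr : r ∈ A) (he : 1 ≤ e) (hc : ConnOn G A)
      (hu : ∃ L, DecomposesOn G A (L ++ [{r}]) ∧ ∀ X ∈ L ++ [{r}], X.card ≤ e + 1)
      (hl : ∃ X ⊆ A \ {r}, ConnOn G (insert r X) ∧ ¬ HasBags G X e) : HasLabel G r A e 1 []
  | two {A : Set V} {e : ℕ} (h : IsBlock G A r e) : HasLabel G r A e 2 []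
  | cons {A Y : Set V} {u : V} {c e a : ℕ} {C : List ℕ} (h : HasLabel G r A e a C)
      (hY : IsBlock G Y u c) (he : e < c) (hC : ∀ x ∈ C, x < c) (hd : Disjoint A Y)
      (hp : ∃ p ∈ A, G.Adj u p) (hE : ∀ x ∈ A, ∀ y ∈ Y, G.Adj x y → y = u) :
      HasLabel G r (A ∪ Y) e a (c :: C)

/-- The variant of `HasLabel` for a subtree with root `r` to which a parent is still to be attached;
if the root itself is critical then everything is pruned. -/
inductive HasBranchLabel (G : SimpleGraph V) (r : V) : Set V → Option ℕ → List ℕ → Prop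
  | nil : HasBranchLabel G r ∅ none []
  | root {A : Set V} {e : ℕ} (hr : r ∈ A) (hc : ConnOn G A) (hl : ¬ HasBags G A e)
      (hu : ∃ L, DecomposesOn G A (L ++ [{r}]) ∧ ∀ X ∈ L ++ [{r}], X.card ≤ e + 1) :
      HasBranchLabel G r A (some e) []
  | cons {A Y : Set V} {u : V} {c : ℕ} {b : Option ℕ} {C : List ℕ} (h : HasBranchLabel G r A b C)
      (hY : IsBlock G Y u c) (he : ∀ e ∈ b, e < c) (hC : ∀ x ∈ C, x < c) (hd : Disjoint A Y)
      (h0 : A = ∅ → u = r) (hp : A.Nonempty → ∃ p ∈ A, G.Adj u p)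
      (hE : ∀ x ∈ A, ∀ y ∈ Y, G.Adj x y → y = u) : HasBranchLabel G r (A ∪ Y) b (c :: C)

theorem forall_mem_insertAll [DecidableEq V] (u : V) (S : List (Finset V)) :
    ∀ X ∈ S.map (insert u) ++ [{u}], u ∈ X := by
  intro X hX
  rcases List.mem_append.1 hX with hX | hX
  · obtain ⟨Z, -, rfl⟩ := List.mem_map.1 hX
    exact Finset.mem_insert_self _ _
  · rw [List.mem_singleton.1 hX]
    exact Finset.mem_singleton_self _

theorem HasBags.empty (k : ℕ) : HasBags G ∅ k :=
  ⟨[], ⟨by simp, by simp, by simp, by simp⟩, by simp⟩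

theorem IsBlock.hasBags {Y : Set V} {u : V} {c : ℕ} (h : IsBlock G Y u c) :
    HasBags G Y (c + 1) := by
  obtain ⟨L, R, h1, h2⟩ := h.decomp
  exact ⟨_, h1, h2⟩

theorem IsBlock.not_hasBags {Y : Set V} {u : V} {c : ℕ} (h : IsBlock G Y u c) :
    ¬ HasBags G Y c := by
  obtain ⟨X₁, X₂, h1, -, -, -, -, h2, -⟩ := h.arms
  exact fun h3 => h2 (h3.subset (h1.trans Set.sdiff_subset))

/-- A block hanging by its root on a part of smaller pathwidth. -/
theorem IsBlock.hasBags_union {A Y : Set V} {u : V} {c : ℕ} (hY : IsBlock G Y u c)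
    (hA : HasBags G A c) (hd : Disjoint A Y) (hE : ∀ x ∈ A, ∀ y ∈ Y, G.Adj x y → y = u) :
    HasBags G (A ∪ Y) (c + 1) := by
  classical
  obtain ⟨L, R, h1, h2⟩ := hY.decomp
  obtain ⟨S, h3, h4⟩ := hA
  -- The part `A` is decomposed with `u` added to all bags and inserted at the bag `{u}`; bags of
  -- size at most `c` grow to at most `c + 1`.
  have h5 := h1.insertMiddle (h3.insertAll (r := u)) (forall_mem_insertAll u S)
    (by
      rintro a ha (rfl | ha')
      · rfl
      · exact absurd ha (Set.disjoint_left.1 hd ha'))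
    (by
      rintro x hx y (rfl | hy) hyu hxy
      · exact absurd rfl hyu
      · exact hE y hy x hx hxy.symm)
    (Or.inl rfl)
  have hset : Y ∪ insert u A = A ∪ Y := by
    rw [Set.union_insert, Set.union_comm]
    exact Set.insert_eq_of_mem (Or.inr hY.mem)
  rw [hset] at h5
  refine ⟨_, h5, fun X hX => ?_⟩
  simp only [List.mem_append, List.mem_cons, List.mem_map, List.not_mem_nil, or_false] at hX
  rcases hX with hX | rfl | (⟨Z, hZ, rfl⟩ | rfl) | hX
  · exact h2 X (by simp [hX])
  · exact h2 _ (by simp)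
  · exact (Finset.card_insert_le _ _).trans (Nat.succ_le_succ (h4 Z hZ))
  · exact h2 _ (by simp)
  · exact h2 X (by simp [hX])

/-- Any two of the three arms are joined through `u`, which lies outside the third. -/
theorem not_hasBags_of_arms {A X₁ X₂ W : Set V} {u : V} {c : ℕ} (h₁ : X₁ ⊆ A) (h₂ : X₂ ⊆ A)
    (hW : W ⊆ A) (huA : u ∈ A) (d₁₂ : Disjoint X₁ X₂) (d₁ : Disjoint X₁ W) (d₂ : Disjoint X₂ W)
    (u₁ : u ∉ X₁) (u₂ : u ∉ X₂) (uW : u ∉ W) (c₁ : ConnOn G (insert u X₁))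
    (c₂ : ConnOn G (insert u X₂)) (cW : ConnOn G (insert u W)) (w₁ : ¬ HasBags G X₁ c)
    (w₂ : ¬ HasBags G X₂ c) (w : ¬ HasBags G W c) : ¬ HasBags G A (c + 1) := by
  have key : ∀ P Q X : Set V, P ⊆ A → Q ⊆ A → ConnOn G (insert u P) → ConnOn G (insert u Q) →
      Disjoint P X → Disjoint Q X → u ∉ X →
      ∃ W ⊆ A, ConnOn G W ∧ Disjoint W X ∧ P ⊆ W ∧ Q ⊆ W := by
    intro P Q X hP hQ cP cQ dP dQ huX
    refine ⟨insert u P ∪ insert u Q, ?_, cP.union cQ (Or.inl rfl) (Or.inl rfl) (Or.inl rfl), ?_,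
      fun x hx => Or.inl (Or.inr hx), fun x hx => Or.inr (Or.inr hx)⟩
    · rintro x ((rfl | hx) | (rfl | hx))
      exacts [huA, hP hx, huA, hQ hx]
    · rw [Set.disjoint_left]
      rintro x ((rfl | hx) | (rfl | hx))
      exacts [huX, Set.disjoint_left.1 dP hx, huX, Set.disjoint_left.1 dQ hx]
  exact not_hasBags_of_three h₁ h₂ hW w₁ w₂ w (key X₂ W X₁ h₂ hW c₂ cW d₁₂.symm d₁.symm u₁)
    (key X₁ W X₂ h₁ hW c₁ cW d₁₂ d₂.symm u₂) (key X₁ X₂ W h₁ h₂ c₁ c₂ d₁ d₂ uW)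

/-- A further part of pathwidth at least `c` hanging at the root is a third arm. -/
theorem IsBlock.overflow {Y W : Set V} {u : V} {c : ℕ} (hY : IsBlock G Y u c) (hW : ConnOn G W)
    (hd : Disjoint W Y) (hp : ∃ p ∈ W, G.Adj u p) (hw : ¬ HasBags G W c) :
    ¬ HasBags G (W ∪ Y) (c + 1) := by
  obtain ⟨X₁, X₂, h₁, h₂, h12, c₁, c₂, w₁, w₂⟩ := hY.arms
  obtain ⟨p, hp, hup⟩ := hp
  have hd' : ∀ x ∈ Y, x ∉ W := fun x hx hx' => Set.disjoint_left.1 hd hx' hx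
  refine not_hasBags_of_arms (fun x hx => Or.inr (h₁ hx).1) (fun x hx => Or.inr (h₂ hx).1)
    (fun x hx => Or.inl hx) (Or.inr hY.mem) h12 ?_ ?_ (fun h => (h₁ h).2 rfl)
    (fun h => (h₂ h).2 rfl) (hd' _ hY.mem) c₁ c₂ ?_ w₁ w₂ hw
  · exact Set.disjoint_left.2 fun x hx => hd' x (h₁ hx).1
  · exact Set.disjoint_left.2 fun x hx => hd' x (h₂ hx).1
  · have := (ConnOn.singleton G u).union hW rfl hp (Or.inr hup)
    rwa [Set.singleton_union] at this

variable {r r' : V} {A A₁ A₂ : Set V} {e a : ℕ} {C C₁ C₂ : List ℕ} {b : Option ℕ}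

theorem HasLabel.mem (h : HasLabel G r A e a C) : r ∈ A := by
  induction h with
  | zero hr => exact hr
  | one hr => exact hr
  | two h => exact h.mem
  | cons _ _ _ _ _ _ _ ih => exact Or.inl ih

theorem HasLabel.conn (h : HasLabel G r A e a C) : ConnOn G A := by
  induction h with
  | zero _ hc => exact hc
  | one _ _ hc => exact hc
  | two h => exact h.conn
  | cons _ hY _ _ _ hp _ ih =>
    obtain ⟨p, hp, hup⟩ := hp
    exact ih.union hY.conn hp hY.mem (Or.inr hup.symm)

theorem HasLabel.lt_of_mem (h : HasLabel G r A e a C) : ∀ c ∈ C, e < c := by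
  induction h with
  | zero => simp
  | one => simp
  | two => simp
  | cons _ _ he _ _ _ _ ih =>
    intro x hx
    rcases List.mem_cons.1 hx with rfl | hx
    · exact he
    · exact ih x hx

theorem HasLabel.arms_le (h : HasLabel G r A e a C) : a ≤ 2 := by
  induction h with
  | zero => simp
  | one => simp
  | two => simp
  | cons _ _ _ _ _ _ _ ih => exact ih

theorem insert_diff_self_of_mem' {r : V} {A : Set V} (h : r ∈ A) : insert r (A \ {r}) = A := by
  rw [Set.insert_sdiff_singleton, Set.insert_eq_of_mem h]

theorem HasLabel.hasBags (h : HasLabel G r A e a C) {k : ℕ} (he : e ≤ k) (hC : ∀ c ∈ C, c ≤ k) :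
    HasBags G A (k + 1) := by
  induction h generalizing k with
  | zero hr _ _ hu =>
    have := hu.insert r
    rw [insert_diff_self_of_mem' hr] at this
    exact this.mono (by omega)
  | one _ _ _ hu =>
    obtain ⟨L, h1, h2⟩ := hu
    exact ⟨_, h1, fun X hX => (h2 X hX).trans (by omega)⟩
  | two h => exact h.hasBags.mono (by omega)
  | @cons A Y u c e a C _ hY he hC' hd _ hE ih =>
    have hck := hC c (by simp)
    have h1 := hY.pos
    -- All levels recorded for `A` are at most `c - 1`, so `A` fits at the bag `{u}` of the block.
    have h2 : HasBags G A c := by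
      have := ih (k := c - 1) (by omega) (fun x hx => by have := hC' x hx; omega)
      rwa [Nat.sub_add_cancel h1] at this
    exact (hY.hasBags_union h2 hd hE).mono (by omega)

theorem HasLabel.le_topLevel (h : HasLabel G r A e a C) :
    e ≤ topLevel (e, a, C) ∧ ∀ c ∈ C, c ≤ topLevel (e, a, C) := by
  cases h with
  | zero => simp [topLevel]
  | one => simp [topLevel]
  | two => simp [topLevel]
  | cons _ _ he hC =>
    refine ⟨he.le, fun x hx => ?_⟩
    rcases List.mem_cons.1 hx with rfl | hx
    · exact le_rfl
    · exact (hC x hx).le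

theorem HasLabel.hasBags_top (h : HasLabel G r A e a C) :
    HasBags G A (topLevel (e, a, C) + 1) := h.hasBags h.le_topLevel.1 h.le_topLevel.2

theorem HasLabel.not_hasBags (h : HasLabel G r A e a C) : ¬ HasBags G A (topLevel (e, a, C)) := by
  cases h with
  | zero _ _ hl => exact hl
  | one _ _ _ _ hl =>
    obtain ⟨X, hX, -, hw⟩ := hl
    exact fun h => hw (h.subset (hX.trans Set.sdiff_subset))
  | two h => exact h.not_hasBags
  | cons _ hY => exact fun h => hY.not_hasBags (h.subset Set.subset_union_right)

theorem HasBranchLabel.mem (h : HasBranchLabel G r A b C) (hA : A.Nonempty) : r ∈ A := by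
  induction h with
  | nil => exact absurd rfl hA.ne_empty
  | root hr => exact hr
  | @cons A Y _ _ _ _ _ hY _ _ _ h0 _ _ ih =>
    rcases A.eq_empty_or_nonempty with hA | hA
    · exact Or.inr (h0 hA ▸ hY.mem)
    · exact Or.inl (ih hA)

theorem HasBranchLabel.conn (h : HasBranchLabel G r A b C) : ConnOn G A := by
  induction h with
  | nil => exact fun _ h => h.elim
  | root _ hc => exact hc
  | @cons A Y _ _ _ _ _ hY _ _ _ _ hp _ ih =>
    rcases A.eq_empty_or_nonempty with hA | hA
    · rw [hA, Set.empty_union]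
      exact hY.conn
    · obtain ⟨p, hp, hup⟩ := hp hA
      exact ih.union hY.conn hp hY.mem (Or.inr hup.symm)

theorem HasBranchLabel.lt_of_mem (h : HasBranchLabel G r A b C) : ∀ c ∈ C, ∀ e ∈ b, e < c := by
  induction h with
  | nil => simp
  | root => simp
  | cons _ _ he _ _ _ _ _ ih =>
    intro x hx
    rcases List.mem_cons.1 hx with rfl | hx
    · exact he
    · exact ih x hx

theorem HasBranchLabel.hasBags (h : HasBranchLabel G r A b C) {k : ℕ} (he : ∀ e ∈ b, e ≤ k)
    (hC : ∀ c ∈ C, c ≤ k) : HasBags G A (k + 1) := by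
  induction h generalizing k with
  | nil => exact .empty _
  | @root A e _ _ _ hu =>
    obtain ⟨L, h1, h2⟩ := hu
    have := he e rfl
    exact ⟨_, h1, fun X hX => (h2 X hX).trans (by omega)⟩
  | @cons A Y u c b C _ hY hbc hC' hd _ _ hE ih =>
    have hck := hC c (by simp)
    have h1 := hY.pos
    have h2 : HasBags G A c := by
      have := ih (k := c - 1) (fun e hb => Nat.le_sub_one_of_lt (hbc e hb))
        (fun x hx => by have := hC' x hx; omega)
      rwa [Nat.sub_add_cancel h1] at this
    exact (hY.hasBags_union h2 hd hE).mono (by omega)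

/-- With at most one arm of full level, a decomposition can end in the bag `{r}`, which is what
attaching a parent requires. In the case `zero` this is done by adding `r` to all bags. -/
theorem HasLabel.toBranch (h : HasLabel G r A e a C) (ha : a < 2) :
    HasBranchLabel G r A (some e) C := by
  classical
  induction h with
  | zero hr hc hl hu =>
    obtain ⟨S, h1, h2⟩ := hu
    have h3 := h1.insertAll (r := r)
    rw [insert_diff_self_of_mem' hr] at h3
    refine .root hr hc hl ⟨_, h3, fun X hX => ?_⟩
    rcases List.mem_append.1 hX with hX | hX
    · obtain ⟨Z, hZ, rfl⟩ := List.mem_map.1 hX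
      exact (Finset.card_insert_le _ _).trans (Nat.succ_le_succ (h2 Z hZ))
    · simp only [List.mem_singleton] at hX
      simp [hX]
  | one hr he hc hu hl =>
    obtain ⟨X, hX, -, hw⟩ := hl
    exact .root hr hc (fun h => hw (h.subset (hX.trans Set.sdiff_subset))) hu
  | two h => omega
  | cons h hY he hC hd hp hE ih =>
    exact .cons (ih ha) hY (by rintro e' ⟨⟩; exact he) hC hd
      (fun h0 => absurd h0 (Set.Nonempty.ne_empty ⟨_, h.mem⟩)) (fun _ => hp) hE

/-- A root with two full arms becomes the root of a critical subtree once it has a parent; its level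
joins the list and the remaining part is empty. -/
theorem HasLabel.toBranch_two (h : HasLabel G r A e a C) (ha : a = 2) :
    HasBranchLabel G r A none (C ++ [e]) := by
  induction h with
  | zero => omega
  | one => omega
  | two h =>
    have := HasBranchLabel.cons (.nil (G := G) (r := r)) h (by simp) (by simp) (by simp)
      (fun _ => rfl) (by simp) (by simp)
    rwa [Set.empty_union] at this
  | cons h hY he hC hd hp hE ih =>
    refine .cons (ih ha) hY (by simp) ?_ hd
      (fun h0 => absurd h0 (Set.Nonempty.ne_empty ⟨_, h.mem⟩)) (fun _ => hp) hE
    intro x hx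
    rcases List.mem_append.1 hx with hx | hx
    · exact hC x hx
    · simp only [List.mem_singleton] at hx
      rwa [hx]

/-- Data for joining two rooted parts by an edge between their roots. -/
structure Joinable (G : SimpleGraph V) (r r' : V) (A₁ A₂ : Set V) : Prop where
  disj : Disjoint A₁ A₂
  adj : A₂.Nonempty → G.Adj r r'
  edge : ∀ x ∈ A₁, ∀ y ∈ A₂, G.Adj x y → x = r ∧ y = r'

/-- Deleting `r` separates the two parts; hence joining raises the pathwidth by at most one. -/
theorem Joinable.hasBags_diff (hJ : Joinable G r r' A₁ A₂) {k : ℕ} (h₁ : HasBags G A₁ k)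
    (h₂ : HasBags G A₂ k) (hr : r ∈ A₁) : HasBags G ((A₁ ∪ A₂) \ {r}) k := by
  have hset : (A₁ ∪ A₂) \ {r} = A₁ \ {r} ∪ A₂ := by
    rw [Set.union_sdiff_distrib, Set.sdiff_singleton_eq_self (Set.disjoint_left.1 hJ.disj hr)]
  rw [hset]
  exact (h₁.subset Set.sdiff_subset).union h₂ (hJ.disj.mono_left Set.sdiff_subset)
    fun x hx y hy hxy => hx.2 (hJ.edge x hx.1 y hy hxy).1

theorem Joinable.conn (hJ : Joinable G r r' A₁ A₂) (c₁ : ConnOn G A₁) (c₂ : ConnOn G A₂)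
    (hr : r ∈ A₁) (hr' : A₂.Nonempty → r' ∈ A₂) : ConnOn G (A₁ ∪ A₂) := by
  rcases A₂.eq_empty_or_nonempty with h | h
  · rwa [h, Set.union_empty]
  · exact c₁.union c₂ hr (hr' h) (Or.inr (hJ.adj h))

/-- Whenever the join reaches level `k + 1` although both parts stay at `k`, deleting `r` leaves
only smaller pathwidth, so the root has no arm of the new level and the label starts afresh. -/
theorem HasLabel.overflow (h₁ : HasLabel G r A₁ e a C₁) (h₂ : HasBranchLabel G r' A₂ b C₂)
    (hJ : Joinable G r r' A₁ A₂) {k : ℕ} (he : e ≤ k) (hC₁ : ∀ c ∈ C₁, c ≤ k)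
    (hb : ∀ e ∈ b, e ≤ k) (hC₂ : ∀ c ∈ C₂, c ≤ k) (hl : ¬ HasBags G (A₁ ∪ A₂) (k + 1)) :
    HasLabel G r (A₁ ∪ A₂) (k + 1) 0 [] :=
  .zero (Or.inl h₁.mem) (hJ.conn h₁.conn h₂.conn h₁.mem h₂.mem) hl
    (hJ.hasBags_diff (h₁.hasBags he hC₁) (h₂.hasBags hb hC₂) h₁.mem)

/-- Appending the rest of the tree, with the root `r` in all bags, to a decomposition. -/
theorem Joinable.decomposes_append [DecidableEq V] (hJ : Joinable G r r' A₁ A₂) (hr : r ∈ A₁)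
    {L R S : List (Finset V)} (h₁ : DecomposesOn G A₁ (L ++ {r} :: R))
    (h₂ : DecomposesOn G A₂ S) :
    DecomposesOn G (A₁ ∪ A₂) (L ++ {r} :: (S.map (insert r) ++ [{r}] ++ R)) := by
  have h3 := h₁.insertMiddle (h₂.insertAll (r := r)) (forall_mem_insertAll r S)
    (by
      rintro a ha (rfl | ha')
      · rfl
      · exact absurd ha' (Set.disjoint_left.1 hJ.disj ha))
    (by
      rintro x hx y (rfl | hy) hyu hxy
      · exact absurd rfl hyu
      · exact (hJ.edge x hx y hy hxy).1)
    (Or.inl rfl)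
  have hset : A₁ ∪ insert r A₂ = A₁ ∪ A₂ := by
    rw [Set.union_insert]
    exact Set.insert_eq_of_mem (Or.inl hr)
  rwa [hset] at h3

/-- A branch of smaller pathwidth is inserted at the bag `{r}` with `r` added to its bags, which
never exceed `e + 1`. -/
theorem HasLabel.absorb_small (h₁ : HasLabel G r A₁ e a []) (h₂ : HasBranchLabel G r' A₂ b C₂)
    (hJ : Joinable G r r' A₁ A₂) (hb : ∀ k ∈ b, k < e) (hC₂ : ∀ c ∈ C₂, c < e) :
    HasLabel G r (A₁ ∪ A₂) e a [] := by
  classical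
  rcases A₂.eq_empty_or_nonempty with h0 | h0
  · rwa [h0, Set.union_empty]
  have hr := h₁.mem
  have hc := hJ.conn h₁.conn h₂.conn h₁.mem h₂.mem
  -- At level `0` nothing can be smaller except the empty branch.
  have hpos : 1 ≤ e := by
    by_contra h
    obtain rfl : e = 0 := by omega
    have : HasBranchLabel G r' A₂ b C₂ := h₂
    cases h₂ with
    | nil => exact absurd rfl h0.ne_empty
    | @root A e => exact absurd (hb e rfl) (by omega)
    | @cons A Y u c => exact absurd (hC₂ c (by simp)) (by omega)
  have w₂ : HasBags G A₂ e := by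
    have := h₂.hasBags (k := e - 1) (fun k hk => by have := hb k hk; omega)
      (fun c hc => by have := hC₂ c hc; omega)
    rwa [Nat.sub_add_cancel hpos] at this
  have w₂' := w₂
  obtain ⟨S, hS, hSk⟩ := w₂
  have hcard : ∀ (L R : List (Finset V)), (∀ X ∈ L ++ {r} :: R, X.card ≤ e + 1) →
      ∀ X ∈ L ++ {r} :: (S.map (insert r) ++ [{r}] ++ R), X.card ≤ e + 1 := by
    intro L R h X hX
    simp only [List.mem_append, List.mem_cons, List.mem_map, List.not_mem_nil, or_false] at hX
    rcases hX with hX | rfl | (⟨Z, hZ, rfl⟩ | rfl) | hX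
    · exact h X (by simp [hX])
    · simp
    · exact (Finset.card_insert_le _ _).trans (Nat.succ_le_succ (hSk Z hZ))
    · simp
    · exact h X (by simp [hX])
  have hsub : A₁ \ {r} ⊆ (A₁ ∪ A₂) \ {r} := fun x hx => ⟨Or.inl hx.1, hx.2⟩
  cases h₁ with
  | zero _ _ hl hu =>
    refine .zero (Or.inl hr) hc (fun h => hl (h.subset Set.subset_union_left)) ?_
    have hset : (A₁ ∪ A₂) \ {r} = A₁ \ {r} ∪ A₂ := by
      rw [Set.union_sdiff_distrib, Set.sdiff_singleton_eq_self (Set.disjoint_left.1 hJ.disj hr)]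
    rw [hset]
    exact hu.union w₂' (hJ.disj.mono_left Set.sdiff_subset)
      fun x hx y hy hxy => hx.2 (hJ.edge x hx.1 y hy hxy).1
  | one _ he _ hu hl =>
    obtain ⟨L, h1, h2⟩ := hu
    obtain ⟨X, hX, hXc, hXw⟩ := hl
    refine .one (Or.inl hr) he hc ⟨L ++ {r} :: S.map (insert r), ?_, ?_⟩
      ⟨X, hX.trans hsub, hXc, hXw⟩
    · simpa using hJ.decomposes_append hr h1 hS
    · simpa using hcard L [] h2
  | two h =>
    obtain ⟨L, R, h1, h2⟩ := h.decomp
    obtain ⟨X₁, X₂, hX₁, hX₂, hX⟩ := h.arms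
    exact .two ⟨Or.inl hr, h.pos, hc, ⟨L, _, hJ.decomposes_append hr h1 hS, hcard L R h2⟩,
      X₁, X₂, hX₁.trans hsub, hX₂.trans hsub, hX⟩

/-- The branch at `r'` continued by the vertex `r`. -/
theorem Joinable.decomposes_branch [DecidableEq V] (hJ : Joinable G r r' A₁ A₂) (hr : r ∈ A₁)
    {k : ℕ} (hk : 1 ≤ k) {L : List (Finset V)} (h₂ : DecomposesOn G A₂ (L ++ [{r'}]))
    (hL : ∀ X ∈ L ++ [{r'}], X.card ≤ k + 1) :
    ∃ L', DecomposesOn G (insert r A₂) (L' ++ [{r}]) ∧ ∀ X ∈ L' ++ [{r}], X.card ≤ k + 1 := by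
  have hr' : r' ∈ A₂ := h₂.sub {r'} (by simp) r' (by simp)
  -- The final bag `{r'}` is followed by `{r', r}` and then `{r}`; the bag of two vertices is why `1
  -- ≤ k` is needed.
  have hpair : DecomposesOn G {r', r} [{r', r}] := by
    refine ⟨by simp, by simp, ?_, fun X Y Z hs => by simpa using hs.length_le⟩
    rintro a (rfl | rfl) b (rfl | rfl) - <;> simp
  have h3 := h₂.insertMiddle hpair (by simp)
    (by
      rintro a ha (rfl | rfl)
      · rfl
      · exact absurd ha (Set.disjoint_left.1 hJ.disj hr))
    (by
      rintro x hx y (rfl | rfl) hyr hxy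
      · exact absurd rfl hyr
      · exact (hJ.edge y hr x hx hxy.symm).2)
    (Or.inl rfl)
  have hset : A₂ ∪ {r', r} = insert r A₂ := by
    ext x
    simp only [Set.mem_union, Set.mem_insert_iff, Set.mem_singleton_iff]
    constructor
    · rintro (h | rfl | rfl)
      · exact Or.inr h
      · exact Or.inr hr'
      · exact Or.inl rfl
    · rintro (rfl | h)
      · exact Or.inr (Or.inr rfl)
      · exact Or.inl h
  rw [hset, List.append_cons] at h3
  have h4 := DecomposesOn.insertSubbag (Y := {r}) (R := []) h3 (by simp) (by simp)
  refine ⟨L ++ [{r'}] ++ [{r', r}], by simpa using h4, fun X hX => ?_⟩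
  rw [List.mem_append, List.mem_append, List.mem_singleton, List.mem_singleton] at hX
  rcases hX with (hX | rfl) | rfl
  · exact hL X hX
  · exact Finset.card_le_two.trans (by omega)
  · simp

/-- The branch is used first, ending in `{r}`; then follows the rest of `A₁` with `r` in all bags,
again ending in `{r}`. -/
theorem Joinable.decomposes_one (hJ : Joinable G r r' A₁ A₂) (hr : r ∈ A₁) {k : ℕ} (hk : 1 ≤ k)
    (h₁ : HasBags G (A₁ \ {r}) k)
    (h₂ : ∃ L, DecomposesOn G A₂ (L ++ [{r'}]) ∧ ∀ X ∈ L ++ [{r'}], X.card ≤ k + 1) :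
    ∃ L, DecomposesOn G (A₁ ∪ A₂) (L ++ [{r}]) ∧ ∀ X ∈ L ++ [{r}], X.card ≤ k + 1 := by
  classical
  obtain ⟨L₀, h3, h4⟩ := h₂
  obtain ⟨L, h5, h6⟩ := hJ.decomposes_branch hr hk h3 h4
  obtain ⟨S, hS, hSk⟩ := h₁
  have h7 := hS.insertAll (r := r)
  rw [insert_diff_self_of_mem' hr] at h7
  have h8 := h5.insertMiddle h7 (forall_mem_insertAll r S)
    (by
      rintro a (rfl | ha) ha'
      · rfl
      · exact absurd ha (Set.disjoint_left.1 hJ.disj ha'))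
    (by
      rintro x (rfl | hx) y hy hyr hxy
      · rfl
      · exact absurd (hJ.edge y hy x hx hxy.symm).1 hyr)
    hr
  have hset : insert r A₂ ∪ A₁ = A₁ ∪ A₂ := by
    rw [Set.insert_union, Set.union_comm]
    exact Set.insert_eq_of_mem (Or.inl hr)
  rw [hset] at h8
  refine ⟨L ++ {r} :: S.map (insert r), by simpa using h8, fun X hX => ?_⟩
  simp only [List.mem_append, List.mem_cons, List.mem_map, List.not_mem_nil, or_false] at hX
  rcases hX with (hX | rfl | ⟨Z, hZ, rfl⟩) | rfl
  · exact h6 X (by simp [hX])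
  · simp
  · exact (Finset.card_insert_le _ _).trans (Nat.succ_le_succ (hSk Z hZ))
  · simp

/-- Gluing two decompositions at a common vertex. -/
theorem DecomposesOn.glue {A B : Set V} {L R : List (Finset V)} {u : V}
    (h : DecomposesOn G A (L ++ [{u}])) (h' : DecomposesOn G B ({u} :: R))
    (hd : ∀ a, a ∈ A → a ∈ B → a = u)
    (hadj : ∀ x ∈ A, ∀ y ∈ B, x ≠ u → y ≠ u → ¬ G.Adj x y) :
    DecomposesOn G (A ∪ B) (L ++ {u} :: R) := by
  have huA : u ∈ A := h.sub {u} (by simp) u (by simp)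
  have huB : u ∈ B := h'.sub {u} (by simp) u (by simp)
  have key : ∀ X ∈ L ++ [{u}], X ∈ L ++ {u} :: R := by
    intro X hX
    simp only [List.mem_append, List.mem_cons, List.not_mem_nil, or_false] at hX ⊢
    tauto
  have key' : ∀ X ∈ {u} :: R, X ∈ L ++ {u} :: R := fun X hX => List.mem_append_right _ hX
  refine ⟨?_, ?_, ?_, ?_⟩
  · intro X hX a ha
    rcases List.mem_append.1 hX with hX | hX
    · exact Or.inl (h.sub X (List.mem_append_left _ hX) a ha)
    · exact Or.inr (h'.sub X hX a ha)
  · rintro a (ha | ha)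
    · obtain ⟨X, hX, haX⟩ := h.vertex a ha
      exact ⟨X, key X hX, haX⟩
    · obtain ⟨X, hX, haX⟩ := h'.vertex a ha
      exact ⟨X, key' X hX, haX⟩
  · have aux : ∀ a ∈ A, ∀ b ∈ B, G.Adj a b → ∃ X ∈ L ++ {u} :: R, a ∈ X ∧ b ∈ X := by
      intro a ha b hb hab
      by_cases hau : a = u
      · obtain ⟨X, hX, h1⟩ := h'.edge a (hau ▸ huB) b hb hab
        exact ⟨X, key' X hX, h1⟩
      by_cases hbu : b = u
      · obtain ⟨X, hX, h1⟩ := h.edge a ha b (hbu ▸ huA) hab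
        exact ⟨X, key X hX, h1⟩
      · exact absurd hab (hadj a ha b hb hau hbu)
    rintro a (ha | ha) b (hb | hb) hab
    · obtain ⟨X, hX, haX⟩ := h.edge a ha b hb hab
      exact ⟨X, key X hX, haX⟩
    · exact aux a ha b hb hab
    · obtain ⟨X, h1, h2, h3⟩ := aux b hb a ha hab.symm
      exact ⟨X, h1, h3, h2⟩
    · obtain ⟨X, hX, haX⟩ := h'.edge a ha b hb hab
      exact ⟨X, key' X hX, haX⟩
  · intro X Y Z hs a hX hZ
    have hA : ∀ X ∈ L, a ∈ X → a ∈ A := fun X hX => h.sub X (List.mem_append_left _ hX) a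
    have hB : ∀ X ∈ {u} :: R, a ∈ X → a ∈ B := fun X hX => h'.sub X hX a
    rcases sublist_three_append.1 hs with h1 | ⟨h1, h2⟩ | ⟨h1, h2⟩ | h1
    · exact h.interval X Y Z (sublist_three_append.2 (Or.inl h1)) a hX hZ
    · obtain rfl := hd a (hA X (h1.subset (by simp)) hX) (hB Z h2 hZ)
      exact h.interval X Y {a} (sublist_three_append.2 (Or.inr (Or.inl ⟨h1, by simp⟩))) a hX
        (by simp)
    · obtain rfl := hd a (hA X h1 hX) (hB Z (h2.subset (by simp)) hZ)
      rcases sublist_two_cons.1 h2 with ⟨rfl, -⟩ | h3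
      · simp
      · exact h'.interval {a} Y Z (sublist_three_cons.2 (Or.inl ⟨rfl, h3⟩)) a (by simp) hZ
    · exact h'.interval X Y Z h1 a hX hZ

theorem Joinable.conn_insert (hJ : Joinable G r r' A₁ A₂) (h₂ : ConnOn G A₂) (hr' : r' ∈ A₂) :
    ConnOn G (insert r A₂) := by
  have := (ConnOn.singleton G r).union h₂ rfl hr' (Or.inr (hJ.adj ⟨r', hr'⟩))
  rwa [Set.singleton_union] at this

theorem Joinable.subset_diff (hJ : Joinable G r r' A₁ A₂) (hr : r ∈ A₁) :
    A₂ ⊆ (A₁ ∪ A₂) \ {r} := by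
  refine fun x hx => ⟨Or.inr hx, ?_⟩
  rintro rfl
  exact Set.disjoint_left.1 hJ.disj hr hx

/-- Everything at the old root has pathwidth below `k`, so the new branch is the only arm of level
`k`. -/
theorem HasLabel.absorb_large {k : ℕ} (h₁ : HasLabel G r A₁ e a C₁)
    (h₂ : HasBranchLabel G r' A₂ (some k) []) (hJ : Joinable G r r' A₁ A₂) (he : e < k)
    (hC₁ : ∀ c ∈ C₁, c < k) : HasLabel G r (A₁ ∪ A₂) k 1 [] := by
  cases h₂ with
  | root hr' hc hl hu =>
    have w₁ : HasBags G A₁ k := by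
      have := h₁.hasBags (k := k - 1) (by omega) (fun c hc => Nat.le_sub_one_of_lt (hC₁ c hc))
      rwa [Nat.sub_add_cancel (by omega)] at this
    exact .one (Or.inl h₁.mem) (by omega) (hJ.conn h₁.conn hc h₁.mem fun _ => hr')
      (hJ.decomposes_one h₁.mem (by omega) (w₁.subset Set.sdiff_subset) hu)
      ⟨A₂, hJ.subset_diff h₁.mem, hJ.conn_insert hc hr', hl⟩

theorem not_hasBags_one_of_adj {x y : V} (hx : x ∈ A) (hy : y ∈ A) (hxy : G.Adj x y) :
    ¬ HasBags G A 1 := by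
  rintro ⟨S, h1, h2⟩
  obtain ⟨X, hX, hxX, hyX⟩ := h1.edge x hx y hy hxy
  exact hxy.ne (Finset.card_le_one.1 (h2 X hX) x hxX y hyX)

/-- The number of arms of level `e` at the root goes from none to one to two, always within width
`e`; a third one forces `e + 1`. -/
theorem HasLabel.absorb_equal (h₁ : HasLabel G r A₁ e a [])
    (h₂ : HasBranchLabel G r' A₂ (some e) []) (hJ : Joinable G r r' A₁ A₂) :
    HasLabel G r (A₁ ∪ A₂) (absorbLevel e a e).1 (absorbLevel e a e).2.1
      (absorbLevel e a e).2.2 := by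
  classical
  have hr := h₁.mem
  have h₂' := h₂
  cases h₂ with
  | root hr' hc hl hu =>
    have hcU := hJ.conn h₁.conn hc h₁.mem fun _ => hr'
    have hnd : ¬ (e < e) := lt_irrefl e
    -- Level `0` is exceptional: the single new edge already needs a bag of size two.
    by_cases he0 : e = 0
    · subst he0
      have : absorbLevel 0 a 0 = (1, 0, []) := by simp [absorbLevel]
      rw [this]
      exact h₁.overflow h₂' hJ le_rfl (by simp) (by simp) (by simp)
        (not_hasBags_one_of_adj (Or.inl hr) (Or.inr hr') (hJ.adj ⟨r', hr'⟩))
    have hpos : 1 ≤ e := by omega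
    have hsub : A₁ \ {r} ⊆ (A₁ ∪ A₂) \ {r} := fun x hx => ⟨Or.inl hx.1, hx.2⟩
    have hc' := hJ.conn_insert hc hr'
    have h₁' := h₁
    cases h₁ with
    | zero _ _ _ hu₁ =>
      have : absorbLevel e 0 e = (e, 1, []) := by simp [absorbLevel, he0]
      rw [this]
      exact .one (Or.inl hr) hpos hcU (hJ.decomposes_one hr hpos hu₁ hu)
        ⟨A₂, hJ.subset_diff hr, hc', hl⟩
    | one _ _ _ hu₁ hl₁ =>
      have : absorbLevel e 1 e = (e, 2, []) := by simp [absorbLevel, he0]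
      rw [this]
      obtain ⟨L₁, h3, h4⟩ := hu₁
      obtain ⟨L, h5, h6⟩ := hu
      obtain ⟨L', h7, h8⟩ := hJ.decomposes_branch hr hpos h5 h6
      obtain ⟨X, hX, hXc, hXw⟩ := hl₁
      -- One decomposition ends in `{r}`, and the reverse of the other begins with `{r}`; gluing
      -- them leaves `{r}` in the middle, as a block requires.
      have h9 := h7.reverse
      rw [List.reverse_append, List.reverse_singleton, List.singleton_append] at h9
      have h10 := h3.glue h9
        (by
          rintro x hx (rfl | hx')
          · rfl
          · exact absurd hx' (Set.disjoint_left.1 hJ.disj hx))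
        (by
          rintro x hx y (rfl | hy) hxr hyr hxy
          · exact hyr rfl
          · exact hxr (hJ.edge x hx y hy hxy).1)
      have hset : A₁ ∪ insert r A₂ = A₁ ∪ A₂ := by
        rw [Set.union_insert]
        exact Set.insert_eq_of_mem (Or.inl hr)
      rw [hset] at h10
      refine .two ⟨Or.inl hr, hpos, hcU, ⟨L₁, L'.reverse, h10, fun Z hZ => ?_⟩, X, A₂,
        hX.trans hsub, hJ.subset_diff hr, hJ.disj.mono_left (hX.trans Set.sdiff_subset), hXc, hc',
        hXw, hl⟩
      simp only [List.mem_append, List.mem_cons, List.mem_reverse] at hZ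
      rcases hZ with hZ | rfl | hZ
      · exact h4 Z (by simp [hZ])
      · simp
      · exact h8 Z (by simp [hZ])
    | two hB =>
      have : absorbLevel e 2 e = (e + 1, 0, []) := by simp [absorbLevel, he0]
      rw [this]
      obtain ⟨X₁, X₂, hX₁, hX₂, h12, c₁, c₂, w₁, w₂⟩ := hB.arms
      refine h₁'.overflow h₂' hJ le_rfl (by simp) (by simp) (by simp)
        (not_hasBags_of_arms (fun x hx => (hsub (hX₁ hx)).1) (fun x hx => (hsub (hX₂ hx)).1)
          Set.subset_union_right (Or.inl hr) h12
          (hJ.disj.mono_left (hX₁.trans Set.sdiff_subset))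
          (hJ.disj.mono_left (hX₂.trans Set.sdiff_subset)) (fun h => (hX₁ h).2 rfl)
          (fun h => (hX₂ h).2 rfl) (Set.disjoint_left.1 hJ.disj hr) c₁ c₂ hc' w₁ w₂ hl)

end Semantics

/-! ### Correctness of the label of a join. -/

section Join

variable {V : Type*} {G : SimpleGraph V} {r r' : V} {A A₁ A₂ : Set V} {e a : ℕ}
  {C C₁ C₂ : List ℕ} {b : Option ℕ}

/-- The label of the part at the root, before the critical subtrees are added. -/
def baseLevel (e a : ℕ) (b : Option ℕ) : ℕ × ℕ × List ℕ :=
  b.elim (e, a, []) (absorbLevel e a)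

def HasTriple (G : SimpleGraph V) (r : V) (A : Set V) (l : ℕ × ℕ × List ℕ) : Prop :=
  HasLabel G r A l.1 l.2.1 l.2.2

theorem topLevel_absorbLevel_of_lt {k : ℕ} (h : e < k) : absorbLevel e a k = (k, 1, []) := by
  rw [absorbLevel, if_neg (by omega), if_pos h]

theorem absorbLevel_of_gt {k : ℕ} (h : k < e) : absorbLevel e a k = (e, a, []) := by
  rw [absorbLevel, if_pos h]

theorem baseLevel_of_lt (hb : ∀ k ∈ b, k < e) : baseLevel e a b = (e, a, []) := by
  cases b with
  | none => rfl
  | some k => exact absorbLevel_of_gt (hb k rfl)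

/-- Putting `r` into all bags after its deletion costs only one, so two parts with bags of size at
most `N` give a whole of level at most `N`. -/
theorem HasTriple.topLevel_le {l : ℕ × ℕ × List ℕ} {N : ℕ} (h : HasTriple G r (A₁ ∪ A₂) l)
    (h₁ : HasBags G A₁ N) (h₂ : HasBags G A₂ N) (hJ : Joinable G r r' A₁ A₂) (hr : r ∈ A₁) :
    topLevel l ≤ N := by
  by_contra hcon
  have h3 := (hJ.hasBags_diff h₁ h₂ hr).insert r
  rw [insert_diff_self_of_mem' (A := A₁ ∪ A₂) (Or.inl hr)] at h3
  exact HasLabel.not_hasBags h (h3.mono (not_le.1 hcon))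

theorem pushLevel_of_lt {c : ℕ} {l : ℕ × ℕ × List ℕ} (h : topLevel l < c) :
    pushLevel c l = (l.1, l.2.1, c :: l.2.2) := by
  rw [pushLevel, if_pos h]

theorem pushLevel_of_eq {c : ℕ} {l : ℕ × ℕ × List ℕ} (h : topLevel l = c) :
    pushLevel c l = (c + 1, 0, []) := by
  rw [pushLevel, if_neg (by omega), if_pos h]

theorem pushLevel_of_gt {c : ℕ} {l : ℕ × ℕ × List ℕ} (h : c < topLevel l) :
    pushLevel c l = l := by
  rw [pushLevel, if_neg (by omega), if_neg (by omega)]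

theorem HasTriple.push {Y : Set V} {u : V} {c : ℕ} {l : ℕ × ℕ × List ℕ} (h : HasTriple G r A l)
    (hY : IsBlock G Y u c) (hlt : topLevel l < c) (hd : Disjoint A Y) (hp : ∃ p ∈ A, G.Adj u p)
    (hE : ∀ x ∈ A, ∀ y ∈ Y, G.Adj x y → y = u) : HasTriple G r (A ∪ Y) (pushLevel c l) := by
  rw [pushLevel_of_lt hlt]
  have htop := HasLabel.le_topLevel h
  exact .cons h hY (htop.1.trans_lt hlt) (fun x hx => (htop.2 x hx).trans_lt hlt) hd hp hE

theorem contains_of_head {N c : ℕ} (h : c = N) (C : List ℕ) : (c :: C).contains N = true := by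
  simp [h]

/-- Induction on the bound for the levels: blocks of the highest level `N` are peeled off, the rest
is treated by induction, and then the blocks are put back. They either extend the list or cause an
overflow. -/
theorem HasLabel.pushLevels {N : ℕ} (h₁ : HasLabel G r A₁ e a C₁)
    (h₂ : HasBranchLabel G r' A₂ b C₂) (hJ : Joinable G r r' A₁ A₂) (hN₁ : ∀ c ∈ C₁, c < N)
    (hN₂ : ∀ c ∈ C₂, c < N) :
    HasTriple G r (A₁ ∪ A₂) (pushLevels N (baseLevel e a b) C₁ C₂) := by
  induction N generalizing A₁ A₂ C₁ C₂ with
  | zero =>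
    obtain rfl : C₁ = [] := List.eq_nil_iff_forall_not_mem.2 fun c hc => by
      have := hN₁ c hc; omega
    obtain rfl : C₂ = [] := List.eq_nil_iff_forall_not_mem.2 fun c hc => by
      have := hN₂ c hc; omega
    change HasTriple G r _ (baseLevel e a b)
    cases b with
    | none => exact h₁.absorb_small h₂ hJ (by simp) (by simp)
    | some k =>
      rcases lt_trichotomy k e with hk | rfl | hk
      · have : baseLevel e a (some k) = (e, a, []) := absorbLevel_of_gt hk
        rw [this]
        exact h₁.absorb_small h₂ hJ (by rintro k' ⟨⟩; exact hk) (by simp)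
      · exact h₁.absorb_equal h₂ hJ
      · have : baseLevel e a (some k) = (k, 1, []) := topLevel_absorbLevel_of_lt hk
        rw [this]
        exact h₁.absorb_large h₂ hJ hk (by simp)
  | succ N ih =>
    -- the cases in which one of the two parts is negligible
    by_cases hs₂ : C₁ = [] ∧ (∀ k ∈ b, k < e) ∧ ∀ c ∈ C₂, c < e
    · obtain ⟨rfl, hb, hC₂⟩ := hs₂
      rw [baseLevel_of_lt hb, pushLevels_of_lt (by simp) (by simpa [topLevel] using hC₂)]
      exact h₁.absorb_small h₂ hJ hb hC₂
    by_cases hs₁ : C₂ = [] ∧ ∃ k, b = some k ∧ e < k ∧ ∀ c ∈ C₁, c < k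
    · obtain ⟨rfl, k, rfl, hek, hC₁⟩ := hs₁
      have : baseLevel e a (some k) = (k, 1, []) := topLevel_absorbLevel_of_lt hek
      rw [this, pushLevels_of_lt (by simpa [topLevel] using hC₁) (by simp)]
      exact h₁.absorb_large h₂ hJ hek hC₁
    rw [pushLevels_succ]
    -- levels of the parts
    have hb_of : ∀ c ∈ C₂, ∀ k ∈ b, k < c := h₂.lt_of_mem
    have he_of : ∀ c ∈ C₁, e < c := h₁.lt_of_mem
    by_cases m₁ : N ∈ C₁
    · have heN := he_of N m₁
      have h₁' := h₁
      cases h₁ with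
      | zero => simp at m₁
      | one => simp at m₁
      | two => simp at m₁
      | @cons A₁ Y u c _ _ C₁ g₁ hY he hC hd hp hE =>
        obtain rfl : c = N := by
          rcases List.mem_cons.1 m₁ with h | h
          · exact h.symm
          · have := hC N h
            have := hN₁ c (by simp)
            omega
        have hJ₁ : Joinable G r r' A₁ A₂ :=
          ⟨hJ.disj.mono_left Set.subset_union_left, hJ.adj, fun x hx => hJ.edge x (Or.inl hx)⟩
        have hYA₂ : Disjoint Y A₂ := hJ.disj.mono_left Set.subset_union_right
        have hE₂ : ∀ x ∈ A₂, ∀ y ∈ Y, ¬ G.Adj x y := by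
          intro x hx y hy hxy
          obtain rfl := (hJ.edge y (Or.inr hy) x hx hxy.symm).1
          exact Set.disjoint_left.1 hd g₁.mem hy
        have hw₁ : HasBags G A₁ c := by
          have := g₁.hasBags (k := c - 1) (by omega)
            (fun x hx => Nat.le_sub_one_of_lt (hC x hx))
          rwa [Nat.sub_add_cancel (by omega)] at this
        rw [contains_of_head rfl, pushLevels_cons_left le_rfl]
        have hset : A₁ ∪ Y ∪ A₂ = A₁ ∪ A₂ ∪ Y := Set.union_right_comm _ _ _
        have hdY : Disjoint (A₁ ∪ A₂) Y := Set.disjoint_union_left.2 ⟨hd, hYA₂.symm⟩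
        have hpY : ∃ p ∈ A₁ ∪ A₂, G.Adj u p := by
          obtain ⟨p, hp, hup⟩ := hp
          exact ⟨p, Or.inl hp, hup⟩
        have hEY : ∀ x ∈ A₁ ∪ A₂, ∀ y ∈ Y, G.Adj x y → y = u := by
          rintro x (hx | hx) y hy hxy
          · exact hE x hx y hy hxy
          · exact absurd hxy (hE₂ x hx y hy)
        have hconn := hJ₁.conn g₁.conn h₂.conn g₁.mem h₂.mem
        have hC₁le : ∀ x ∈ c :: C₁, x ≤ c := by
          intro x hx
          have := hN₁ x hx
          omega
        have hC₂le : ∀ x ∈ C₂, x ≤ c := by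
          intro x hx
          have := hN₂ x hx
          omega
        by_cases m₂ : c ∈ C₂
        · -- two critical subtrees of the same level
          have hbc : ∀ k ∈ b, k < c := hb_of c m₂
          have h₂' := h₂
          cases h₂ with
          | nil => simp at m₂
          | root => simp at m₂
          | @cons A₂ Y₂ u₂ c₂ _ C₂ g₂ hY₂ he₂ hC₂ hd₂ h0 hp₂ hE₂' =>
            obtain rfl : c = c₂ := by
              rcases List.mem_cons.1 m₂ with h | h
              · exact h
              · have := hC₂ c h
                have := hN₂ c₂ (by simp)
                omega
            have hover : HasTriple G r (A₁ ∪ Y ∪ (A₂ ∪ Y₂)) (c + 1, 0, []) := by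
              refine h₁'.overflow h₂' hJ heN.le hC₁le (fun k hk => (hbc k hk).le) hC₂le ?_
              rw [hset]
              refine hY.overflow hconn hdY hpY fun h => hY₂.not_hasBags (h.subset ?_)
              exact fun x hx => Or.inr (Or.inr hx)
            have hJ₂ : Joinable G r r' A₁ A₂ :=
              ⟨hJ₁.disj.mono_right Set.subset_union_left, fun h => hJ₁.adj (h.mono (by simp)),
                fun x hx y hy => hJ₁.edge x hx y (Or.inl hy)⟩
            have hlt : ∀ x ∈ C₁, x < c := hC
            have hlt₂ : ∀ x ∈ C₂, x < c := hC₂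
            have hR := ih g₁ g₂ hJ₂ hlt hlt₂
            have hw₂ : HasBags G A₂ c := by
              have := g₂.hasBags (k := c - 1) (fun k hk => Nat.le_sub_one_of_lt (hbc k hk))
                (fun x hx => Nat.le_sub_one_of_lt (hC₂ x hx))
              rwa [Nat.sub_add_cancel (by omega)] at this
            have htop := hR.topLevel_le hw₁ hw₂ hJ₂ g₁.mem
            rw [pushLevels_cons_right le_rfl, contains_of_head rfl]
            -- If the rest is below `c`, the first block enters the list and the second overflows;
            -- if it has level `c`, the first overflows and the second is too small to matter.
            have : pushIf true c (pushIf true c (_root_.pushLevels c (baseLevel e a b) C₁ C₂)) =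
                (c + 1, 0, []) := by
              change pushLevel c (pushLevel c _) = _
              rcases htop.lt_or_eq with htop | htop
              · rw [pushLevel_of_lt htop, pushLevel_of_eq (c := c) rfl]
              · rw [pushLevel_of_eq htop, pushLevel_of_gt (by simp [topLevel])]
            rw [this]
            exact hover
        · have hm₂ : C₂.contains c = false := by simpa using m₂
          rw [hm₂]
          change HasTriple G r _ (pushLevel c _)
          have hC₂lt : ∀ x ∈ C₂, x < c := fun x hx =>
            lt_of_le_of_ne (hC₂le x hx) fun h => m₂ (h ▸ hx)
          have hR := ih g₁ h₂ hJ₁ hC hC₂lt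
          -- If `b` exceeded `c`, so would every level of `C₂`; then `C₂` would be empty and the
          -- first part negligible, a case already settled.
          have hble : ∀ k ∈ b, k ≤ c := by
            intro k hk
            by_contra hcon
            refine hs₁ ⟨?_, k, hk, by omega, fun x hx => by have := hC₁le x hx; omega⟩
            refine List.eq_nil_iff_forall_not_mem.2 fun x hx => ?_
            have := hb_of x hx k hk
            have := hC₂le x hx
            omega
          have htop : topLevel (_root_.pushLevels c (baseLevel e a b) C₁ C₂) ≤ c := by
            by_cases hbc : ∀ k ∈ b, k < c
            · have hw₂ : HasBags G A₂ c := by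
                have := h₂.hasBags (k := c - 1) (fun k hk => Nat.le_sub_one_of_lt (hbc k hk))
                  (fun x hx => Nat.le_sub_one_of_lt (hC₂lt x hx))
                rwa [Nat.sub_add_cancel (by omega)] at this
              exact hR.topLevel_le hw₁ hw₂ hJ₁ g₁.mem
            · push Not at hbc
              obtain ⟨k, hk, hck⟩ := hbc
              obtain rfl : k = c := le_antisymm (hble k hk) hck
              obtain rfl : C₂ = [] := List.eq_nil_iff_forall_not_mem.2 fun x hx => by
                have := hb_of x hx k hk
                have := hC₂le x hx
                omega
              have hbase : baseLevel e a b = (k, 1, []) := by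
                rw [Option.mem_def.1 hk]
                exact topLevel_absorbLevel_of_lt heN
              rw [hbase, pushLevels_of_lt (by simpa [topLevel] using hC) (by simp)]
              exact le_rfl
          -- If the rest has level below `c`, the block is hung on it. If it has level exactly `c`,
          -- it is a third arm at `u`.
          rcases htop.lt_or_eq with htop | htop
          · rw [hset]
            exact hR.push hY htop hdY hpY hEY
          · rw [pushLevel_of_eq htop]
            refine h₁'.overflow h₂ hJ heN.le hC₁le hble hC₂le ?_
            rw [hset]
            refine hY.overflow hconn hdY hpY ?_
            have := HasLabel.not_hasBags hR
            rwa [show topLevel _ = c from htop] at this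
    · have hm₁ : C₁.contains N = false := by simpa using m₁
      rw [hm₁]
      change HasTriple G r _ (pushIf _ N (_root_.pushLevels N _ C₁ C₂))
      have hC₁lt : ∀ x ∈ C₁, x < N := fun x hx =>
        lt_of_le_of_ne (Nat.le_of_lt_succ (hN₁ x hx)) fun h => m₁ (h ▸ hx)
      by_cases m₂ : N ∈ C₂
      · have hbN := hb_of N m₂
        have h₂' := h₂
        cases h₂ with
        | nil => simp at m₂
        | root => simp at m₂
        | @cons A₂ Y u c _ C₂ g₂ hY he₂ hC₂ hd h0 hp hE =>
          obtain rfl : c = N := by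
            rcases List.mem_cons.1 m₂ with h | h
            · exact h.symm
            · have := hC₂ N h
              have := hN₂ c (by simp)
              omega
          rw [contains_of_head rfl, pushLevels_cons_right le_rfl]
          change HasTriple G r _ (pushLevel c _)
          have hcpos := hY.pos
          have hJ₂ : Joinable G r r' A₁ A₂ :=
            ⟨hJ.disj.mono_right Set.subset_union_left, fun h => hJ.adj (h.mono (by simp)),
              fun x hx y hy => hJ.edge x hx y (Or.inl hy)⟩
          have hdY : Disjoint (A₁ ∪ A₂) Y :=
            Set.disjoint_union_left.2 ⟨hJ.disj.mono_right Set.subset_union_right, hd⟩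
          have hrr' : G.Adj r r' := hJ.adj ⟨u, Or.inr hY.mem⟩
          have hpY : ∃ p ∈ A₁ ∪ A₂, G.Adj u p := by
            rcases A₂.eq_empty_or_nonempty with hA | hA
            · exact ⟨r, Or.inl h₁.mem, h0 hA ▸ hrr'.symm⟩
            · obtain ⟨p, hp, hup⟩ := hp hA
              exact ⟨p, Or.inr hp, hup⟩
          have hEY : ∀ x ∈ A₁ ∪ A₂, ∀ y ∈ Y, G.Adj x y → y = u := by
            rintro x (hx | hx) y hy hxy
            · have hyr := (hJ.edge x hx y (Or.inr hy) hxy).2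
              rcases A₂.eq_empty_or_nonempty with hA | hA
              · rw [hyr, h0 hA]
              · exact absurd (hyr ▸ hy) (Set.disjoint_left.1 hd (g₂.mem hA))
            · exact hE x hx y hy hxy
          have hset : A₁ ∪ (A₂ ∪ Y) = A₁ ∪ A₂ ∪ Y := (Set.union_assoc _ _ _).symm
          have hconn := hJ₂.conn h₁.conn g₂.conn h₁.mem g₂.mem
          have hR := ih h₁ g₂ hJ₂ hC₁lt hC₂
          -- Otherwise `C₁` would be empty and the second part negligible, a case already settled.
          have hec : e ≤ c := by
            by_contra hcon
            refine hs₂ ⟨?_, fun k hk => (hbN k hk).trans (by omega), fun x hx => ?_⟩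
            · refine List.eq_nil_iff_forall_not_mem.2 fun x hx => ?_
              have := he_of x hx
              have := hC₁lt x hx
              omega
            · have := hN₂ x hx
              omega
          have htop : topLevel (_root_.pushLevels c (baseLevel e a b) C₁ C₂) ≤ c := by
            rcases hec.lt_or_eq with hec | rfl
            · have hw₁ : HasBags G A₁ c := by
                have := h₁.hasBags (k := c - 1) (by omega)
                  (fun x hx => Nat.le_sub_one_of_lt (hC₁lt x hx))
                rwa [Nat.sub_add_cancel hcpos] at this
              have hw₂ : HasBags G A₂ c := by
                have := g₂.hasBags (k := c - 1) (fun k hk => Nat.le_sub_one_of_lt (hbN k hk))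
                  (fun x hx => Nat.le_sub_one_of_lt (hC₂ x hx))
                rwa [Nat.sub_add_cancel hcpos] at this
              exact hR.topLevel_le hw₁ hw₂ hJ₂ h₁.mem
            · obtain rfl : C₁ = [] := List.eq_nil_iff_forall_not_mem.2 fun x hx => by
                have := he_of x hx
                have := hC₁lt x hx
                omega
              rw [baseLevel_of_lt hbN, pushLevels_of_lt (by simp) (by simpa [topLevel] using hC₂)]
              exact le_rfl
          rcases htop.lt_or_eq with htop | htop
          · rw [hset]
            exact hR.push hY htop hdY hpY hEY
          · rw [pushLevel_of_eq htop]
            refine h₁.overflow h₂' hJ hec (fun x hx => (hC₁lt x hx).le)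
              (fun k hk => (hbN k hk).le) (fun x hx => Nat.le_of_lt_succ (hN₂ x hx)) ?_
            rw [hset]
            refine hY.overflow hconn hdY hpY ?_
            have := HasLabel.not_hasBags hR
            rwa [show topLevel _ = c from htop] at this
      · have hm₂ : C₂.contains N = false := by simpa using m₂
        rw [hm₂]
        exact ih h₁ h₂ hJ hC₁lt fun x hx =>
          lt_of_le_of_ne (Nat.le_of_lt_succ (hN₂ x hx)) fun h => m₂ (h ▸ hx)

/-- The labels computed by `joinLabel` are correct. -/
theorem HasTriple.joinLabel {N : ℕ} {l₁ l₂ : ℕ × ℕ × List ℕ} (h₁ : HasTriple G r A₁ l₁)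
    (h₂ : HasTriple G r' A₂ l₂) (hd : Disjoint A₁ A₂) (hadj : G.Adj r r')
    (hE : ∀ x ∈ A₁, ∀ y ∈ A₂, G.Adj x y → x = r ∧ y = r') (hN₁ : topLevel l₁ < N)
    (hN₂ : topLevel l₂ < N) : HasTriple G r (A₁ ∪ A₂) (joinLabel N l₁ l₂) := by
  have hJ : Joinable G r r' A₁ A₂ := ⟨hd, fun _ => hadj, hE⟩
  have t₁ := HasLabel.le_topLevel h₁
  have t₂ := HasLabel.le_topLevel h₂
  unfold _root_.joinLabel
  split_ifs with ha
  · refine HasLabel.pushLevels (b := none) h₁ (HasLabel.toBranch_two h₂ ha) hJ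
      (fun c hc => (t₁.2 c hc).trans_lt hN₁) fun c hc => ?_
    rcases List.mem_append.1 hc with hc | hc
    · exact (t₂.2 c hc).trans_lt hN₂
    · rw [List.mem_singleton.1 hc]
      exact t₂.1.trans_lt hN₂
  · exact HasLabel.pushLevels (b := some l₂.1) h₁
      (HasLabel.toBranch h₂ (lt_of_le_of_ne (HasLabel.arms_le h₂) ha)) hJ
      (fun c hc => (t₁.2 c hc).trans_lt hN₁) fun c hc => (t₂.2 c hc).trans_lt hN₂

theorem HasTriple.singleton (G : SimpleGraph V) (r : V) : HasTriple G r {r} (0, 0, []) := by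
  refine .zero rfl (ConnOn.singleton G r) (not_hasBags_zero ⟨r, rfl⟩) ?_
  rw [Set.sdiff_self]
  exact .empty 0

/-- Levels stay below the number of vertices, so that number can serve as the parameter `N` of
`joinLabel`. -/
theorem HasTriple.topLevel_lt [Finite V] {l : ℕ × ℕ × List ℕ} (h : HasTriple G r A l) :
    topLevel l < Nat.card V := by
  by_contra hcon
  refine HasLabel.not_hasBags h (HasBags.mono (k := Nat.card V) ?_ (not_lt.1 hcon))
  have := Fintype.ofFinite V
  refine HasBags.subset ⟨[Finset.univ], ⟨by simp, by simp, by simp, ?_⟩, ?_⟩ (Set.subset_univ A)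
  · exact fun X Y Z hs => by simpa using hs.length_le
  · simp [Nat.card_eq_fintype_card]

theorem HasTriple.hasBags_iff {l : ℕ × ℕ × List ℕ} (h : HasTriple G r A l) (k : ℕ) :
    HasBags G A (k + 1) ↔ topLevel l ≤ k := by
  constructor
  · intro hk
    by_contra hcon
    exact HasLabel.not_hasBags h (hk.mono (not_le.1 hcon))
  · exact fun hk => (HasLabel.hasBags_top h).mono (by simpa [topLevel] using hk)

end Join

/-! ### Functions computable in polynomial time -/

/-- Types whose elements are coded as data. -/
class Coded (α : Type*) where
  code : α → Data

section Codes

open Coded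

variable {α β γ δ : Type*} [Coded α] [Coded β] [Coded γ] [Coded δ]

instance : Coded Unit := ⟨fun _ => .nil⟩

/-- Coding `false` by `nil` makes Boolean programs usable directly as tests of `ite` and `while`. -/
instance : Coded Bool := ⟨fun b => if b then .cons .nil .nil else .nil⟩

instance : Coded ℕ := ⟨Data.ofNat⟩

instance : Coded (α × β) := ⟨fun p => .cons (code p.1) (code p.2)⟩

instance : Coded (List α) := ⟨fun l => Data.ofList (l.map code)⟩

/-- The size of the code. -/
def codeSize (a : α) : ℕ := (code a).size

theorem code_cons (a : α) (l : List α) : code (a :: l) = .cons (code a) (code l) := rfl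

theorem Data.size_pos (d : Data) : 0 < d.size := by
  cases d <;> simp [Data.size]

theorem codeSize_pos (a : α) : 0 < codeSize a := Data.size_pos _

theorem codeSize_pair (a : α) (b : β) : codeSize (a, b) = codeSize a + codeSize b + 1 := rfl

theorem codeSize_nil : codeSize ([] : List α) = 1 := rfl

theorem codeSize_cons (a : α) (l : List α) :
    codeSize (a :: l) = codeSize a + codeSize l + 1 := rfl

theorem codeSize_nat (n : ℕ) : codeSize n = 2 * n + 1 := by
  induction n with
  | zero => rfl
  | succ n ih =>
    have : codeSize (n + 1) = 1 + codeSize n + 1 := rfl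
    omega

theorem codeSize_le_of_mem {a : α} {l : List α} (h : a ∈ l) : codeSize a < codeSize l := by
  induction l with
  | nil => simp at h
  | cons b l ih =>
    rw [codeSize_cons]
    rcases List.mem_cons.1 h with rfl | h
    · omega
    · have := ih h
      omega

theorem length_lt_codeSize (l : List α) : l.length < codeSize l := by
  induction l with
  | nil => simp [codeSize_nil]
  | cons b l ih =>
    rw [codeSize_cons, List.length_cons]
    omega

theorem codeSize_list_le {l : List α} {k B : ℕ} (hk : l.length ≤ k) (h : ∀ x ∈ l, codeSize x ≤ B) :
    codeSize l ≤ k * (B + 1) + 1 := by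
  induction l generalizing k with
  | nil => simp [codeSize_nil]
  | cons b l ih =>
    rw [List.length_cons] at hk
    obtain ⟨k, rfl⟩ : ∃ k', k = k' + 1 := ⟨k - 1, by omega⟩
    have h1 := ih (k := k) (by omega) fun x hx => h x (by simp [hx])
    have h2 := h b (by simp)
    rw [codeSize_cons, Nat.succ_mul]
    omega

/-! #### Polynomial bounds -/

theorem Polynomial.eval_mono_nat (q : Polynomial ℕ) {x y : ℕ} (h : x ≤ y) :
    q.eval x ≤ q.eval y := by
  rw [Polynomial.eval_eq_sum, Polynomial.eval_eq_sum]
  exact Finset.sum_le_sum fun i _ => Nat.mul_le_mul_left _ (Nat.pow_le_pow_left h i)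

/-- `g` is bounded by a polynomial in the size of the code. -/
def PolyBounded (g : α → ℕ) : Prop := ∃ q : Polynomial ℕ, ∀ a, g a ≤ q.eval (codeSize a)

theorem PolyBounded.mono {g h : α → ℕ} (hg : PolyBounded g) (hle : ∀ a, h a ≤ g a) :
    PolyBounded h := by
  obtain ⟨q, hq⟩ := hg
  exact ⟨q, fun a => (hle a).trans (hq a)⟩

theorem PolyBounded.const (k : ℕ) : PolyBounded fun _ : α => k :=
  ⟨Polynomial.C k, fun a => by simp⟩

theorem PolyBounded.size : PolyBounded fun a : α => codeSize a :=
  ⟨Polynomial.X, fun a => by simp⟩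

theorem PolyBounded.add {g h : α → ℕ} (hg : PolyBounded g) (hh : PolyBounded h) :
    PolyBounded fun a => g a + h a := by
  obtain ⟨p, hp⟩ := hg
  obtain ⟨q, hq⟩ := hh
  exact ⟨p + q, fun a => by rw [Polynomial.eval_add]; exact Nat.add_le_add (hp a) (hq a)⟩

theorem PolyBounded.mul {g h : α → ℕ} (hg : PolyBounded g) (hh : PolyBounded h) :
    PolyBounded fun a => g a * h a := by
  obtain ⟨p, hp⟩ := hg
  obtain ⟨q, hq⟩ := hh
  exact ⟨p * q, fun a => by rw [Polynomial.eval_mul]; exact Nat.mul_le_mul (hp a) (hq a)⟩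

theorem PolyBounded.eval {g : α → ℕ} (hg : PolyBounded g) (q : Polynomial ℕ) :
    PolyBounded fun a => q.eval (g a) := by
  obtain ⟨p, hp⟩ := hg
  exact ⟨q.comp p, fun a => by
    rw [Polynomial.eval_comp]
    exact Polynomial.eval_mono_nat q (hp a)⟩

/-! #### Polynomial time -/

/-- No result outgrows the time spent on it, since every elementary operation charges at least the
size of what it returns. Hence polynomial time bounds compose. -/
theorem Runs.size_le {c : Prog} {x y : Data} {t : ℕ} (h : Runs c x y t) : y.size ≤ t := by
  induction h <;> try simp only [Data.size] at *
  all_goals omega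

/-- `f` is computed by a program in polynomial time. -/
@[fun_prop]
def PolyTime (f : α → β) : Prop :=
  ∃ (c : Prog) (g : α → ℕ), PolyBounded g ∧ ∀ a, ∃ t, Runs c (code a) (code (f a)) t ∧ t ≤ g a

theorem PolyTime.bounded {f : α → β} (hf : PolyTime f) : PolyBounded fun a => codeSize (f a) := by
  obtain ⟨c, g, hg, h⟩ := hf
  refine hg.mono fun a => ?_
  obtain ⟨t, h1, h2⟩ := h a
  exact h1.size_le.trans h2

theorem PolyBounded.comp {g : β → ℕ} (hg : PolyBounded g) {f : α → β} (hf : PolyTime f) :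
    PolyBounded fun a => g (f a) := by
  obtain ⟨q, hq⟩ := hg
  exact (hf.bounded.eval q).mono fun a => hq (f a)

@[fun_prop]
theorem PolyTime.id : PolyTime fun a : α => a :=
  ⟨.skip, _, .size, fun _ => ⟨_, .skip _, le_rfl⟩⟩

@[fun_prop]
theorem PolyTime.comp {f : β → γ} {g : α → β} (hf : PolyTime f) (hg : PolyTime g) :
    PolyTime fun a => f (g a) := by
  have hg' := hg
  obtain ⟨c, k, hk, h⟩ := hf
  obtain ⟨d, l, hl, h'⟩ := hg
  refine ⟨.seq d c, _, (hl.add (hk.comp hg')).add (.const 1), fun a => ?_⟩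
  obtain ⟨t, h1, h2⟩ := h' a
  obtain ⟨s, h3, h4⟩ := h (g a)
  exact ⟨_, .seq h1 h3, by omega⟩

@[fun_prop]
theorem PolyTime.pair {f : α → β} {g : α → γ} (hf : PolyTime f) (hg : PolyTime g) :
    PolyTime fun a => (f a, g a) := by
  obtain ⟨c, k, hk, h⟩ := hf
  obtain ⟨d, l, hl, h'⟩ := hg
  refine ⟨.pair c d, _, (hk.add hl).add (.const 1), fun a => ?_⟩
  obtain ⟨t, h1, h2⟩ := h a
  obtain ⟨s, h3, h4⟩ := h' a
  exact ⟨_, .pair h1 h3, by omega⟩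

@[fun_prop]
theorem PolyTime.fst' : PolyTime fun p : α × β => p.1 :=
  ⟨.fst, _, .size, fun _ => ⟨_, .fst_cons _ _, le_rfl⟩⟩

@[fun_prop]
theorem PolyTime.snd' : PolyTime fun p : α × β => p.2 :=
  ⟨.snd, _, .size, fun _ => ⟨_, .snd_cons _ _, le_rfl⟩⟩

theorem exists_prog_const (d : Data) : ∃ c t, ∀ x, Runs c x d t := by
  induction d with
  | nil => exact ⟨.nil, 1, fun x => .nil x⟩
  | cons a b iha ihb =>
    obtain ⟨c, t, h⟩ := iha
    obtain ⟨c', t', h'⟩ := ihb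
    exact ⟨.pair c c', _, fun x => .pair (h x) (h' x)⟩

@[fun_prop]
theorem PolyTime.const (b : β) : PolyTime fun _ : α => b := by
  obtain ⟨c, t, h⟩ := exists_prog_const (code b)
  exact ⟨c, _, .const t, fun a => ⟨t, h _, le_rfl⟩⟩

/-- Functions that act in the same way on codes. -/
theorem PolyTime.of_code {f : α → β} (hf : PolyTime f) {α' β' : Type*} [Coded α'] [Coded β']
    {f' : α' → β'} (φ : α' → α) (hφ : ∀ a, code a = code (φ a))
    (h : ∀ a, code (f' a) = code (f (φ a))) : PolyTime f' := by
  obtain ⟨c, g, ⟨q, hq⟩, h'⟩ := hf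
  refine ⟨c, fun a => g (φ a), ⟨q, fun a => ?_⟩, fun a => ?_⟩
  · have := hq (φ a)
    rwa [codeSize, ← hφ] at this
  · rw [hφ, h]
    exact h' (φ a)

theorem code_true_ne : code true ≠ .nil := by simp [code]

@[fun_prop]
theorem PolyTime.cond {b : α → Bool} {f g : α → β} (hb : PolyTime b) (hf : PolyTime f)
    (hg : PolyTime g) : PolyTime fun a => bif b a then f a else g a := by
  obtain ⟨p, i, hi, h⟩ := hb
  obtain ⟨c, k, hk, h'⟩ := hf
  obtain ⟨d, l, hl, h''⟩ := hg
  refine ⟨.ite p c d, _, ((hi.add hk).add hl).add (.const 1), fun a => ?_⟩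
  obtain ⟨t, h1, h2⟩ := h a
  obtain ⟨s, h3, h4⟩ := h' a
  obtain ⟨u, h5, h6⟩ := h'' a
  cases hba : b a with
  | true =>
    rw [hba] at h1
    simp only [hba, cond_true]
    exact ⟨_, .ite_true h1 code_true_ne h3, by omega⟩
  | false =>
    rw [hba] at h1
    simp only [hba, cond_false]
    exact ⟨_, .ite_false h1 h5, by omega⟩

@[fun_prop]
theorem PolyTime.and {b c : α → Bool} (hb : PolyTime b) (hc : PolyTime c) :
    PolyTime fun a => b a && c a := by
  refine (hb.cond hc (.const false)).of_code _root_.id (fun _ => rfl) fun a => ?_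
  cases h : b a <;> simp [h]

@[fun_prop]
theorem PolyTime.or {b c : α → Bool} (hb : PolyTime b) (hc : PolyTime c) :
    PolyTime fun a => b a || c a := by
  refine (hb.cond (.const true) hc).of_code _root_.id (fun _ => rfl) fun a => ?_
  cases h : b a <;> simp [h]

@[fun_prop]
theorem PolyTime.not {b : α → Bool} (hb : PolyTime b) : PolyTime fun a => !b a := by
  refine (hb.cond (.const false) (.const true)).of_code _root_.id (fun _ => rfl) fun a => ?_
  cases h : b a <;> simp [h]

@[fun_prop]
theorem PolyTime.cons {f : α → β} {g : α → List β} (hf : PolyTime f) (hg : PolyTime g) :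
    PolyTime fun a => f a :: g a :=
  (hf.pair hg).of_code _root_.id (fun _ => rfl) fun _ => rfl

@[fun_prop]
theorem PolyTime.tail' : PolyTime fun l : List α => l.tail := by
  refine ⟨.snd, _, .size, fun l => ?_⟩
  cases l with
  | nil => exact ⟨_, .snd_nil, le_rfl⟩
  | cons a l => exact ⟨_, .snd_cons _ _, le_rfl⟩

@[fun_prop]
theorem PolyTime.tail {f : α → List β} (hf : PolyTime f) : PolyTime fun a => (f a).tail :=
  PolyTime.tail'.comp hf

theorem PolyTime.isEmpty' : PolyTime fun l : List α => l.isEmpty := by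
  obtain ⟨c, t, h⟩ := exists_prog_const (code true)
  refine ⟨.ite .skip .nil c, _, (PolyBounded.size.add (.const (t + 1))).add (.const 1),
    fun l => ?_⟩
  cases l with
  | nil => exact ⟨_, .ite_false (.skip _) (h _), by simp [codeSize, code]⟩
  | cons a l => exact ⟨_, .ite_true (.skip _) (by simp [code, Data.ofList]) (.nil _), by simp [codeSize]⟩

@[fun_prop]
theorem PolyTime.isEmpty {f : α → List β} (hf : PolyTime f) : PolyTime fun a => (f a).isEmpty :=
  PolyTime.isEmpty'.comp hf

@[fun_prop]
theorem PolyTime.headD {f : α → List β} {d : α → β} (hf : PolyTime f) (hd : PolyTime d) :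
    PolyTime fun a => (f a).headD (d a) := by
  obtain ⟨c, g, hg, h⟩ := hf
  obtain ⟨c', g', hg', h'⟩ := hd
  refine ⟨.ite c (.seq c .fst) c', _,
    (((hg.add hg).add hg).add hg').add (.const 2), fun a => ?_⟩
  obtain ⟨t, h1, h2⟩ := h a
  obtain ⟨s, h3, h4⟩ := h' a
  cases hfa : f a with
  | nil =>
    rw [hfa] at h1
    simp only [hfa, List.headD_nil]
    exact ⟨_, .ite_false h1 h3, by omega⟩
  | cons b l =>
    have hsize := h1.size_le
    rw [hfa] at h1 hsize
    simp only [hfa, List.headD_cons]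
    refine ⟨_, .ite_true h1 (by simp [code, Data.ofList]) (.seq h1 (.fst_cons _ _)), ?_⟩
    change (Data.cons (code b) (Data.ofList (l.map code))).size ≤ t at hsize
    omega

/-! #### Loops -/

/-- The loop that folds a function over a list; the state consists of the remaining list, the
context `a`, and the accumulator. -/
theorem runs_foldl {S : Prog} {step : γ → β → γ} {a : α} {K G N : ℕ} (I : ℕ → γ → Prop)
    (l : List β)
    (hI : ∀ i c, ∀ b ∈ l, i < N → I i c → I (i + 1) (step c b))
    (hS : ∀ i c, ∀ b ∈ l, i < N → I i c →
      ∃ t, Runs S (code (a, c, b)) (code (step c b)) t ∧ t ≤ G)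
    (hK : ∀ i c, i ≤ N → I i c → codeSize c ≤ K) (i : ℕ) (c : γ) (hi : i + l.length ≤ N)
    (h : I i c) :
    ∃ t, Runs (.while .fst (.pair (.seq .fst .snd) (.pair (.seq .snd .fst)
        (.seq (.pair (.seq .snd .fst) (.pair (.seq .snd .snd) (.seq .fst .fst))) S))))
      (code (l, a, c)) (code (([] : List β), a, l.foldl step c)) t ∧
      t ≤ (l.length + 1) * (20 * (codeSize l + codeSize a + K) + G + 40) := by
  induction l generalizing c i with
  | nil =>
    have hc := hK i c (by simpa using hi) h
    refine ⟨_, .while_done (.fst_cons _ _), ?_⟩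
    change codeSize (([] : List β), a, c) + codeSize (([] : List β), a, c) + 1 ≤ _
    rw [codeSize_pair, codeSize_pair, codeSize_nil]
    simp only [List.length_nil]
    omega
  | cons b l ih =>
    rw [List.length_cons] at hi
    have hiN : i < N := by omega
    have hc := hK i c (by omega) h
    obtain ⟨s, h1, h2⟩ := hS i c b (by simp) hiN h
    obtain ⟨t, h3, h4⟩ := ih (fun i c b hb => hI i c b (by simp [hb]))
      (fun i c b hb => hS i c b (by simp [hb])) (i + 1) (step c b) (by omega)
      (hI i c b (by simp) hiN h)
    have hne : code (b :: l) ≠ .nil := by simp [code, Data.ofList]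
    have hA : Runs (.seq .snd .fst) (code (b :: l, a, c)) (code a) _ :=
      .seq (.snd_cons _ _) (.fst_cons _ _)
    have hC : Runs (.seq .snd .snd) (code (b :: l, a, c)) (code c) _ :=
      .seq (.snd_cons _ _) (.snd_cons _ _)
    have hL : Runs (.seq .fst .snd) (code (b :: l, a, c)) (code l) _ :=
      .seq (.fst_cons _ _) (.snd_cons _ _)
    have hB : Runs (.seq .fst .fst) (code (b :: l, a, c)) (code b) _ :=
      .seq (.fst_cons _ _) (.fst_cons _ _)
    -- One pass turns the state `(b :: l, a, c)` into `(l, a, step c b)`.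
    refine ⟨_, .while_step (.fst_cons _ _) hne
      (.pair hL (.pair hA (.seq (.pair hA (.pair hC hB)) h1))) h3, ?_⟩
    have e1 : (Data.cons (code (b :: l)) (code (a, c))).size
        = codeSize b + codeSize l + 1 + (codeSize a + codeSize c + 1) + 1 := rfl
    have e2 : (Data.cons (code a) (code c)).size = codeSize a + codeSize c + 1 := rfl
    have e3 : (Data.cons (code b) (code l)).size = codeSize b + codeSize l + 1 := rfl
    have e4 : (Data.cons (code b) (Data.ofList (l.map code))).size
      = codeSize b + codeSize l + 1 := rfl
    have e5 : (code (b :: l)).size = codeSize b + codeSize l + 1 := rfl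
    have e6 : (code (a, c)).size = codeSize a + codeSize c + 1 := rfl
    -- The bound per pass is stated for the longer list, so that the costs of all passes simply add
    -- up.
    have h5 : t ≤ (l.length + 1) * (20 * (codeSize (b :: l) + codeSize a + K) + G + 40) :=
      h4.trans (Nat.mul_le_mul_left _ (by rw [codeSize_cons]; omega))
    rw [List.length_cons, Nat.succ_mul (l.length + 1)]
    rw [codeSize_cons] at h5 ⊢
    simp only [Data.size] at *
    omega

/-- Folding over a list takes polynomial time if the accumulators stay polynomially bounded. -/
theorem PolyTime.foldl {l : α → List β} {init : α → γ} {step : α → γ → β → γ}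
    (hl : PolyTime l) (hinit : PolyTime init)
    (hstep : PolyTime fun x : α × γ × β => step x.1 x.2.1 x.2.2)
    (I : α → ℕ → γ → Prop) (h0 : ∀ a, I a 0 (init a))
    (hI : ∀ a i c, ∀ b ∈ l a, i < (l a).length → I a i c → I a (i + 1) (step a c b))
    {K : α → ℕ} (hK : PolyBounded K)
    (hIK : ∀ a i c, i ≤ (l a).length → I a i c → codeSize c ≤ K a) :
    PolyTime fun a => (l a).foldl (step a) (init a) := by
  have hl' := hl.bounded
  obtain ⟨cl, gl, hgl, hl⟩ := hl
  obtain ⟨ci, gi, hgi, hi⟩ := hinit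
  obtain ⟨S, gs, ⟨q, hq⟩, hs⟩ := hstep
  have hG := (((PolyBounded.size.add hK).add hl').add (.const 2)).eval q
  have hW := (hl'.add (.const 1)).mul
    (((((PolyBounded.const 20).mul ((hl'.add .size).add hK)).add hG)).add (.const 40))
  refine ⟨.seq (.pair cl (.pair .skip ci)) (.seq (.while .fst (.pair (.seq .fst .snd)
      (.pair (.seq .snd .fst) (.seq (.pair (.seq .snd .fst) (.pair (.seq .snd .snd)
      (.seq .fst .fst))) S)))) (.seq .snd .snd)), _,
    (((hgl.add hgi).add hW).add (((PolyBounded.const 3).mul PolyBounded.size).add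
      ((PolyBounded.const 2).mul hK))).add (.const 20), fun a => ?_⟩
  obtain ⟨t1, h1, h1'⟩ := hl a
  obtain ⟨t2, h2, h2'⟩ := hi a
  -- The invariant also holds for the final accumulator, whose size enters the cost of the
  -- concluding projections.
  have hin : ∀ (l' : List β) (i : ℕ) (c : γ), (∀ b ∈ l', b ∈ l a) →
      i + l'.length ≤ (l a).length → I a i c → I a (i + l'.length) (l'.foldl (step a) c) := by
    intro l'
    induction l' with
    | nil => exact fun i c _ _ h => h
    | cons b l' ih =>
      intro i c hmem hi h
      rw [List.length_cons] at hi ⊢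
      have := ih (i + 1) (step a c b) (fun x hx => hmem x (by simp [hx])) (by omega)
        (hI a i c b (hmem b (by simp)) (by omega) h)
      rwa [show i + 1 + l'.length = i + (l'.length + 1) by omega] at this
  have hend := hIK a _ _ (by omega) (hin (l a) 0 (init a) (fun _ h => h) (by omega) (h0 a))
  obtain ⟨t3, h3, h3'⟩ := runs_foldl (S := S) (step := step a) (a := a) (K := K a)
    (G := q.eval (codeSize a + K a + codeSize (l a) + 2)) (N := (l a).length) (I a) (l a)
    (hI a) (fun i c b hb hi h => by
      obtain ⟨t, h4, h5⟩ := hs (a, c, b)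
      refine ⟨t, h4, h5.trans ((hq _).trans (Polynomial.eval_mono_nat q ?_))⟩
      have h6 := hIK a i c (by omega) h
      have h7 := codeSize_le_of_mem hb
      rw [codeSize_pair, codeSize_pair]
      omega) (hIK a) 0 (init a) (by omega) (h0 a)
  refine ⟨_, .seq (.pair h1 (.pair (.skip _) h2)) (.seq h3 (.seq (.snd_cons _ _) (.snd_cons _ _))),
    ?_⟩
  have h8 : (l a).length + 1 ≤ codeSize (l a) + 1 := by
    have := length_lt_codeSize (l a)
    omega
  have h9 := h3'.trans (Nat.mul_le_mul_right _ h8)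
  have e1 : (code a).size = codeSize a := rfl
  have e2 (x : List β) (y : α × γ) :
      (Data.cons (code x) (code y)).size = codeSize x + codeSize y + 1 := rfl
  have e3 (x : α) (y : γ) :
      (Data.cons (code x) (code y)).size = codeSize x + codeSize y + 1 := rfl
  rw [e1, e2, e3, codeSize_pair, codeSize_nil]
  dsimp only
  omega

end Codes

/-! ### Lists and unary numbers in polynomial time. -/

section ListFunctions

open Coded

variable {α β γ δ : Type*} [Coded α] [Coded β] [Coded γ] [Coded δ]

/-- Folding a function that enlarges the accumulator by a polynomially bounded amount. -/
theorem PolyTime.foldl_of_growth {l : α → List β} {init : α → γ} {step : α → γ → β → γ}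
    (hl : PolyTime l) (hinit : PolyTime init)
    (hstep : PolyTime fun x : α × γ × β => step x.1 x.2.1 x.2.2) {G : α → ℕ} (hG : PolyBounded G)
    (h : ∀ a c, ∀ b ∈ l a, codeSize (step a c b) ≤ codeSize c + G a) :
    PolyTime fun a => (l a).foldl (step a) (init a) := by
  refine hl.foldl hinit hstep (fun a i c => codeSize c ≤ codeSize (init a) + i * G a)
    (fun a => by omega) (fun a i c b hb _ hc => ?_)
    (hinit.bounded.add (hl.bounded.mul hG)) fun a i c hi hc => hc.trans ?_
  · have := h a c b hb
    rw [Nat.succ_mul]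
    omega
  · have h1 := length_lt_codeSize (l a)
    exact Nat.add_le_add_left (Nat.mul_le_mul_right _ (by omega)) _

@[fun_prop]
theorem PolyTime.reverse {l : α → List β} (hl : PolyTime l) : PolyTime fun a => (l a).reverse := by
  have := hl.foldl_of_growth (init := fun _ => ([] : List β)) (step := fun _ c b => b :: c)
    (.const _) (by fun_prop) (G := fun a => codeSize (l a)) hl.bounded (fun a c b hb => by
      have := codeSize_le_of_mem hb
      rw [codeSize_cons]
      omega)
  simpa using this

@[fun_prop]
theorem PolyTime.append {l l' : α → List β} (hl : PolyTime l) (hl' : PolyTime l') :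
    PolyTime fun a => l a ++ l' a := by
  have := hl.reverse.foldl_of_growth (init := l') (step := fun _ c b => b :: c)
    hl' (by fun_prop) (G := fun a => codeSize (l a)) hl.bounded (fun a c b hb => by
      have := codeSize_le_of_mem (List.mem_reverse.1 hb)
      rw [codeSize_cons]
      omega)
  simpa using this

@[fun_prop]
theorem PolyTime.map {l : α → List β} {f : α → β → γ} (hl : PolyTime l)
    (hf : PolyTime fun x : α × β => f x.1 x.2) : PolyTime fun a => (l a).map (f a) := by
  obtain ⟨q, hq⟩ := hf.bounded
  have := hl.reverse.foldl_of_growth (init := fun _ => ([] : List γ))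
    (step := fun a c b => f a b :: c) (.const _)
    (.cons (hf.comp (f := fun x : α × β => f x.1 x.2) (g := fun x : α × List γ × β => (x.1, x.2.2))
      (by fun_prop)) (by fun_prop))
    (((PolyBounded.size.add hl.bounded).eval q).add (.const 1)) (fun a c b hb => by
      have h1 := codeSize_le_of_mem (List.mem_reverse.1 hb)
      have h2 := (hq (a, b)).trans (Polynomial.eval_mono_nat q
        (show codeSize (a, b) ≤ codeSize a + codeSize (l a) by rw [codeSize_pair]; omega))
      rw [codeSize_cons]
      dsimp only at h2
      omega)
  have e : ∀ a, (l a).reverse.foldl (fun c b => f a b :: c) [] = (l a).map (f a) := fun a => by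
    rw [List.foldl_reverse]
    induction l a with
    | nil => rfl
    | cons b l ih => simp [ih]
  simpa only [e] using this

@[fun_prop]
theorem PolyTime.filter {l : α → List β} {p : α → β → Bool} (hl : PolyTime l)
    (hp : PolyTime fun x : α × β => p x.1 x.2) : PolyTime fun a => (l a).filter (p a) := by
  have hp' : PolyTime fun x : α × List β × β => p x.1 x.2.2 :=
    hp.comp (f := fun x : α × β => p x.1 x.2) (g := fun x : α × List β × β => (x.1, x.2.2))
      (by fun_prop)
  have := hl.reverse.foldl_of_growth (init := fun _ => ([] : List β))
    (step := fun a c b => bif p a b then b :: c else c) (.const _) (by fun_prop) hl.bounded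
    (fun a c b hb => by
      have h1 := codeSize_le_of_mem (List.mem_reverse.1 hb)
      cases p a b
      · simp
      · rw [cond_true, codeSize_cons]
        omega)
  have e : ∀ a, (l a).reverse.foldl (fun c b => bif p a b then b :: c else c) []
      = (l a).filter (p a) := fun a => by
    rw [List.foldl_reverse]
    induction l a with
    | nil => rfl
    | cons b l ih => cases h : p a b <;> simp [ih, h]
  simpa only [e] using this

@[fun_prop]
theorem PolyTime.any {l : α → List β} {p : α → β → Bool} (hl : PolyTime l)
    (hp : PolyTime fun x : α × β => p x.1 x.2) : PolyTime fun a => (l a).any (p a) := by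
  have := ((hl.filter hp).isEmpty).not
  have e : ∀ a, (l a).any (p a) = !((l a).filter (p a)).isEmpty := fun a => by
    rw [Bool.eq_iff_iff]
    simp
  simpa only [e] using this

@[fun_prop]
theorem PolyTime.all {l : α → List β} {p : α → β → Bool} (hl : PolyTime l)
    (hp : PolyTime fun x : α × β => p x.1 x.2) : PolyTime fun a => (l a).all (p a) := by
  have := (hl.any (p := fun a b => !p a b) hp.not).not
  have e : ∀ a, (l a).all (p a) = !(l a).any fun b => !p a b := fun a => by
    rw [Bool.eq_iff_iff]
    simp
  simpa only [e] using this

/-! #### Natural numbers -/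

theorem code_nat (n : ℕ) : code n = code (List.replicate n ()) := by
  induction n with
  | zero => rfl
  | succ n ih =>
    rw [List.replicate_succ, code_cons, ← ih]
    rfl

/-- Natural numbers are coded like lists of units. -/
theorem PolyTime.replicate {f : α → ℕ} (hf : PolyTime f) :
    PolyTime fun a => List.replicate (f a) () :=
  hf.of_code _root_.id (fun _ => rfl) fun _ => (code_nat _).symm

@[fun_prop]
theorem PolyTime.length {f : α → List β} (hf : PolyTime f) : PolyTime fun a => (f a).length :=
  (hf.map (f := fun _ _ => ()) (.const ())).of_code _root_.id (fun _ => rfl) fun a => by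
    rw [code_nat]
    simp [List.map_const']

@[fun_prop]
theorem PolyTime.sub {f g : α → ℕ} (hf : PolyTime f) (hg : PolyTime g) :
    PolyTime fun a => f a - g a := by
  -- Truncated subtraction drops one unit per round; `tail` of the empty list is empty.
  have := hg.replicate.foldl_of_growth (step := fun _ c _ => c.tail) hf.replicate (by fun_prop)
    (.const 0) (fun a c b _ => by
      cases c with
      | nil => simp
      | cons _ _ => rw [List.tail_cons, codeSize_cons]; omega)
  refine this.of_code _root_.id (fun _ => rfl) fun a => ?_
  rw [code_nat, _root_.id]
  congr 1
  induction g a with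
  | zero => rfl
  | succ n ih =>
    rw [List.replicate_succ', List.foldl_append, ← ih, Nat.sub_succ]
    simp

@[fun_prop]
theorem PolyTime.succ {f : α → ℕ} (hf : PolyTime f) : PolyTime fun a => f a + 1 :=
  ((PolyTime.const ()).cons hf.replicate).of_code _root_.id (fun _ => rfl) fun _ => code_nat _

@[fun_prop]
theorem PolyTime.ble {f g : α → ℕ} (hf : PolyTime f) (hg : PolyTime g) :
    PolyTime fun a => (f a).ble (g a) :=
  (hf.sub hg).replicate.isEmpty.of_code _root_.id (fun _ => rfl) fun a => by
    congr 1
    rw [Bool.eq_iff_iff]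
    simp [Nat.sub_eq_zero_iff_le]

@[fun_prop]
theorem PolyTime.beq {f g : α → ℕ} (hf : PolyTime f) (hg : PolyTime g) :
    PolyTime fun a => f a == g a :=
  ((hf.ble hg).and (hg.ble hf)).of_code _root_.id (fun _ => rfl) fun a => by
    congr 1
    rw [Bool.eq_iff_iff]
    simp [Nat.le_antisymm_iff]

@[fun_prop]
theorem PolyTime.contains {l : α → List ℕ} {f : α → ℕ} (hl : PolyTime l) (hf : PolyTime f) :
    PolyTime fun a => (l a).contains (f a) := by
  have : PolyTime fun a => (l a).any fun b => f a == b := by fun_prop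
  simpa only [List.contains_eq_any_beq] using this

theorem codeSize_range_le (n i : ℕ) (h : i ≤ n) : codeSize (List.range i) ≤ n * (2 * n + 2) + 1 :=
  codeSize_list_le (by simpa using h) fun x hx => by
    rw [codeSize_nat]
    have := List.mem_range.1 hx
    omega

@[fun_prop]
theorem PolyTime.range {f : α → ℕ} (hf : PolyTime f) : PolyTime fun a => List.range (f a) := by
  -- Each round rewrites the whole list by shifting it, so the bound on growth per round is replaced
  -- by the exact invariant `c = List.range i`.
  have := hf.replicate.foldl (init := fun _ => ([] : List ℕ))
    (step := fun _ c _ => 0 :: c.map fun k => k + 1) (.const _) (by fun_prop)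
    (fun _ i c => c = List.range i) (fun _ => rfl)
    (fun a i c b _ _ hc => by rw [hc, List.range_succ_eq_map])
    (K := fun a => codeSize (f a) * (2 * codeSize (f a) + 2) + 1)
    ((hf.bounded.mul (((PolyBounded.const 2).mul hf.bounded).add (.const 2))).add (.const 1))
    (fun a i c hi hc => by
      rw [hc]
      rw [List.length_replicate] at hi
      exact codeSize_range_le _ _ (by rw [codeSize_nat]; omega))
  refine this.of_code _root_.id (fun _ => rfl) fun a => ?_
  congr 1
  rw [_root_.id]
  induction f a with
  | zero => rfl
  | succ n ih =>
    rw [List.replicate_succ', List.foldl_append, ← ih, List.range_succ_eq_map]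
    rfl

end ListFunctions

/-! ### The label computations in polynomial time. -/

section LabelsInPolyTime

open Coded

variable {α β γ δ : Type*} [Coded α] [Coded β] [Coded γ] [Coded δ]

@[fun_prop]
theorem PolyTime.ite_lt {f g : α → ℕ} {u v : α → β} (hf : PolyTime f) (hg : PolyTime g)
    (hu : PolyTime u) (hv : PolyTime v) : PolyTime fun a => if f a < g a then u a else v a := by
  have := (hf.succ.ble hg).cond hu hv
  refine this.of_code _root_.id (fun _ => rfl) fun a => ?_
  by_cases h : f a < g a
  · have : (f a + 1).ble (g a) = true := by
      rw [Nat.ble_eq]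
      omega
    simp [h, this]
  · have : (f a + 1).ble (g a) = false := by
      rw [← Bool.not_eq_true, Nat.ble_eq]
      omega
    simp [h, this]

@[fun_prop]
theorem PolyTime.ite_eq {f g : α → ℕ} {u v : α → β} (hf : PolyTime f) (hg : PolyTime g)
    (hu : PolyTime u) (hv : PolyTime v) : PolyTime fun a => if f a = g a then u a else v a := by
  have := (hf.beq hg).cond hu hv
  refine this.of_code _root_.id (fun _ => rfl) fun a => ?_
  by_cases h : f a = g a
  · simp [h]
  · simp [h, beq_false_of_ne h]

@[fun_prop]
theorem PolyTime.topLevel {l : α → ℕ × ℕ × List ℕ} (hl : PolyTime l) :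
    PolyTime fun a => topLevel (l a) := by
  unfold _root_.topLevel
  fun_prop

@[fun_prop]
theorem PolyTime.pushIf {b : α → Bool} {c : α → ℕ} {l : α → ℕ × ℕ × List ℕ} (hb : PolyTime b)
    (hc : PolyTime c) (hl : PolyTime l) : PolyTime fun a => pushIf (b a) (c a) (l a) := by
  have : PolyTime fun a => bif b a then pushLevel (c a) (l a) else l a := by
    unfold _root_.pushLevel
    fun_prop
  refine this.of_code _root_.id (fun _ => rfl) fun a => ?_
  simp only [_root_.pushIf, _root_.id]
  cases b a <;> rfl

@[fun_prop]
theorem PolyTime.absorbLevel {e b k : α → ℕ} (he : PolyTime e) (hb : PolyTime b)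
    (hk : PolyTime k) : PolyTime fun a => absorbLevel (e a) (b a) (k a) := by
  unfold _root_.absorbLevel
  fun_prop

/-- A bound on labels. -/
def LevelBound (E B K : ℕ) (l : ℕ × ℕ × List ℕ) : Prop :=
  l.1 ≤ E ∧ l.2.1 ≤ B ∧ codeSize l.2.2 ≤ K

theorem LevelBound.codeSize_le {E B K : ℕ} {l : ℕ × ℕ × List ℕ} (h : LevelBound E B K l) :
    codeSize l ≤ 2 * E + 2 * B + K + 4 := by
  obtain ⟨e, b, C⟩ := l
  obtain ⟨h1, h2, h3⟩ := h
  rw [codeSize_pair, codeSize_pair, codeSize_nat, codeSize_nat]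
  dsimp only at *
  omega

theorem LevelBound.mono {E B K E' B' K' : ℕ} {l : ℕ × ℕ × List ℕ} (h : LevelBound E B K l)
    (hE : E ≤ E') (hB : B ≤ B') (hK : K ≤ K') : LevelBound E' B' K' l :=
  ⟨h.1.trans hE, h.2.1.trans hB, h.2.2.trans hK⟩

theorem LevelBound.pushIf {E B K N c : ℕ} {l : ℕ × ℕ × List ℕ} (h : LevelBound E B K l)
    (hc : c < N) (hN : N ≤ E) (b : Bool) : LevelBound E B (K + (2 * N + 2)) (pushIf b c l) := by
  have h' := h
  obtain ⟨h1, h2, h3⟩ := h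
  unfold _root_.pushIf pushLevel
  split_ifs
  · refine ⟨h1, h2, ?_⟩
    rw [codeSize_cons, codeSize_nat]
    omega
  · refine ⟨by dsimp only; omega, Nat.zero_le _, ?_⟩
    rw [codeSize_nil]
    omega
  · exact h'.mono le_rfl le_rfl (by omega)
  · exact h'.mono le_rfl le_rfl (by omega)

theorem LevelBound.pushLevels {E B K N : ℕ} {l : ℕ × ℕ × List ℕ} (h : LevelBound E B K l)
    (hN : N ≤ E) (C₁ C₂ : List ℕ) (i : ℕ) (hi : i ≤ N) :
    LevelBound E B (K + i * (4 * N + 4)) (pushLevels i l C₁ C₂) := by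
  induction i with
  | zero => simpa [_root_.pushLevels] using h
  | succ i ih =>
    rw [pushLevels_succ]
    refine (((ih (by omega)).pushIf (N := N) (by omega) hN _).pushIf (N := N) (by omega) hN
      _).mono le_rfl le_rfl ?_
    rw [Nat.succ_mul i]
    omega

@[fun_prop]
theorem PolyTime.pushLevels {N : α → ℕ} {l : α → ℕ × ℕ × List ℕ} {C₁ C₂ : α → List ℕ}
    (hN : PolyTime N) (hl : PolyTime l) (h₁ : PolyTime C₁) (h₂ : PolyTime C₂) :
    PolyTime fun a => pushLevels (N a) (l a) (C₁ a) (C₂ a) := by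
  have hstep : PolyTime fun x : α × (ℕ × ℕ × List ℕ) × ℕ =>
      _root_.pushIf ((C₂ x.1).contains x.2.2) x.2.2
        (_root_.pushIf ((C₁ x.1).contains x.2.2) x.2.2 x.2.1) := by
    fun_prop
  refine PolyTime.foldl (l := fun a => List.range (N a)) (init := l)
    (step := fun a l k => _root_.pushIf ((C₂ a).contains k) k
      (_root_.pushIf ((C₁ a).contains k) k l)) (by fun_prop) hl hstep
    (fun a i c => LevelBound (codeSize (l a) + N a) (codeSize (l a))
      (codeSize (l a) + i * (4 * N a + 4)) c)
    (fun a => ?_) (fun a i c b hb _ hc => ?_)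
    (K := fun a => 2 * (codeSize (l a) + codeSize (N a)) + 2 * codeSize (l a)
      + (codeSize (l a) + codeSize (N a) * (4 * codeSize (N a) + 4)) + 4)
    ((((((PolyBounded.const 2).mul (hl.bounded.add hN.bounded)).add
      ((PolyBounded.const 2).mul hl.bounded)).add (hl.bounded.add (hN.bounded.mul
      (((PolyBounded.const 4).mul hN.bounded).add (.const 4)))))).add (.const 4))
    fun a i c hi hc => hc.codeSize_le.trans ?_
  · obtain ⟨e, b, C⟩ := l a
    refine ⟨?_, ?_, ?_⟩ <;> rw [codeSize_pair, codeSize_pair, codeSize_nat, codeSize_nat] <;>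
      dsimp only <;> omega
  · have hb' := List.mem_range.1 hb
    refine ((hc.pushIf hb' (by omega) _).pushIf hb' (by omega) _).mono le_rfl le_rfl ?_
    rw [Nat.succ_mul i]
    omega
  · rw [List.length_range] at hi
    have h1 : N a ≤ codeSize (N a) := by
      rw [codeSize_nat]
      omega
    have h2 : i * (4 * N a + 4) ≤ codeSize (N a) * (4 * codeSize (N a) + 4) :=
      Nat.mul_le_mul (hi.trans h1) (by omega)
    omega

@[fun_prop]
theorem PolyTime.joinLabel {N : α → ℕ} {l₁ l₂ : α → ℕ × ℕ × List ℕ}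
    (hN : PolyTime N) (h₁ : PolyTime l₁) (h₂ : PolyTime l₂) :
    PolyTime fun a => joinLabel (N a) (l₁ a) (l₂ a) := by
  unfold _root_.joinLabel
  fun_prop

theorem LevelBound.absorbLevel {E : ℕ} {e b k : ℕ} (he : e ≤ E) (hb : b ≤ 2) (hk : k ≤ E) :
    LevelBound (E + 1) 2 1 (absorbLevel e b k) := by
  unfold _root_.absorbLevel
  split_ifs <;> refine ⟨?_, ?_, (codeSize_nil).le⟩ <;> dsimp only <;> omega

/-- The bound on the list of levels depends on `N` alone, not on `K`, and `E` grows by one only.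
This keeps iterated joins polynomial. -/
theorem LevelBound.joinLabel {E K N : ℕ} {l₁ l₂ : ℕ × ℕ × List ℕ} (h₁ : LevelBound E 2 K l₁)
    (h₂ : LevelBound E 2 K l₂) (hN : N ≤ E) :
    LevelBound (E + 1) 2 (1 + N * (4 * N + 4)) (joinLabel N l₁ l₂) := by
  unfold _root_.joinLabel
  split_ifs
  · exact LevelBound.pushLevels (l := (l₁.1, l₁.2.1, []))
      ⟨h₁.1.trans (Nat.le_succ _), h₁.2.1, codeSize_nil.le⟩ (by omega) _ _ _ le_rfl
  · exact LevelBound.pushLevels (LevelBound.absorbLevel h₁.1 h₁.2.1 h₂.1) (by omega) _ _ _ le_rfl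

/-! #### The pathwidth of a tree given by parent pointers -/

/-- The label stored for `v`. -/
def lookupLabel (st : List (ℕ × ℕ × ℕ × List ℕ)) (v : ℕ) : ℕ × ℕ × List ℕ :=
  ((st.filter fun x => x.1 == v).map fun x => x.2).headD (0, 0, [])

/-- Joining the tree of the child `e.1` to that of its parent `e.2`. -/
def joinStep (N : ℕ) (st : List (ℕ × ℕ × ℕ × List ℕ)) (e : ℕ × ℕ) :
    List (ℕ × ℕ × ℕ × List ℕ) :=
  (e.2, joinLabel N (lookupLabel st e.2) (lookupLabel st e.1)) :: st

/-- The pathwidth of the tree with root `z` and edge list `E` (each vertex before its parent). -/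
def treeLevel (N : ℕ) (E : List (ℕ × ℕ)) (z : ℕ) : ℕ :=
  topLevel (lookupLabel (E.foldl (joinStep N) []) z)

theorem lookupLabel_cons_self (st : List (ℕ × ℕ × ℕ × List ℕ)) (v : ℕ) (l : ℕ × ℕ × List ℕ) :
    lookupLabel ((v, l) :: st) v = l := by
  simp [lookupLabel]

theorem lookupLabel_cons_of_ne (st : List (ℕ × ℕ × ℕ × List ℕ)) {u v : ℕ} (l : ℕ × ℕ × List ℕ)
    (h : u ≠ v) : lookupLabel ((u, l) :: st) v = lookupLabel st v := by
  simp [lookupLabel, h]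

theorem lookupLabel_mem (st : List (ℕ × ℕ × ℕ × List ℕ)) (v : ℕ) :
    (∃ u, (u, lookupLabel st v) ∈ st) ∨ lookupLabel st v = (0, 0, []) := by
  unfold lookupLabel
  cases h : st.filter fun x => x.1 == v with
  | nil => simp
  | cons x t =>
    have hx : x ∈ st.filter fun x => x.1 == v := by simp [h]
    exact Or.inl ⟨x.1, by simpa using (List.mem_filter.1 hx).1⟩

@[fun_prop]
theorem PolyTime.lookupLabel {st : α → List (ℕ × ℕ × ℕ × List ℕ)} {v : α → ℕ}
    (hst : PolyTime st) (hv : PolyTime v) : PolyTime fun a => lookupLabel (st a) (v a) := by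
  unfold _root_.lookupLabel
  fun_prop

/-- A bound on the states of the computation of `treeLevel`. -/
def StateBound (M E K i : ℕ) (st : List (ℕ × ℕ × ℕ × List ℕ)) : Prop :=
  st.length ≤ i ∧ ∀ x ∈ st, x.1 ≤ M ∧ LevelBound E 2 K x.2

theorem StateBound.lookupLabel {M E K i : ℕ} {st : List (ℕ × ℕ × ℕ × List ℕ)}
    (h : StateBound M E (K + 1) i st) (v : ℕ) : LevelBound E 2 (K + 1) (lookupLabel st v) := by
  obtain ⟨u, hu⟩ | h0 := lookupLabel_mem st v
  · exact (h.2 _ hu).2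
  · rw [h0]
    exact ⟨Nat.zero_le _, Nat.zero_le _, by rw [codeSize_nil]; omega⟩

@[fun_prop]
theorem PolyTime.treeLevel {N z : α → ℕ} {E : α → List (ℕ × ℕ)} (hN : PolyTime N)
    (hE : PolyTime E) (hz : PolyTime z) : PolyTime fun a => treeLevel (N a) (E a) (z a) := by
  have hstep : PolyTime fun x : α × List (ℕ × ℕ × ℕ × List ℕ) × (ℕ × ℕ) =>
      joinStep (N x.1) x.2.1 x.2.2 := by
    unfold joinStep
    fun_prop
  have key : PolyTime fun a => (E a).foldl (joinStep (N a)) [] := by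
    -- After `i` joins the store has at most `i` entries with first components at most `N a + i`,
    -- while the bound on their lists of levels stays fixed.
    refine hE.foldl (init := fun _ => []) (step := fun a => joinStep (N a)) (.const _) hstep
      (fun a i c => StateBound (codeSize (E a)) (N a + i) (N a * (4 * N a + 4) + 1) i c)
      (fun a => ⟨le_rfl, by simp⟩) (fun a i c b hb _ hc => ⟨?_, ?_⟩)
      (K := fun a => codeSize (E a) * ((2 * codeSize (E a) + 1 + (2 * (codeSize (N a)
        + codeSize (E a)) + 2 * 2 + (codeSize (N a) * (4 * codeSize (N a) + 4) + 1) + 4) + 1)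
        + 1) + 1) ?_ fun a i c hi hc => ?_
    · have := hc.1
      rw [joinStep, List.length_cons]
      omega
    · intro x hx
      rcases List.mem_cons.1 hx with rfl | hx
      · refine ⟨?_, ?_⟩
        · have h1 := codeSize_le_of_mem hb
          obtain ⟨b1, b2⟩ := b
          rw [codeSize_pair, codeSize_nat, codeSize_nat] at h1
          dsimp only
          omega
        · exact ((hc.lookupLabel _).joinLabel (hc.lookupLabel _) (by omega)).mono (by omega)
            le_rfl (by omega)
      · exact ⟨(hc.2 x hx).1, (hc.2 x hx).2.mono (by omega) le_rfl le_rfl⟩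
    · have hn := hN.bounded
      have he := hE.bounded
      exact (he.mul ((((((PolyBounded.const 2).mul he).add (.const 1)).add
        (((((PolyBounded.const 2).mul (hn.add he)).add (.const _)).add
        ((hn.mul (((PolyBounded.const 4).mul hn).add (.const 4))).add (.const 1))).add
        (.const 4))).add (.const 1)).add (.const 1))).add (.const 1)
    · have h1 := length_lt_codeSize (E a)
      refine codeSize_list_le (by have := hc.1; omega) fun x hx => ?_
      obtain ⟨h2, h3⟩ := hc.2 x hx
      have h4 := h3.codeSize_le
      have h5 : N a ≤ codeSize (N a) := by
        rw [codeSize_nat]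
        omega
      have h6 : N a * (4 * N a + 4) ≤ codeSize (N a) * (4 * codeSize (N a) + 4) :=
        Nat.mul_le_mul h5 (by omega)
      obtain ⟨u, l⟩ := x
      rw [codeSize_pair, codeSize_nat]
      dsimp only at *
      omega
  unfold _root_.treeLevel
  fun_prop

end LabelsInPolyTime

/-! ### Computing the level of a tree by eliminating children before their parents. -/

section TreeLevel

open Set

variable {V : Type*}

/-- `E` lists pairs of a vertex and its parent such that every vertex of `W` other than `z` occurs
once as a child, before its parent does so. -/
inductive IsElimination (z : V) : Set V → List (V × V) → Prop
  | nil : IsElimination z {z} []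
  | cons {W : Set V} {E : List (V × V)} {v p : V} : v ∉ W → p ∈ W → IsElimination z W E →
      IsElimination z (insert v W) ((v, p) :: E)

/-- The graph with the edges listed in `E`. -/
def listGraph (E : List (V × V)) : SimpleGraph V :=
  SimpleGraph.fromRel fun u v => (u, v) ∈ E

theorem IsElimination.root_mem {z : V} {W : Set V} {E : List (V × V)} (h : IsElimination z W E) :
    z ∈ W := by
  induction h with
  | nil => rfl
  | cons _ _ _ ih => exact Or.inr ih

theorem IsElimination.mem {z : V} {W : Set V} {E : List (V × V)} (h : IsElimination z W E) :
    ∀ e ∈ E, e.1 ∈ W ∧ e.2 ∈ W ∧ e.1 ≠ e.2 := by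
  induction h with
  | nil => simp
  | cons hv hp _ ih =>
    intro e he
    rcases List.mem_cons.1 he with rfl | he
    · refine ⟨Or.inl rfl, Or.inr hp, fun h => hv ?_⟩
      dsimp only at h
      rwa [h]
    · exact ⟨Or.inr (ih e he).1, Or.inr (ih e he).2.1, (ih e he).2.2⟩

theorem listGraph_adj {E : List (V × V)} {u v : V} :
    (listGraph E).Adj u v ↔ u ≠ v ∧ ((u, v) ∈ E ∨ (v, u) ∈ E) := by
  simp [listGraph]

/-- The labels of the trees that hang below the vertices of `W` that are not yet processed. -/
theorem IsElimination.hasTriple {m : ℕ} {G : SimpleGraph (Fin m)} {z : Fin m} {W : Set (Fin m)}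
    {E : List (Fin m × Fin m)} (hE : IsElimination z W E) (st : List (ℕ × ℕ × ℕ × List ℕ))
    (comp : Fin m → Set (Fin m)) (hlab : ∀ v ∈ W, HasTriple G v (comp v) (lookupLabel st v))
    (hd : ∀ v ∈ W, ∀ w ∈ W, v ≠ w → Disjoint (comp v) (comp w))
    (hX : ∀ v ∈ W, ∀ w ∈ W, v ≠ w → ∀ x ∈ comp v, ∀ y ∈ comp w, G.Adj x y → x = v ∧ y = w)
    (hG : ∀ v ∈ W, ∀ w ∈ W, G.Adj v w → (v, w) ∈ E ∨ (w, v) ∈ E)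
    (hadj : ∀ e ∈ E, G.Adj e.1 e.2) :
    HasTriple G z (⋃ v ∈ W, comp v) (lookupLabel
      ((E.map fun e => ((e.1 : ℕ), (e.2 : ℕ))).foldl (joinStep m) st) z) := by
  induction hE generalizing st comp with
  | nil => simpa using hlab z rfl
  | @cons W E v p hv hp hE ih =>
    have hvp : v ≠ p := fun h => hv (h ▸ hp)
    have hcard : ∀ u ∈ insert v W, topLevel (lookupLabel st u) < m := fun u hu => by
      simpa using (hlab u hu).topLevel_lt
    have hvW : v ∈ insert v W := Or.inl rfl
    have hpW : p ∈ insert v W := Or.inr hp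
    have hadj_vp : G.Adj v p := hadj (v, p) (by simp)
    -- The only possible edge from `comp v` to `comp w` is `{v, w}`, and `v` occurs in the list only
    -- together with `p`.
    have hother : ∀ w ∈ W, w ≠ p → ∀ x ∈ comp v, ∀ y ∈ comp w, ¬ G.Adj x y := by
      intro w hw hwp x hx y hy hxy
      have hvw : v ≠ w := fun h => hv (h ▸ hw)
      obtain ⟨rfl, rfl⟩ := hX v hvW w (Or.inr hw) hvw x hx y hy hxy
      rcases hG x hvW y (Or.inr hw) hxy with h | h
      · rcases List.mem_cons.1 h with h | h
        · exact hwp (Prod.ext_iff.1 h).2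
        · exact hv (hE.mem _ h).1
      · rcases List.mem_cons.1 h with h | h
        · have h1 : y = x := (Prod.ext_iff.1 h).1
          exact hvw h1.symm
        · exact hv (hE.mem _ h).2.1
    have hnew : HasTriple G p (comp p ∪ comp v)
        (joinLabel m (lookupLabel st p) (lookupLabel st v)) :=
      (hlab p hpW).joinLabel (hlab v hvW) (hd p hpW v hvW hvp.symm) hadj_vp.symm
        (hX p hpW v hvW hvp.symm) (hcard p hpW) (hcard v hvW)
    have hself : Function.update comp p (comp p ∪ comp v) p = comp p ∪ comp v := by simp
    have hne : ∀ w, w ≠ p → Function.update comp p (comp p ∪ comp v) w = comp w := fun w hw => by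
      simp [hw]
    have hcons : ∀ u ∈ W, u ≠ v := fun u hu h => hv (h ▸ hu)
    -- The tree below `v` is merged into that of `p`; its new label is prepended to the store and so
    -- shadows the old one.
    have key := ih (joinStep m st ((v : ℕ), (p : ℕ)))
      (Function.update comp p (comp p ∪ comp v)) ?_ ?_ ?_ ?_
      (fun e he => hadj e (by simp [he]))
    · rw [List.map_cons, List.foldl_cons]
      convert key using 1
      ext x
      simp only [mem_iUnion, exists_prop]
      constructor
      · rintro ⟨w, rfl | hw, hx⟩
        · exact ⟨p, hp, by rw [hself]; exact Or.inr hx⟩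
        · by_cases hwp : w = p
          · subst hwp
            exact ⟨w, hw, by rw [hself]; exact Or.inl hx⟩
          · exact ⟨w, hw, by rwa [hne w hwp]⟩
      · rintro ⟨w, hw, hx⟩
        by_cases hwp : w = p
        · subst hwp
          rw [hself] at hx
          rcases hx with hx | hx
          · exact ⟨w, Or.inr hw, hx⟩
          · exact ⟨v, Or.inl rfl, hx⟩
        · rw [hne w hwp] at hx
          exact ⟨w, Or.inr hw, hx⟩
    · intro w hw
      by_cases hwp : w = p
      · subst hwp
        rw [hself, joinStep, lookupLabel_cons_self]
        exact hnew
      · rw [hne w hwp, joinStep, lookupLabel_cons_of_ne _ _ (fun h => hwp (Fin.ext h.symm))]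
        exact hlab w (Or.inr hw)
    · have hdis : ∀ w ∈ W, w ≠ p → Disjoint (comp p ∪ comp v) (comp w) := fun w hw hwp =>
        Set.disjoint_union_left.2 ⟨hd p hpW w (Or.inr hw) hwp.symm,
          hd v hvW w (Or.inr hw) (hcons w hw).symm⟩
      intro u hu w hw huw
      by_cases hup : u = p
      · subst hup
        rw [hself, hne w huw.symm]
        exact hdis w hw huw.symm
      · rw [hne u hup]
        by_cases hwp : w = p
        · subst hwp
          rw [hself]
          exact (hdis u hu huw).symm
        · rw [hne w hwp]
          exact hd u (Or.inr hu) w (Or.inr hw) huw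
    · have hside : ∀ w ∈ W, w ≠ p → ∀ x ∈ comp p ∪ comp v, ∀ y ∈ comp w, G.Adj x y →
          x = p ∧ y = w := by
        rintro w hw hwp x (hx | hx) y hy hxy
        · exact hX p hpW w (Or.inr hw) hwp.symm x hx y hy hxy
        · exact absurd hxy (hother w hw hwp x hx y hy)
      intro u hu w hw huw x hx y hy hxy
      by_cases hup : u = p
      · subst hup
        rw [hself] at hx
        rw [hne w huw.symm] at hy
        exact hside w hw huw.symm x hx y hy hxy
      · rw [hne u hup] at hx
        by_cases hwp : w = p
        · subst hwp
          rw [hself] at hy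
          exact (hside u hu huw y hy x hx hxy.symm).symm
        · rw [hne w hwp] at hy
          exact hX u (Or.inr hu) w (Or.inr hw) huw x hx y hy hxy
    · intro u hu w hw huw
      rcases hG u (Or.inr hu) w (Or.inr hw) huw with h | h
      · rcases List.mem_cons.1 h with h | h
        · exact absurd (Prod.ext_iff.1 h).1 (hcons u hu)
        · exact Or.inl h
      · rcases List.mem_cons.1 h with h | h
        · exact absurd (Prod.ext_iff.1 h).1 (hcons w hw)
        · exact Or.inr h

theorem IsElimination.hasBags_iff {m : ℕ} {z : Fin m} {W : Set (Fin m)}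
    {E : List (Fin m × Fin m)} (hE : IsElimination z W E) (k : ℕ) :
    HasBags (listGraph E) W (k + 1) ↔
      treeLevel m (E.map fun e => ((e.1 : ℕ), (e.2 : ℕ))) z ≤ k := by
  -- The store may start empty because the default `(0, 0, [])` of `lookupLabel` is the label of a
  -- single vertex.
  have key := hE.hasTriple (G := listGraph E) [] (fun v => {v})
    (fun v _ => HasTriple.singleton _ v) (fun v _ w _ hvw => by simpa using hvw)
    (fun v _ w _ _ x hx y hy _ => ⟨hx, hy⟩) (fun v _ w _ hvw => (listGraph_adj.1 hvw).2)
    (fun e he => listGraph_adj.2 ⟨(hE.mem e he).2.2, Or.inl he⟩)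
  rw [Set.biUnion_of_singleton] at key
  exact key.hasBags_iff k

end TreeLevel

section Program

open Coded

variable {α β γ δ : Type*} [Coded α] [Coded β] [Coded γ] [Coded δ]

/-! ### The program -/

/-- In the ranking `r`, candidate `x` is before `y`. -/
def ranksBefore (r : List ℕ) (x y : ℕ) : Bool :=
  (r.filter fun z => z == x || z == y).headD 0 == x && !(x == y)

/-- `a` is the best candidate in `S`. -/
def isTopIn (r S : List ℕ) (a : ℕ) : Bool :=
  S.contains a && S.all fun b => b == a || ranksBefore r a b

/-- `a` is the second-best candidate in `S`. -/
def isSecondIn (r S : List ℕ) (a : ℕ) : Bool :=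
  S.any fun x => isTopIn r S x && isTopIn r (S.filter fun y => !(y == x)) a

/-- `a` is the worst candidate in `S`. -/
def isBottomIn (r S : List ℕ) (a : ℕ) : Bool :=
  S.contains a && S.all fun b => b == a || ranksBefore r b a

/-- The worst candidates of the voters. -/
def bottomList (R : List (List ℕ)) (S : List ℕ) : List ℕ :=
  S.filter fun a => R.any fun r => isBottomIn r S a

/-- The candidates to which `a` may be attached. -/
def attachList (R : List (List ℕ)) (S : List ℕ) (a : ℕ) : List ℕ :=
  S.filter fun c => R.all fun r =>
    (!isTopIn r S a && ranksBefore r c a) || (isTopIn r S a && isSecondIn r S c)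

/-- One stage of the construction of the attachment digraph; the state consists of the remaining
candidates and the adjacency lists of the removed ones. -/
def stageStep (R : List (List ℕ)) (s : List ℕ × List (ℕ × List ℕ)) :
    List ℕ × List (ℕ × List ℕ) :=
  bif s.1.isEmpty then s
  else bif s.1.tail.tail.isEmpty then (s.1.tail, s.2 ++ [(s.1.headD 0, s.1.tail)])
  else (s.1.filter fun a => !(bottomList R s.1).contains a,
    s.2 ++ (bottomList R s.1).map fun a => (a, attachList R s.1 a))

/-- The adjacency lists of the attachment digraph, in the order of removal. -/
def attachmentLists (R : List (List ℕ)) : List (ℕ × List ℕ) :=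
  ((R.headD []).foldl (fun s _ => stageStep R s) (R.headD [], [])).2

/-- The arcs that start in forced vertices. -/
def forcedArcs (A : List (ℕ × List ℕ)) : List (ℕ × ℕ) :=
  (A.filter fun x => !x.2.isEmpty && x.2.tail.isEmpty).map fun x => (x.1, x.2.headD 0)

/-- The sink of the attachment digraph. -/
def sinkOf (A : List (ℕ × List ℕ)) : ℕ :=
  ((A.filter fun x => x.2.isEmpty).map fun x => x.1).headD 0

/-- The two forced vertices between which the free vertex `x.1` has the choice. -/
def choicePair (F : List (ℕ × ℕ)) (x : ℕ × List ℕ) : ℕ × ℕ :=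
  (F.filter fun e => x.2.contains e.1 && x.2.contains e.2).headD (0, 0)

/-- Attaching the free vertex `x.1`, so that the pathwidth is as small as possible. -/
def attachStep (A : List (ℕ × List ℕ)) (E : List (ℕ × ℕ)) (x : ℕ × List ℕ) : List (ℕ × ℕ) :=
  bif (treeLevel A.length ((x.1, (choicePair (forcedArcs A) x).1) :: E) (sinkOf A)).ble
      (treeLevel A.length ((x.1, (choicePair (forcedArcs A) x).2) :: E) (sinkOf A))
    then (x.1, (choicePair (forcedArcs A) x).1) :: E
    else (x.1, (choicePair (forcedArcs A) x).2) :: E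

/-- The edges of the tree, computed from the adjacency lists of the attachment digraph. -/
def treeEdges (A : List (ℕ × List ℕ)) : List (ℕ × ℕ) :=
  (A.filter fun x => !x.2.tail.isEmpty).foldl (attachStep A) (forcedArcs A)

@[fun_prop]
theorem PolyTime.ranksBefore {r : α → List ℕ} {x y : α → ℕ} (hr : PolyTime r) (hx : PolyTime x)
    (hy : PolyTime y) : PolyTime fun a => ranksBefore (r a) (x a) (y a) := by
  unfold _root_.ranksBefore
  fun_prop

@[fun_prop]
theorem PolyTime.isTopIn {r S : α → List ℕ} {x : α → ℕ} (hr : PolyTime r) (hS : PolyTime S)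
    (hx : PolyTime x) : PolyTime fun a => isTopIn (r a) (S a) (x a) := by
  unfold _root_.isTopIn
  fun_prop

@[fun_prop]
theorem PolyTime.isSecondIn {r S : α → List ℕ} {x : α → ℕ} (hr : PolyTime r) (hS : PolyTime S)
    (hx : PolyTime x) : PolyTime fun a => isSecondIn (r a) (S a) (x a) := by
  unfold _root_.isSecondIn
  fun_prop

@[fun_prop]
theorem PolyTime.isBottomIn {r S : α → List ℕ} {x : α → ℕ} (hr : PolyTime r) (hS : PolyTime S)
    (hx : PolyTime x) : PolyTime fun a => isBottomIn (r a) (S a) (x a) := by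
  unfold _root_.isBottomIn
  fun_prop

@[fun_prop]
theorem PolyTime.bottomList {R : α → List (List ℕ)} {S : α → List ℕ} (hR : PolyTime R)
    (hS : PolyTime S) : PolyTime fun a => bottomList (R a) (S a) := by
  unfold _root_.bottomList
  fun_prop

@[fun_prop]
theorem PolyTime.attachList {R : α → List (List ℕ)} {S : α → List ℕ} {x : α → ℕ} (hR : PolyTime R)
    (hS : PolyTime S) (hx : PolyTime x) : PolyTime fun a => attachList (R a) (S a) (x a) := by
  unfold _root_.attachList
  fun_prop

@[fun_prop]
theorem PolyTime.stageStep {R : α → List (List ℕ)} {s : α → List ℕ × List (ℕ × List ℕ)}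
    (hR : PolyTime R) (hs : PolyTime s) : PolyTime fun a => stageStep (R a) (s a) := by
  unfold _root_.stageStep
  fun_prop

theorem codeSize_filter_le (l : List α) (p : α → Bool) : codeSize (l.filter p) ≤ codeSize l := by
  induction l with
  | nil => simp
  | cons a l ih =>
    rw [List.filter_cons, codeSize_cons]
    split_ifs
    · rw [codeSize_cons]
      omega
    · omega

theorem codeSize_append (l l' : List α) : codeSize (l ++ l') + 1 = codeSize l + codeSize l' := by
  induction l with
  | nil => rw [List.nil_append, codeSize_nil]; omega
  | cons a l ih =>
    rw [List.cons_append, codeSize_cons, codeSize_cons]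
    omega

theorem codeSize_stageStep_fst (R : List (List ℕ)) (s : List ℕ × List (ℕ × List ℕ)) :
    codeSize (stageStep R s).1 ≤ codeSize s.1 := by
  obtain ⟨_ | ⟨a, l⟩, acc⟩ := s
  · exact le_rfl
  · cases l with
    | nil =>
      simp only [stageStep, List.isEmpty_cons, cond_false, List.tail_cons, List.tail_nil,
        List.isEmpty_nil, cond_true]
      rw [codeSize_cons]
      omega
    | cons b l =>
      simp only [stageStep, List.isEmpty_cons, cond_false, List.tail_cons]
      cases l.isEmpty
      · exact codeSize_filter_le _ _
      · change codeSize (b :: l) ≤ codeSize (a :: b :: l)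
        rw [codeSize_cons a]
        omega

theorem codeSize_stageStep_snd (R : List (List ℕ)) (s : List ℕ × List (ℕ × List ℕ)) {M : ℕ}
    (hM : codeSize s.1 ≤ M) :
    codeSize (stageStep R s).2 ≤ codeSize s.2 + M * (2 * M + 2) := by
  have hpos : 1 ≤ M := (codeSize_pos s.1).trans_le hM
  have h0 : M + 1 ≤ M * (2 * M + 2) := by nlinarith
  obtain ⟨_ | ⟨a, l⟩, acc⟩ := s
  · exact Nat.le_add_right _ _
  · have h1 := codeSize_append acc [(a, l)]
    rw [codeSize_cons, codeSize_nil] at h1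
    have h2 : codeSize (a, l) = codeSize (a :: l) := rfl
    simp only [stageStep, List.isEmpty_cons, cond_false, List.tail_cons, List.headD_cons]
    dsimp only at hM
    cases l.tail.isEmpty
    · rw [cond_false]
      have h3 := codeSize_append acc
        ((bottomList R (a :: l)).map fun x => (x, attachList R (a :: l) x))
      have h4 : codeSize ((bottomList R (a :: l)).map fun x => (x, attachList R (a :: l) x))
          ≤ M * ((2 * M + 1) + 1) + 1 := by
        refine codeSize_list_le ?_ fun x hx => ?_
        · rw [List.length_map]
          exact (List.length_filter_le _ _).trans ((length_lt_codeSize _).le.trans hM)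
        · obtain ⟨y, hy, rfl⟩ := List.mem_map.1 hx
          have h5 := codeSize_le_of_mem (List.mem_filter.1 hy).1
          have h6 : codeSize (attachList R (a :: l) y) ≤ _ := codeSize_filter_le _ _
          rw [codeSize_pair]
          omega
      dsimp only
      rw [show 2 * M + 1 + 1 = 2 * M + 2 by omega] at h4
      omega
    · rw [cond_true]
      dsimp only
      omega

-- The first ranking doubles as the round counter. The candidate list never grows and each round
-- adds a bounded amount to the adjacency lists.
@[fun_prop]
theorem PolyTime.attachmentLists {R : α → List (List ℕ)} (hR : PolyTime R) :
    PolyTime fun a => attachmentLists (R a) := by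
  have hM : PolyBounded fun a => codeSize (R a) := hR.bounded
  have hstep : PolyTime fun x : α × (List ℕ × List (ℕ × List ℕ)) × ℕ =>
      _root_.stageStep (R x.1) x.2.1 := by
    fun_prop
  have hhead : ∀ a, codeSize ((R a).headD []) ≤ codeSize (R a) := fun a => by
    cases R a with
    | nil => exact le_rfl
    | cons r l => exact (codeSize_le_of_mem (by simp)).le
  have key := PolyTime.foldl (l := fun a => (R a).headD []) (init := fun a => ((R a).headD [], []))
    (step := fun a s _ => _root_.stageStep (R a) s) (by fun_prop) (by fun_prop) hstep
    (fun a i s => codeSize s.1 ≤ codeSize (R a) ∧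
      codeSize s.2 ≤ 1 + i * (codeSize (R a) * (2 * codeSize (R a) + 2)))
    (fun a => ⟨hhead a, by rw [codeSize_nil]; omega⟩)
    (fun a i s b _ _ hs => ⟨(codeSize_stageStep_fst _ _).trans hs.1, by
      have := codeSize_stageStep_snd (R a) s hs.1
      rw [Nat.succ_mul i]
      omega⟩)
    (K := fun a => codeSize (R a) + (1 + codeSize (R a) * (codeSize (R a)
      * (2 * codeSize (R a) + 2))) + 1)
    ((hM.add ((PolyBounded.const 1).add (hM.mul (hM.mul (((PolyBounded.const 2).mul hM).add
      (.const 2)))))).add (.const 1))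
    (fun a i s hi hs => by
      have h1 := (length_lt_codeSize ((R a).headD [])).le.trans (hhead a)
      have h2 := Nat.mul_le_mul_right (codeSize (R a) * (2 * codeSize (R a) + 2)) (hi.trans h1)
      obtain ⟨s₁, s₂⟩ := s
      rw [codeSize_pair]
      have := hs.1
      have := hs.2
      dsimp only at *
      omega)
  unfold _root_.attachmentLists
  fun_prop

@[fun_prop]
theorem PolyTime.forcedArcs {A : α → List (ℕ × List ℕ)} (hA : PolyTime A) :
    PolyTime fun a => forcedArcs (A a) := by
  unfold _root_.forcedArcs
  fun_prop

@[fun_prop]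
theorem PolyTime.sinkOf {A : α → List (ℕ × List ℕ)} (hA : PolyTime A) :
    PolyTime fun a => sinkOf (A a) := by
  unfold _root_.sinkOf
  fun_prop

@[fun_prop]
theorem PolyTime.choicePair {F : α → List (ℕ × ℕ)} {x : α → ℕ × List ℕ} (hF : PolyTime F)
    (hx : PolyTime x) : PolyTime fun a => choicePair (F a) (x a) := by
  unfold _root_.choicePair
  fun_prop

theorem codeSize_choicePair_le (F : List (ℕ × ℕ)) (x : ℕ × List ℕ) :
    codeSize (choicePair F x) ≤ codeSize F + 3 := by
  unfold choicePair
  have h := codeSize_filter_le F fun e => x.2.contains e.1 && x.2.contains e.2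
  cases hf : F.filter fun e => x.2.contains e.1 && x.2.contains e.2 with
  | nil => exact Nat.le_add_left _ _
  | cons e l =>
    rw [hf, codeSize_cons] at h
    rw [List.headD_cons]
    omega

/-- Each round adds one edge, whose code is bounded by those of the input and of the forced arcs. -/
theorem PolyTime.treeEdges : PolyTime treeEdges := by
  have hstep : PolyTime fun x : List (ℕ × List ℕ) × List (ℕ × ℕ) × (ℕ × List ℕ) =>
      attachStep x.1 x.2.1 x.2.2 := by
    unfold attachStep
    fun_prop
  have hF : PolyBounded fun A : List (ℕ × List ℕ) => codeSize (_root_.forcedArcs A) :=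
    (PolyTime.forcedArcs .id).bounded
  refine PolyTime.foldl_of_growth (l := fun A => A.filter fun x => !x.2.tail.isEmpty)
    (init := _root_.forcedArcs) (step := attachStep) (by fun_prop) (PolyTime.forcedArcs .id) hstep
    (G := fun A => codeSize A + (codeSize (_root_.forcedArcs A) + 3) + 2)
    ((PolyBounded.size.add (hF.add (.const 3))).add (.const 2)) fun A E x hx => ?_
  have h1 := codeSize_choicePair_le (_root_.forcedArcs A) x
  have h2 := codeSize_le_of_mem (List.mem_filter.1 hx).1
  obtain ⟨a, B⟩ := x
  rcases hc : _root_.choicePair (_root_.forcedArcs A) (a, B) with ⟨c₁, c₂⟩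
  rw [hc, codeSize_pair] at h1
  rw [codeSize_pair] at h2
  rw [attachStep, hc]
  dsimp only
  cases (_root_.treeLevel A.length ((a, c₁) :: E) (_root_.sinkOf A)).ble
      (_root_.treeLevel A.length ((a, c₂) :: E) (_root_.sinkOf A))
  · rw [cond_false, codeSize_cons, codeSize_pair]
    omega
  · rw [cond_true, codeSize_cons, codeSize_pair]
    omega

end Program

/-! ### The program computes adjacency lists of an attachment digraph. -/

section ProgramCorrect

variable {n m : ℕ} {P : Profile n (Fin m)} {rk : Fin n → List (Fin m)}

/-- The candidates in a list, as numbers. -/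
def toNats (l : List (Fin m)) : List ℕ := l.map Fin.val

/-- The rankings, as lists of numbers. -/
def natRankings (rk : Fin n → List (Fin m)) : List (List ℕ) := List.ofFn fun i => toNats (rk i)

theorem mem_toNats {l : List (Fin m)} {a : Fin m} : (a : ℕ) ∈ toNats l ↔ a ∈ l := by
  simp [toNats, Fin.val_inj]

theorem filter_toNats (l : List (Fin m)) (p : ℕ → Bool) :
    (toNats l).filter p = toNats (l.filter fun a => p a) := by
  simp only [toNats, List.filter_map]
  rfl

/-- Once a ranking is filtered down to `x` and `y`, its first entry is the preferred one. -/
theorem ranksBefore_iff {i : Fin n} {r : List (Fin m)} (hr : P.IsRanking i r) (x y : Fin m) :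
    ranksBefore (toNats r) x y = true ↔ P.prefers i x y := by
  by_cases hxy : x = y
  · subst hxy
    simp [ranksBefore, Profile.prefers_irrefl]
  have hpw : (r.filter fun a : Fin m => (a : ℕ) == x || (a : ℕ) == y).Pairwise (P.prefers i) :=
    hr.1.sublist List.filter_sublist
  have hx : x ∈ r.filter fun a : Fin m => (a : ℕ) == x || (a : ℕ) == y := by simp [hr.2 x]
  have hy : y ∈ r.filter fun a : Fin m => (a : ℕ) == x || (a : ℕ) == y := by simp [hr.2 y]
  have hmem : ∀ z ∈ r.filter fun a : Fin m => (a : ℕ) == x || (a : ℕ) == y, z = x ∨ z = y := by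
    simp [Fin.val_inj]
  rw [ranksBefore, filter_toNats]
  revert hpw hx hy hmem
  cases r.filter fun a : Fin m => (a : ℕ) == x || (a : ℕ) == y with
  | nil => simp
  | cons z l =>
    intro hpw hx hy hmem
    have hne : (x : ℕ) ≠ y := fun h => hxy (Fin.ext h)
    rcases hmem z (by simp) with rfl | rfl
    · have hyl : y ∈ l := (List.mem_cons.1 hy).resolve_left (Ne.symm hxy)
      simp [toNats, hne, (List.pairwise_cons.1 hpw).1 y hyl]
    · have hxl : x ∈ l := (List.mem_cons.1 hx).resolve_left hxy
      have := Profile.prefers_asymm ((List.pairwise_cons.1 hpw).1 x hxl)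
      simp [toNats, hne.symm, this]

theorem forall_mem_toNats {l : List (Fin m)} {p : ℕ → Prop} :
    (∀ x ∈ toNats l, p x) ↔ ∀ a ∈ l, p (a : ℕ) := by
  simp [toNats]

theorem exists_mem_toNats {l : List (Fin m)} {p : ℕ → Prop} :
    (∃ x ∈ toNats l, p x) ↔ ∃ a ∈ l, p (a : ℕ) := by
  simp [toNats]

theorem isTopIn_iff {i : Fin n} {r : List (Fin m)} (hr : P.IsRanking i r) (S : List (Fin m))
    (a : Fin m) : isTopIn (toNats r) (toNats S) a = true ↔ P.IsTop i {c | c ∈ S} a := by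
  simp only [isTopIn, Bool.and_eq_true, List.contains_iff_mem, mem_toNats, List.all_eq_true,
    forall_mem_toNats, Bool.or_eq_true, beq_iff_eq, Fin.val_inj, ranksBefore_iff hr,
    Profile.IsTop, Set.mem_ofPred_eq, or_iff_not_imp_left]

theorem isBottomIn_iff {i : Fin n} {r : List (Fin m)} (hr : P.IsRanking i r) (S : List (Fin m))
    (a : Fin m) : isBottomIn (toNats r) (toNats S) a = true ↔ P.IsBottom i {c | c ∈ S} a := by
  simp only [isBottomIn, Bool.and_eq_true, List.contains_iff_mem, mem_toNats, List.all_eq_true,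
    forall_mem_toNats, Bool.or_eq_true, beq_iff_eq, Fin.val_inj, ranksBefore_iff hr,
    Profile.IsBottom, Set.mem_ofPred_eq, or_iff_not_imp_left]

theorem isSecondIn_iff {i : Fin n} {r : List (Fin m)} (hr : P.IsRanking i r) (S : List (Fin m))
    (a : Fin m) : isSecondIn (toNats r) (toNats S) a = true ↔ P.IsSecond i {c | c ∈ S} a := by
  simp only [isSecondIn, List.any_eq_true, exists_mem_toNats, Bool.and_eq_true, filter_toNats,
    isTopIn_iff hr, Profile.IsSecond]
  have e : ∀ x : Fin m, {c | c ∈ S.filter fun b : Fin m => !((b : ℕ) == x)}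
      = {c | c ∈ S} \ {x} := by
    intro x
    ext c
    simp [Fin.val_inj]
  simp only [e]
  exact ⟨fun ⟨x, _, h⟩ => ⟨x, h⟩, fun ⟨x, h⟩ => ⟨x, h.1.1, h⟩⟩

theorem exists_bottomList (hrk : ∀ i, P.IsRanking i (rk i)) {S : List (Fin m)} (hS : S.Nodup) :
    ∃ L : List (Fin m), bottomList (natRankings rk) (toNats S) = toNats L ∧ L.Nodup ∧
      ∀ a, a ∈ L ↔ a ∈ P.bottoms {c | c ∈ S} := by
  refine ⟨_, filter_toNats _ _, hS.filter _, fun a => ?_⟩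
  simp only [List.mem_filter, List.any_eq_true, natRankings, List.mem_ofFn, exists_exists_eq_and,
    isBottomIn_iff (hrk _), Profile.bottoms]
  exact ⟨fun h => h.2, fun h => ⟨h.elim fun i hi => hi.1, h⟩⟩

theorem exists_attachList (hn : 0 < n) (hrk : ∀ i, P.IsRanking i (rk i)) {S : List (Fin m)}
    (hS : S.Nodup) (a : Fin m) : ∃ L : List (Fin m),
      attachList (natRankings rk) (toNats S) a = toNats L ∧ L.Nodup ∧
      ∀ b, b ∈ L ↔ b ∈ P.attachSet {c | c ∈ S} a := by
  refine ⟨_, filter_toNats _ _, hS.filter _, fun b => ?_⟩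
  simp only [List.mem_filter, List.all_eq_true, natRankings, List.mem_ofFn, forall_exists_index,
    forall_apply_eq_imp_iff, Bool.or_eq_true, Bool.and_eq_true, Bool.not_eq_true',
    ← Bool.not_eq_true, isTopIn_iff (hrk _), isSecondIn_iff (hrk _), ranksBefore_iff (hrk _),
    Profile.attachSet, Set.mem_iInter, Profile.attachSetOf]
  exact ⟨fun h i => ⟨h.1, h.2 i⟩, fun h => ⟨(h ⟨0, hn⟩).1, fun i => (h i).2⟩⟩

/-- The list `A` of adjacency lists represents the digraph `D` on `S`; no arc ends in a vertex that
comes earlier in the list. -/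
structure Represents (S : Set (Fin m)) (A : List (Fin m × List (Fin m))) (D : Digraph (Fin m)) :
    Prop where
  adj : ∀ a b, D.Adj a b ↔ ∃ B, (a, B) ∈ A ∧ b ∈ B
  nodup : (A.map Prod.fst).Nodup
  mem : ∀ a, a ∈ S ↔ ∃ B, (a, B) ∈ A
  nodup_snd : ∀ x ∈ A, x.2.Nodup
  target : ∀ x ∈ A, ∀ b ∈ x.2, b ∈ S
  order : A.Pairwise fun x y => x.1 ∉ y.2

/-- Adjacency lists, in numbers. -/
def toNatLists (A : List (Fin m × List (Fin m))) : List (ℕ × List ℕ) :=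
  A.map fun x => ((x.1 : ℕ), toNats x.2)

theorem foldl_stageStep_nil (R : List (List ℕ)) (l : List ℕ) (acc : List (ℕ × List ℕ)) :
    l.foldl (fun s _ => stageStep R s) ([], acc) = ([], acc) := by
  induction l with
  | nil => rfl
  | cons b l ih => exact ih

theorem ncard_list {S : List (Fin m)} (hS : S.Nodup) : {c | c ∈ S}.ncard = S.length := by
  rw [← List.toFinset_card_of_nodup hS, ← Set.ncard_coe_finset]
  congr 1
  ext c
  simp

/-- Arcs from the bottoms leave the set of bottoms, and arcs added later stay among the remaining
candidates; so no arc points to an earlier entry of the list. -/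
theorem Represents.step {S : Set (Fin m)} {L : List (Fin m)} {A : List (Fin m × List (Fin m))}
    {D : Digraph (Fin m)} {g : Fin m → List (Fin m)} (hn : 0 < n) (hS : 3 ≤ S.ncard)
    (hLnd : L.Nodup) (hL : ∀ a, a ∈ L ↔ a ∈ P.bottoms S) (hgnd : ∀ a, (g a).Nodup)
    (hg : ∀ a b, b ∈ g a ↔ b ∈ P.attachSet S a) (hA : Represents (S \ P.bottoms S) A D) :
    Represents S ((L.map fun a => (a, g a)) ++ A)
      ⟨fun a b => (a ∈ P.bottoms S ∧ b ∈ P.attachSet S a) ∨ D.Adj a b⟩ := by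
  have hmem : ∀ a B, (a, B) ∈ (L.map fun a => (a, g a)) ++ A ↔
      (a ∈ P.bottoms S ∧ B = g a) ∨ (a, B) ∈ A := by
    intro a B
    simp only [List.mem_append, List.mem_map, Prod.mk.injEq]
    refine or_congr_left ⟨?_, fun h => ⟨a, (hL a).2 h.1, rfl, h.2.symm⟩⟩
    rintro ⟨a, ha, rfl, rfl⟩
    exact ⟨(hL a).1 ha, rfl⟩
  have hdis : ∀ a ∈ L, ∀ B, (a, B) ∉ A := fun a ha B h =>
    ((hA.mem a).2 ⟨B, h⟩).2 ((hL a).1 ha)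
  refine ⟨fun a b => ?_, ?_, fun a => ?_, fun x hx => ?_, fun x hx b hb => ?_, ?_⟩
  · simp only [hmem, hA.adj]
    constructor
    · rintro (h | ⟨B, h, hb⟩)
      · exact ⟨g a, Or.inl ⟨h.1, rfl⟩, (hg a b).2 h.2⟩
      · exact ⟨B, Or.inr h, hb⟩
    · rintro ⟨B, ⟨h, rfl⟩ | h, hb⟩
      · exact Or.inl ⟨h, (hg a b).1 hb⟩
      · exact Or.inr ⟨B, h, hb⟩
  · rw [List.map_append, List.map_map, List.nodup_append]
    refine ⟨by simpa [Function.comp_def] using hLnd, hA.nodup, ?_⟩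
    rintro a ha b hb rfl
    obtain ⟨⟨a', B⟩, hB, rfl⟩ := List.mem_map.1 hb
    exact hdis a' (by simpa using ha) B hB
  · simp only [hmem]
    constructor
    · intro ha
      by_cases hab : a ∈ P.bottoms S
      · exact ⟨_, Or.inl ⟨hab, rfl⟩⟩
      · exact ((hA.mem a).1 ⟨ha, hab⟩).imp fun _ => Or.inr
    · rintro ⟨B, h | h⟩
      · exact Profile.bottoms_subset h.1
      · exact ((hA.mem a).2 ⟨B, h⟩).1
  · obtain ⟨a, B⟩ := x
    rcases (hmem a B).1 hx with ⟨-, rfl⟩ | h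
    · exact hgnd a
    · exact hA.nodup_snd _ h
  · obtain ⟨a, B⟩ := x
    rcases (hmem a B).1 hx with ⟨-, rfl⟩ | h
    · exact (Profile.mem_and_ne_of_mem_attachSet hn ((hg a b).1 hb)).1
    · exact (hA.target _ h b hb).1
  · refine List.pairwise_append.2 ⟨?_, hA.order, fun x hx y hy hxy => ?_⟩
    · refine List.pairwise_map.2 (List.Pairwise.imp_of_mem ?_ hLnd)
      intro a b ha hb _ hab
      exact Profile.notMem_bottoms_of_mem_attachSet hS (Profile.bottoms_subset ((hL b).1 hb))
        ((hg b a).1 hab) ((hL a).1 ha)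
    · obtain ⟨a, ha, rfl⟩ := List.mem_map.1 hx
      exact (hA.target y hy _ hxy).2 ((hL a).1 ha)

/-- Only the length of `l` matters: it counts rounds, and every round on a nonempty list removes at
least one candidate. -/
theorem exists_represents (hn : 0 < n) (hrk : ∀ i, P.IsRanking i (rk i))
    {T : SimpleGraph (Fin m)} (hT : P.LocallyPeaked T) (l : List ℕ) {S : List (Fin m)}
    (hS : S.Nodup) (hconn : Profile.ConnIn T {c | c ∈ S}) (hl : S.length ≤ l.length)
    (acc : List (ℕ × List ℕ)) :
    ∃ (A : List (Fin m × List (Fin m))) (D : Digraph (Fin m)),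
      (l.foldl (fun s _ => stageStep (natRankings rk) s) (toNats S, acc)).2 = acc ++ toNatLists A ∧
      P.Builds {c | c ∈ S} D ∧ Represents {c | c ∈ S} A D := by
  induction l generalizing S acc with
  | nil =>
    obtain rfl : S = [] := List.eq_nil_of_length_eq_zero (by simpa using hl)
    refine ⟨[], _, by simp [toNatLists], .done _ (by simp), ?_⟩
    refine ⟨?_, ?_, ?_, ?_, ?_, ?_⟩ <;> simp
  | cons b l ih =>
    rw [List.foldl_cons]
    match S, hS, hconn, hl with
    | [], _, _, _ =>
      refine ⟨[], _, ?_, .done _ (by simp), ?_⟩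
      · change (l.foldl _ ([], acc)).2 = _
        rw [foldl_stageStep_nil]
        simp [toNatLists]
      · refine ⟨?_, ?_, ?_, ?_, ?_, ?_⟩ <;> simp
    | [x], _, _, _ =>
      refine ⟨[(x, [])], _, ?_, .done _ (by simp), ?_⟩
      · change (l.foldl _ ([], acc ++ [((x : ℕ), [])])).2 = _
        rw [foldl_stageStep_nil]
        rfl
      · refine ⟨?_, ?_, ?_, ?_, ?_, ?_⟩ <;> simp
    | [x, y], hS, _, hl =>
      have hxy : x ≠ y := by simpa using hS
      have e : {c | c ∈ [x, y]} = {x, y} := by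
        ext c
        simp
      rw [e]
      refine ⟨[(x, [y]), (y, [])], _, ?_, .two x y hxy, ?_⟩
      · obtain ⟨b', l, rfl⟩ : ∃ b' l', l = b' :: l' := by
          cases l with
          | nil => simp at hl
          | cons b' l' => exact ⟨b', l', rfl⟩
        rw [List.foldl_cons]
        change (l.foldl _ ([], acc ++ [((x : ℕ), [(y : ℕ)])] ++ [((y : ℕ), [])])).2 = _
        rw [foldl_stageStep_nil, List.append_assoc]
        rfl
      · refine ⟨?_, ?_, ?_, ?_, ?_, ?_⟩
        · rintro a b
          simp
          aesop
        · simpa using hxy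
        · simp
          aesop
        · simp
        · simp
        · simp
    | x :: y :: z :: S', hS, hconn, hl =>
      generalize hSe : x :: y :: z :: S' = S at *
      have h3 : 3 ≤ {c | c ∈ S}.ncard := by
        rw [ncard_list hS, ← hSe]
        simp
      obtain ⟨L, hL1, hL2, hL3⟩ := exists_bottomList hrk hS
      choose g hg1 hg2 hg3 using exists_attachList hn hrk hS
      have e : {c | c ∈ S.filter fun a : Fin m =>
          !(bottomList (natRankings rk) (toNats S)).contains (a : ℕ)}
          = {c | c ∈ S} \ P.bottoms {c | c ∈ S} := by
        ext c
        simp only [Set.mem_ofPred_eq, List.mem_filter, Bool.not_eq_true', ← Bool.not_eq_true,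
          List.contains_iff_mem, hL1, mem_toNats, hL3, Set.mem_sdiff]
      have hlt : (S.filter fun a : Fin m =>
          !(bottomList (natRankings rk) (toNats S)).contains (a : ℕ)).length < S.length := by
        obtain ⟨a, ha⟩ := Profile.bottoms_nonempty (P := P) hn
          (Set.nonempty_of_ncard_ne_zero (s := {c | c ∈ S}) (by omega))
        refine List.length_filter_lt_length_iff_exists.2 
          ⟨a, Profile.bottoms_subset (S := {c | c ∈ S}) ha, ?_⟩
        simp [hL1, mem_toNats, hL3, ha]
      obtain ⟨A, D, h1, h2, h3'⟩ := ih (hS.filter _)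
        (by rw [e]; exact hT.connIn_diff hconn)
        (by rw [List.length_cons] at hl; omega)
        (acc ++ (toNats L).map fun a => (a, attachList (natRankings rk) (toNats S) a))
      rw [e] at h2 h3'
      refine ⟨(L.map fun a => (a, g a)) ++ A, _, ?_, .step _ D h3 (fun a ha => ?_) h2,
        h3'.step hn h3 hL2 hL3 hg2 hg3⟩
      · have hstep : stageStep (natRankings rk) (toNats S, acc)
            = (toNats (S.filter fun a : Fin m =>
                !(bottomList (natRankings rk) (toNats S)).contains (a : ℕ)),
              acc ++ (toNats L).map fun a => (a, attachList (natRankings rk) (toNats S) a)) := by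
          rw [← filter_toNats S fun a => !(bottomList (natRankings rk) (toNats S)).contains a,
            ← hL1]
          subst hSe
          rfl
        rw [hstep, h1, toNatLists, toNatLists, List.map_append, List.append_assoc]
        congr 2
        simp only [toNats, List.map_map, List.map_inj_left]
        exact fun a _ => congrArg _ (hg1 a)
      · obtain ⟨c, hc, hca⟩ := Profile.exists_mem_ne (S := {c | c ∈ S}) (k := 2) le_rfl (by omega) a
        obtain ⟨b, hb, -⟩ := hT.exists_attach hconn ha hc hca
        exact ⟨b, hb⟩

end ProgramCorrect

/-! ### The program returns a possible output of the algorithm. -/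

section TreeEdges

variable {n m : ℕ} {P : Profile n (Fin m)} {D : Digraph (Fin m)} {st : Fin m → ℕ} {z : Fin m}
  {A : List (Fin m × List (Fin m))}

/-- If no child is the parent of a later entry, then each parent other than `z`, being itself a
child in the list, must occur as a child further on. -/
theorem IsElimination.of_order {V : Type*} {z : V} {E : List (V × V)}
    (hnd : (E.map Prod.fst).Nodup) (hz : z ∉ E.map Prod.fst) (ho : E.Pairwise fun x y => x.1 ≠ y.2)
    (ht : ∀ e ∈ E, e.2 = z ∨ e.2 ∈ E.map Prod.fst) (hne : ∀ e ∈ E, e.1 ≠ e.2) :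
    IsElimination z ({z} ∪ {a | a ∈ E.map Prod.fst}) E := by
  induction E with
  | nil => simpa using IsElimination.nil (z := z)
  | cons e E ih =>
    obtain ⟨v, p⟩ := e
    rw [List.map_cons, List.nodup_cons] at hnd
    rw [List.map_cons, List.mem_cons, not_or] at hz
    rw [List.pairwise_cons] at ho
    have e1 : ({z} ∪ {a | a ∈ ((v, p) :: E).map Prod.fst} : Set V)
        = insert v ({z} ∪ {a | a ∈ E.map Prod.fst}) := by
      ext a
      simp only [List.map_cons, List.mem_cons, Set.mem_union, Set.mem_singleton_iff,
        Set.mem_ofPred_eq, Set.mem_insert_iff]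
      tauto
    rw [e1]
    refine .cons ?_ ?_ (ih hnd.2 hz.2 ho.2 (fun e he => ?_) fun e he => hne e (by simp [he]))
    · rintro (h | h)
      · exact hz.1 h.symm
      · exact hnd.1 h
    · rcases ht (v, p) (by simp) with h | h
      · exact Or.inl h
      · rw [List.map_cons, List.mem_cons] at h
        exact Or.inr (h.resolve_left fun h => hne (v, p) (by simp) h.symm)
    · refine (ht e (by simp [he])).imp_right fun h => ?_
      rw [List.map_cons, List.mem_cons] at h
      exact h.resolve_left fun h => ho.1 e he h.symm

theorem IsElimination.exists_parent {V : Type*} {z : V} {W : Set V} {E : List (V × V)}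
    (h : IsElimination z W E) : ∀ a ∈ W, a ≠ z → ∃ b, (a, b) ∈ E := by
  induction h with
  | nil => exact fun a ha haz => absurd ha haz
  | @cons W E v p hv hp hE ih =>
    rintro a (rfl | ha) haz
    · exact ⟨p, by simp⟩
    · obtain ⟨b, hb⟩ := ih a ha haz
      exact ⟨b, by simp [hb]⟩

theorem IsElimination.parent_unique {V : Type*} {z : V} {W : Set V} {E : List (V × V)}
    (h : IsElimination z W E) : ∀ a b c, (a, b) ∈ E → (a, c) ∈ E → b = c := by
  induction h with
  | nil => simp
  | @cons W E v p hv hp hE ih =>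
    intro a b c hb hc
    rcases List.mem_cons.1 hb with hb | hb <;> rcases List.mem_cons.1 hc with hc | hc
    · exact (Prod.ext_iff.1 hb).2.trans (Prod.ext_iff.1 hc).2.symm
    · exact absurd (hE.mem _ hc).1 ((Prod.ext_iff.1 hb).1 ▸ hv)
    · exact absurd (hE.mem _ hb).1 ((Prod.ext_iff.1 hc).1 ▸ hv)
    · exact ih a b c hb hc

theorem IsElimination.root_no_parent {V : Type*} {z : V} {W : Set V} {E : List (V × V)}
    (h : IsElimination z W E) : ∀ b, (z, b) ∉ E := by
  induction h with
  | nil => simp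
  | @cons W E v p hv hp hE ih =>
    intro b hb
    rcases List.mem_cons.1 hb with hb | hb
    · obtain rfl : z = v := (Prod.ext_iff.1 hb).1
      exact hv hE.root_mem
    · exact ih b hb

/-- One of the two endpoints of an edge may receive a new leaf. -/
theorem IsElimination.hasBags_leaf {V : Type*} {z : V} {W : Set V} {E : List (V × V)}
    (hE : IsElimination z W E) {a c₁ c₂ : V} {k : ℕ} (ha : a ∉ W) (hc : (c₁, c₂) ∈ E)
    (h : HasBags (listGraph E) W (k + 1)) :
    HasBags (listGraph ((a, c₁) :: E)) (insert a W) (k + 1) ∨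
      HasBags (listGraph ((a, c₂) :: E)) (insert a W) (k + 1) := by
  classical
  obtain ⟨S, h1, h2⟩ := h
  obtain ⟨hm1, hm2, hne⟩ := hE.mem _ hc
  -- After refinement one endpoint of the edge lies in a bag of size at most `k`; the leaf is
  -- attached there.
  obtain ⟨S', h3, h4, -, X, hX, hcX, hXk⟩ :=
    h1.exists_slack_edge h2 hm1 hm2 (listGraph_adj.2 ⟨hne, Or.inl hc⟩)
  have key : ∀ c ∈ X, HasBags (listGraph ((a, c) :: E)) (insert a W) (k + 1) := by
    intro c hcX
    obtain ⟨L, R, rfl⟩ := List.append_of_mem hX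
    have hsub : ∀ x y, x ∈ W → y ∈ W → (x, y) ∈ (a, c) :: E → (x, y) ∈ E := by
      intro x y hx hy hxy
      refine (List.mem_cons.1 hxy).resolve_left fun h => ?_
      obtain rfl : x = a := (Prod.ext_iff.1 h).1
      exact ha hx
    refine ⟨_, h3.insertLeaf (G' := listGraph ((a, c) :: E)) ha hcX (fun b hb hab => ?_)
      (fun x hx y hy hxy => ?_), fun Y hY => ?_⟩
    · rcases (listGraph_adj.1 hab).2 with h | h
      · rcases List.mem_cons.1 h with h | h
        · exact (Prod.ext_iff.1 h).2
        · exact absurd (hE.mem _ h).1 ha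
      · rcases List.mem_cons.1 h with h | h
        · obtain rfl : b = a := (Prod.ext_iff.1 h).1
          exact absurd hb ha
        · exact absurd (hE.mem _ h).2.1 ha
    · obtain ⟨hne, hxy⟩ := listGraph_adj.1 hxy
      exact listGraph_adj.2 ⟨hne, hxy.imp (hsub x y hx hy) (hsub y x hy hx)⟩
    · simp only [List.mem_append, List.mem_cons] at hY h4
      rcases hY with hY | rfl | rfl | hY
      · exact h4 Y (Or.inl hY)
      · exact h4 Y (Or.inr (Or.inl rfl))
      · exact (Finset.card_insert_le _ _).trans (by omega)
      · exact h4 Y (Or.inr (Or.inr hY))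
  exact hcX.imp (key c₁) (key c₂)

/-- Edges, in numbers. -/
def toNatEdges (E : List (Fin m × Fin m)) : List (ℕ × ℕ) :=
  E.map fun e => ((e.1 : ℕ), (e.2 : ℕ))

/-- The arcs from forced vertices. -/
def forcedPairs (A : List (Fin m × List (Fin m))) (d : Fin m) : List (Fin m × Fin m) :=
  (A.filter fun x => !x.2.isEmpty && x.2.tail.isEmpty).map fun x => (x.1, x.2.headD d)

theorem forcedArcs_toNatLists (A : List (Fin m × List (Fin m))) (d : Fin m) :
    forcedArcs (toNatLists A) = toNatEdges (forcedPairs A d) := by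
  have e : ∀ x : Fin m × List (Fin m), (!(toNats x.2).isEmpty && (toNats x.2).tail.isEmpty)
      = (!x.2.isEmpty && x.2.tail.isEmpty) := by
    rintro ⟨a, _ | ⟨b, _ | ⟨c, l⟩⟩⟩ <;> rfl
  simp only [forcedArcs, toNatLists, toNatEdges, forcedPairs, List.filter_map, List.map_map,
    Function.comp_def, e]
  refine List.map_congr_left fun x hx => ?_
  obtain ⟨a, _ | ⟨b, l⟩⟩ := x
  · simp at hx
  · rfl

theorem mem_forcedPairs {d a b : Fin m} : (a, b) ∈ forcedPairs A d ↔ (a, [b]) ∈ A := by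
  simp only [forcedPairs, List.mem_map, List.mem_filter]
  constructor
  · rintro ⟨⟨c, _ | ⟨e, _ | ⟨f, l⟩⟩⟩, ⟨h1, h2⟩, h3⟩
    · simp at h2
    · obtain ⟨rfl, rfl⟩ := Prod.ext_iff.1 h3
      exact h1
    · simp at h2
  · exact fun h => ⟨_, ⟨h, rfl⟩, rfl⟩

theorem Represents.unique {S : Set (Fin m)} (hA : Represents S A D) {a : Fin m}
    {B B' : List (Fin m)} (h : (a, B) ∈ A) (h' : (a, B') ∈ A) : B = B' := by
  have := List.inj_on_of_nodup_map hA.nodup h h' rfl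
  exact (Prod.ext_iff.1 this).2

theorem Represents.outDeg_eq {S : Set (Fin m)} (hA : Represents S A D) {a : Fin m}
    {B : List (Fin m)} (h : (a, B) ∈ A) : outDeg D a = B.length := by
  rw [outDeg, ← ncard_list (hA.nodup_snd _ h)]
  congr 1
  ext b
  simp only [Set.mem_ofPred_eq, hA.adj]
  constructor
  · rintro ⟨B', h', hb⟩
    rwa [hA.unique h h']
  · exact fun hb => ⟨B, h, hb⟩

theorem Represents.adj_iff {S : Set (Fin m)} (hA : Represents S A D) {a b : Fin m}
    {B : List (Fin m)} (h : (a, B) ∈ A) : D.Adj a b ↔ b ∈ B := by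
  rw [hA.adj]
  constructor
  · rintro ⟨B', h', hb⟩
    rwa [hA.unique h h']
  · exact fun hb => ⟨B, h, hb⟩

theorem Represents.mem_forcedPairs_iff (hA : Represents Set.univ A D) {d a b : Fin m} :
    (a, b) ∈ forcedPairs A d ↔ a ∈ forced D ∧ D.Adj a b := by
  rw [mem_forcedPairs]
  constructor
  · exact fun h => ⟨(hA.outDeg_eq h).le, (hA.adj_iff h).2 (by simp)⟩
  · rintro ⟨h1, h2⟩
    obtain ⟨B, hB⟩ := (hA.mem a).1 trivial
    have h3 : B.length ≤ 1 := (hA.outDeg_eq hB).symm.trans_le h1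
    have h4 := (hA.adj_iff hB).1 h2
    match B, h3, h4 with
    | [c], _, h4 => rwa [List.mem_singleton.1 h4]

theorem Represents.isElimination_forcedPairs (hn : 0 < n) (hD : P.StagedOn Set.univ D st z)
    (hA : Represents Set.univ A D) (d : Fin m) :
    IsElimination z (forced D) (forcedPairs A d) := by
  have hmem : ∀ a, a ∈ (forcedPairs A d).map Prod.fst ↔ a ∈ forced D ∧ a ≠ z := by
    intro a
    rw [List.mem_map]
    constructor
    · rintro ⟨⟨a, b⟩, h, rfl⟩
      obtain ⟨h1, h2⟩ := hA.mem_forcedPairs_iff.1 h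
      refine ⟨h1, ?_⟩
      rintro rfl
      exact hD.sink _ h2
    · rintro ⟨h1, h2⟩
      obtain ⟨b, hb⟩ := hD.nonsink a trivial h2
      exact ⟨(a, b), hA.mem_forcedPairs_iff.2 ⟨h1, hb⟩, rfl⟩
  have e : forced D = {z} ∪ {a | a ∈ (forcedPairs A d).map Prod.fst} := by
    ext a
    simp only [hmem, Set.mem_union, Set.mem_singleton_iff, Set.mem_ofPred_eq]
    constructor
    · exact fun h => or_iff_not_imp_left.2 fun h' => ⟨h, h'⟩
    · rintro (rfl | h)
      · exact hD.sink_mem_forced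
      · exact h.1
  rw [e]
  refine .of_order ?_ (fun h => ((hmem z).1 h).2 rfl) ?_ ?_ ?_
  · rw [forcedPairs, List.map_map]
    exact hA.nodup.sublist (List.filter_sublist.map _)
  · refine List.pairwise_map.2 (List.Pairwise.imp_of_mem ?_
      (hA.order.sublist List.filter_sublist))
    rintro ⟨a, B⟩ ⟨b, _ | ⟨c, l⟩⟩ - hb hab
    · simp at hb
    · rintro rfl
      exact hab (by simp)
  · rintro ⟨a, b⟩ hab
    obtain ⟨h1, h2⟩ := hA.mem_forcedPairs_iff.1 hab
    rw [hmem]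
    exact or_iff_not_imp_left.2 fun h => ⟨hD.forced_of_adj hn h1 h2, h⟩
  · rintro ⟨a, b⟩ hab hne
    obtain rfl : a = b := hne
    exact lt_irrefl _ (hD.lt (hA.mem_forcedPairs_iff.1 hab).2)

theorem Represents.length_eq (hA : Represents Set.univ A D) : A.length = m := by
  have h := ncard_list hA.nodup
  have e : {c | c ∈ A.map Prod.fst} = Set.univ := by
    ext a
    obtain ⟨B, hB⟩ := (hA.mem a).1 trivial
    simp only [Set.mem_univ, iff_true]
    exact List.mem_map.2 ⟨_, hB, rfl⟩
  rw [e, Set.ncard_univ, Nat.card_eq_fintype_card, Fintype.card_fin, List.length_map] at h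
  exact h.symm

theorem Represents.sinkOf_eq (hD : P.StagedOn Set.univ D st z)
    (hA : Represents Set.univ A D) : sinkOf (toNatLists A) = z := by
  have hz : ∀ a, (a, []) ∈ A → a = z := by
    intro a ha
    by_contra haz
    obtain ⟨b, hb⟩ := hD.nonsink a trivial haz
    simpa using (hA.adj_iff ha).1 hb
  have hzA : (z, []) ∈ A := by
    obtain ⟨B, hB⟩ := (hA.mem z).1 trivial
    cases B with
    | nil => exact hB
    | cons b B => exact absurd ((hA.adj_iff hB).2 (by simp)) (hD.sink b)
  have hmem : (((z : ℕ), []) : ℕ × List ℕ) ∈ (toNatLists A).filter fun x => x.2.isEmpty :=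
    List.mem_filter.2 ⟨List.mem_map.2 ⟨_, hzA, rfl⟩, rfl⟩
  have hall : ∀ x ∈ (toNatLists A).filter fun x => x.2.isEmpty, x.1 = z := by
    intro x hx
    obtain ⟨h1, h2⟩ := List.mem_filter.1 hx
    obtain ⟨⟨a, _ | ⟨b, l⟩⟩, ha, rfl⟩ := List.mem_map.1 h1
    · exact congrArg Fin.val (hz a ha)
    · simp [toNats] at h2
  unfold sinkOf
  cases hl : (toNatLists A).filter fun x => x.2.isEmpty with
  | nil => simp [hl] at hmem
  | cons x l => exact hall x (by simp [hl])

/-- The pair found by the program for a free vertex. -/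
theorem Represents.exists_choicePair (hn : 0 < n) (hD : P.StagedOn Set.univ D st z)
    {T : SimpleGraph (Fin m)} (hT : T ∈ P.treeSet) (hA : Represents Set.univ A D) {a : Fin m}
    {B : List (Fin m)} (ha : (a, B) ∈ A) (hB : 2 ≤ B.length) :
    ∃ c₁ c₂ : Fin m, choicePair (forcedArcs (toNatLists A)) (a, toNats B) = ((c₁ : ℕ), (c₂ : ℕ)) ∧
      (c₁, c₂) ∈ forcedPairs A z ∧ D.Adj a c₁ ∧ D.Adj a c₂ := by
  have hfree : a ∈ free D := hB.trans_eq (hA.outDeg_eq ha).symm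
  obtain ⟨c₁, hc₁, c₂, -, h12, h1, h2⟩ := hD.exists_forced_pair hn hT hfree
  have hmem : ((c₁ : ℕ), (c₂ : ℕ)) ∈ (forcedArcs (toNatLists A)).filter fun e =>
      (toNats B).contains e.1 && (toNats B).contains e.2 := by
    rw [forcedArcs_toNatLists A z]
    refine List.mem_filter.2 ⟨List.mem_map.2 ⟨_, hA.mem_forcedPairs_iff.2 ⟨hc₁, h12⟩, rfl⟩, ?_⟩
    simp [mem_toNats, ← hA.adj_iff ha, h1, h2]
  unfold choicePair
  cases hl : (forcedArcs (toNatLists A)).filter fun e =>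
      (toNats B).contains e.1 && (toNats B).contains e.2 with
  | nil =>
    rw [hl] at hmem
    simp at hmem
  | cons e l =>
    have he : e ∈ (forcedArcs (toNatLists A)).filter fun e =>
        (toNats B).contains e.1 && (toNats B).contains e.2 := by
      rw [hl]
      simp
    obtain ⟨h3, h4⟩ := List.mem_filter.1 he
    rw [forcedArcs_toNatLists A z] at h3
    obtain ⟨⟨d₁, d₂⟩, h5, rfl⟩ := List.mem_map.1 h3
    simp only [Bool.and_eq_true, List.contains_iff_mem, mem_toNats, ← hA.adj_iff ha] at h4
    exact ⟨d₁, d₂, rfl, h5, h4.1, h4.2⟩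

/-- Invariant of the greedy loop: the tree built so far has pathwidth at most `w`. One of the two
possible attachments preserves this, hence so does the one with the smaller computed level. -/
theorem Represents.exists_foldl_attachStep (hn : 0 < n) (hD : P.StagedOn Set.univ D st z)
    {T : SimpleGraph (Fin m)} (hT : T ∈ P.treeSet) (hA : Represents Set.univ A D) {w : ℕ}
    (l : List (Fin m × List (Fin m))) (hl : ∀ x ∈ l, x ∈ A ∧ 2 ≤ x.2.length)
    (hlnd : (l.map Prod.fst).Nodup) {W : Set (Fin m)} (hW : ∀ x ∈ l, x.1 ∉ W)
    {E : List (Fin m × Fin m)} (hE : IsElimination z W E)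
    (hbags : HasBags (listGraph E) W (w + 1)) (hsub : ∀ e ∈ forcedPairs A z, e ∈ E) :
    ∃ E', (toNatLists l).foldl (attachStep (toNatLists A)) (toNatEdges E) = toNatEdges E' ∧
      IsElimination z (W ∪ {a | a ∈ l.map Prod.fst}) E' ∧
      HasBags (listGraph E') (W ∪ {a | a ∈ l.map Prod.fst}) (w + 1) ∧
      ∀ e ∈ E', e ∈ E ∨ ∃ c₁ c₂, (c₁, c₂) ∈ forcedPairs A z ∧ D.Adj e.1 c₁ ∧ D.Adj e.1 c₂ ∧
        (e.2 = c₁ ∨ e.2 = c₂) := by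
  induction l generalizing W E with
  | nil => exact ⟨E, rfl, by simpa using hE, by simpa using hbags, fun e he => Or.inl he⟩
  | cons x l ih =>
    obtain ⟨a, B⟩ := x
    obtain ⟨haA, hB⟩ := hl (a, B) (by simp)
    obtain ⟨c₁, c₂, hc, hc12, hac₁, hac₂⟩ := hA.exists_choicePair hn hD hT haA hB
    have haW : a ∉ W := hW (a, B) (by simp)
    have hcE := hsub _ hc12
    obtain ⟨hm1, hm2, -⟩ := hE.mem _ hcE
    have hE1 := IsElimination.cons haW hm1 hE
    have hE2 := IsElimination.cons haW hm2 hE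
    rw [List.map_cons, List.nodup_cons] at hlnd
    have hset : W ∪ {b | b ∈ ((a, B) :: l).map Prod.fst}
        = insert a W ∪ {b | b ∈ l.map Prod.fst} := by
      ext b
      simp only [List.map_cons, List.mem_cons, Set.mem_union, Set.mem_ofPred_eq,
        Set.mem_insert_iff]
      tauto
    have next : ∀ c, (c = c₁ ∨ c = c₂) → IsElimination z (insert a W) ((a, c) :: E) →
        HasBags (listGraph ((a, c) :: E)) (insert a W) (w + 1) →
        attachStep (toNatLists A) (toNatEdges E) (a, toNats B) = toNatEdges ((a, c) :: E) →
        ∃ E', (toNatLists ((a, B) :: l)).foldl (attachStep (toNatLists A)) (toNatEdges E)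
          = toNatEdges E' ∧ IsElimination z (W ∪ {b | b ∈ ((a, B) :: l).map Prod.fst}) E' ∧
          HasBags (listGraph E') (W ∪ {b | b ∈ ((a, B) :: l).map Prod.fst}) (w + 1) ∧
          ∀ e ∈ E', e ∈ E ∨ ∃ c₁ c₂, (c₁, c₂) ∈ forcedPairs A z ∧ D.Adj e.1 c₁ ∧ D.Adj e.1 c₂ ∧
            (e.2 = c₁ ∨ e.2 = c₂) := by
      intro c hcc hEc hbc hstep
      have hW' : ∀ x ∈ l, x.1 ∉ insert a W := by
        rintro x hx (h | h)
        · exact hlnd.1 (List.mem_map.2 ⟨x, hx, h⟩)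
        · exact hW x (by simp [hx]) h
      obtain ⟨E', h1, h2, h3, h4⟩ := ih (fun x hx => hl x (by simp [hx])) hlnd.2 hW' hEc hbc
        (fun e he => by simp [hsub e he])
      rw [hset]
      refine ⟨E', ?_, h2, h3, fun e he => ?_⟩
      · rw [← h1, ← hstep]
        rfl
      · rcases h4 e he with h | h
        · rcases List.mem_cons.1 h with rfl | h
          · exact Or.inr ⟨c₁, c₂, hc12, hac₁, hac₂, hcc⟩
          · exact Or.inl h
        · exact Or.inr h
    have hlen : (toNatLists A).length = m := by rw [toNatLists, List.length_map, hA.length_eq]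
    have hstep : attachStep (toNatLists A) (toNatEdges E) (a, toNats B)
        = bif (treeLevel m (toNatEdges ((a, c₁) :: E)) z).ble
            (treeLevel m (toNatEdges ((a, c₂) :: E)) z)
          then toNatEdges ((a, c₁) :: E) else toNatEdges ((a, c₂) :: E) := by
      rw [attachStep, hc, hlen, hA.sinkOf_eq hD]
      rfl
    have hlev := hE.hasBags_leaf haW hcE hbags
    rw [hE1.hasBags_iff, hE2.hasBags_iff] at hlev
    cases hble : (treeLevel m (toNatEdges ((a, c₁) :: E)) z).ble
        (treeLevel m (toNatEdges ((a, c₂) :: E)) z) with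
    | true =>
      have hle := Nat.le_of_ble_eq_true hble
      refine next c₁ (Or.inl rfl) hE1 ((hE1.hasBags_iff w).2 (hlev.elim id fun h => hle.trans h)) ?_
      rw [hstep, hble, cond_true]
    | false =>
      have hle : treeLevel m (toNatEdges ((a, c₂) :: E)) z
          ≤ treeLevel m (toNatEdges ((a, c₁) :: E)) z := by
        rw [← Bool.not_eq_true, Nat.ble_eq] at hble
        omega
      refine next c₂ (Or.inr rfl) hE2 ((hE2.hasBags_iff w).2 (hlev.elim (fun h => hle.trans h) id)) ?_
      rw [hstep, hble, cond_false]

/-- A tree of small pathwidth that arises by choices between adjacent forced vertices is an output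
of the algorithm. -/
theorem Profile.StagedOn.exists_run (hn : 0 < n) (hPD : P.IsAttachmentDigraph D)
    (hD : P.StagedOn Set.univ D st z) {f : Fin m → Fin m}
    (hf : ∀ a ∈ forced D, a ≠ z → D.Adj a (f a))
    (hf' : ∀ a ∈ free D, ∃ c₁ ∈ forced D, ∃ c₂ ∈ forced D, D.Adj c₁ c₂ ∧ D.Adj a c₁ ∧ D.Adj a c₂ ∧
      (f a = c₁ ∨ f a = c₂))
    (hbags : HasBags (attachmentGraph D f) Set.univ (pathwidth (forcedGraph D) + 1)) :
    IsAlgorithmOutput P (attachmentGraph D f) ∧ IsMinPathwidthTree P (attachmentGraph D f) := by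
  classical
  have hadj : ∀ a, a ≠ z → D.Adj a (f a) := by
    intro a haz
    by_cases ha : a ∈ forced D
    · exact hf a ha haz
    · obtain ⟨c₁, -, c₂, -, -, h1, h2, h | h⟩ := hf' a (Profile.free_iff_not_forced.2 ha)
      · rwa [h]
      · rwa [h]
  obtain ⟨S, h1, h2⟩ := hbags
  have h3 : DecomposesOn (forcedGraph D) Set.univ
      (S.map fun X => X.subtype (· ∈ forced D)) := by
    refine h1.preimage _ Subtype.val _ (fun _ _ => trivial) (fun a _ b _ hab => ?_) _ (by simp)
    rw [hD.attachmentGraph_adj hadj]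
    rcases (hD.forcedGraph_adj a b).1 hab with h | h
    · have haz : (a : Fin m) ≠ z := fun haz => hD.sink b (haz ▸ h)
      exact Or.inl ⟨haz, Profile.eq_of_forced a.2 (hadj a haz) h⟩
    · have hbz : (b : Fin m) ≠ z := fun hbz => hD.sink a (hbz ▸ h)
      exact Or.inr ⟨hbz, Profile.eq_of_forced b.2 (hadj b hbz) h⟩
  -- Restriction cannot increase the width, and the forced part allows no smaller one; so the
  -- restricted decomposition has minimum width.
  have h4 : bagWidth (S.map fun X => X.subtype (· ∈ forced D)) = pathwidth (forcedGraph D) := by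
    refine le_antisymm (bagWidth_le_iff.2 fun X hX => ?_)
      (pathwidth_le_iff.2 ⟨_, h3, bagWidth_le_iff.1 le_rfl⟩)
    obtain ⟨Y, hY, rfl⟩ := List.mem_map.1 hX
    rw [Finset.card_subtype]
    exact (Finset.card_filter_le _ _).trans (h2 Y hY)
  obtain ⟨S', h5, h6⟩ := exists_isSlackDecomposition _ h3 h4
  have hrun : IsAttachmentRun D S' f := by
    refine ⟨fun a ha hs => hf a ha fun haz => hs (hD.isSink_iff.2 haz), fun a ha => ?_⟩
    obtain ⟨c₁, hc₁, c₂, hc₂, h12, hac₁, hac₂, hfa⟩ := hf' a ha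
    have hfo : f a ∈ forced D := by
      rcases hfa with h | h
      · rwa [h]
      · rwa [h]
    have hna := Profile.free_iff_not_forced.1 ha
    have haz : a ≠ z := fun haz => hna (haz ▸ hD.sink_mem_forced)
    refine ⟨⟨c₁, hc₁⟩, ⟨c₂, hc₂⟩, ⟨f a, hfo⟩, h12, hac₁, hac₂, hfa.imp Subtype.ext Subtype.ext, rfl,
      ?_⟩
    -- The bag covering the edge `{a, f a}` loses the free vertex `a` under restriction, so its
    -- trace has size at most the width. The slack refinement keeps this bag.
    obtain ⟨X, hX, haX, hfX⟩ := h1.edge a trivial (f a) trivial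
      ((hD.attachmentGraph_adj hadj a (f a)).2 (Or.inl ⟨haz, rfl⟩))
    refine ⟨_, h6 _ (List.mem_map_of_mem hX), Finset.mem_subtype.2 hfX, ?_⟩
    rw [h5.minimum, Finset.card_subtype]
    have hlt : (X.filter (· ∈ forced D)).card < X.card :=
      Finset.card_lt_card ((Finset.filter_ssubset).2 ⟨a, haX, hna⟩)
    have := h2 X hX
    omega
  exact ⟨⟨D, S', f, hPD, h5, hrun, rfl⟩, hD.isMinPathwidthTree hn h5 hrun⟩

theorem Represents.treeEdges_correct (hn : 0 < n) (hPD : P.IsAttachmentDigraph D)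
    (hD : P.StagedOn Set.univ D st z) {T : SimpleGraph (Fin m)} (hT : T ∈ P.treeSet)
    (hA : Represents Set.univ A D) :
    ∃ E, treeEdges (toNatLists A) = toNatEdges E ∧ ListsEdges E (listGraph E) ∧
      IsAlgorithmOutput P (listGraph E) ∧ IsMinPathwidthTree P (listGraph E) := by
  have hF := hA.isElimination_forcedPairs hn hD z
  have hbags : HasBags (listGraph (forcedPairs A z)) (forced D)
      (pathwidth (forcedGraph D) + 1) := by
    obtain ⟨S, h1, h2⟩ := pathwidth_le_iff.1 (le_refl (pathwidth (forcedGraph D)))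
    refine ⟨_, decomposesOn_forced h1 fun a b hab => ?_, fun X hX => ?_⟩
    · rw [hD.forcedGraph_adj]
      exact (listGraph_adj.1 hab).2.imp (fun h => (hA.mem_forcedPairs_iff.1 h).2)
        fun h => (hA.mem_forcedPairs_iff.1 h).2
    · obtain ⟨Y, hY, rfl⟩ := List.mem_map.1 hX
      rw [Finset.card_map]
      exact h2 Y hY
  have hlen : ∀ B : List (Fin m), (!B.tail.isEmpty) = true ↔ 2 ≤ B.length := by
    rintro (_ | ⟨b, _ | ⟨c, l⟩⟩) <;> simp
  have hfil : ∀ x ∈ A.filter fun x => !x.2.tail.isEmpty, x ∈ A ∧ 2 ≤ x.2.length := fun x hx =>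
    ⟨(List.mem_filter.1 hx).1, (hlen _).1 (List.mem_filter.1 hx).2⟩
  have hfree : ∀ x ∈ A.filter fun x => !x.2.tail.isEmpty, x.1 ∉ forced D := by
    rintro ⟨a, B⟩ hx
    obtain ⟨h1, h2⟩ := hfil _ hx
    rw [← Profile.free_iff_not_forced]
    exact h2.trans_eq (hA.outDeg_eq h1).symm
  obtain ⟨E, h1, h2, h3, h4⟩ := hA.exists_foldl_attachStep hn hD hT
    (A.filter fun x => !x.2.tail.isEmpty) hfil
    (hA.nodup.sublist (List.filter_sublist.map _)) (W := forced D) hfree hF hbags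
    fun e he => he
  have huniv : forced D ∪ {a | a ∈ (A.filter fun x => !x.2.tail.isEmpty).map Prod.fst}
      = Set.univ := by
    refine Set.eq_univ_of_forall fun a => ?_
    by_cases ha : a ∈ forced D
    · exact Or.inl ha
    · obtain ⟨B, hB⟩ := (hA.mem a).1 trivial
      have h5 : 2 ≤ B.length :=
        (show 2 ≤ outDeg D a from Profile.free_iff_not_forced.2 ha).trans_eq (hA.outDeg_eq hB)
      exact Or.inr (List.mem_map.2 ⟨(a, B), List.mem_filter.2 ⟨hB, (hlen B).2 h5⟩, rfl⟩)
  rw [huniv] at h2 h3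
  -- The attachment function is read off from the edge list, in which every vertex but `z` has
  -- exactly one parent.
  have hpar : ∀ a, ∃ b, a ≠ z → (a, b) ∈ E := by
    intro a
    by_cases haz : a = z
    · exact ⟨a, fun h => absurd haz h⟩
    · exact (h2.exists_parent a trivial haz).imp fun b hb _ => hb
  choose f hf using hpar
  have hcases : ∀ a, a ≠ z → (a ∈ forced D ∧ D.Adj a (f a)) ∨ ∃ c₁ ∈ forced D, ∃ c₂ ∈ forced D,
      D.Adj c₁ c₂ ∧ D.Adj a c₁ ∧ D.Adj a c₂ ∧ (f a = c₁ ∨ f a = c₂) := by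
    intro a haz
    rcases h4 _ (hf a haz) with h | ⟨c₁, c₂, hc, hac₁, hac₂, h⟩
    · exact Or.inl (hA.mem_forcedPairs_iff.1 h)
    · obtain ⟨h5, h6⟩ := hA.mem_forcedPairs_iff.1 hc
      exact Or.inr ⟨c₁, h5, c₂, hD.forced_of_adj hn h5 h6, h6, hac₁, hac₂, h⟩
  have hadj : ∀ a, a ≠ z → D.Adj a (f a) := by
    intro a haz
    rcases hcases a haz with h | ⟨c₁, -, c₂, -, -, h1, h2, h | h⟩
    · exact h.2
    · rwa [h]
    · rwa [h]
  have hmem : ∀ a b, (a, b) ∈ E ↔ a ≠ z ∧ f a = b := by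
    intro a b
    constructor
    · intro hab
      have haz : a ≠ z := by
        rintro rfl
        exact h2.root_no_parent b hab
      exact ⟨haz, h2.parent_unique a _ _ (hf a haz) hab⟩
    · rintro ⟨haz, rfl⟩
      exact hf a haz
  have hgraph : listGraph E = attachmentGraph D f := by
    ext a b
    rw [hD.attachmentGraph_adj hadj, listGraph_adj, hmem, hmem]
    refine ⟨And.right, fun h => ⟨?_, h⟩⟩
    rintro rfl
    rw [← hmem, or_self] at h
    exact (h2.mem _ h).2.2 rfl
  refine ⟨E, ?_, fun a b => ?_, ?_⟩
  · rw [← h1, treeEdges, ← forcedArcs_toNatLists]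
    congr 1
    simp only [toNatLists, List.filter_map]
    congr 1
    refine List.filter_congr fun x _ => ?_
    obtain ⟨a, _ | ⟨b, _ | ⟨c, l⟩⟩⟩ := x <;> rfl
  · rw [listGraph_adj]
    refine ⟨And.right, fun h => ⟨?_, h⟩⟩
    rintro rfl
    rcases h with h | h
    · exact (h2.mem _ h).2.2 rfl
    · exact (h2.mem _ h).2.2 rfl
  · rw [hgraph] at h3 ⊢
    refine hD.exists_run hn hPD (fun a _ haz => hadj a haz) (fun a ha => ?_) h3
    have hna := Profile.free_iff_not_forced.1 ha
    have haz : a ≠ z := fun haz => hna (haz ▸ hD.sink_mem_forced)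
    exact (hcases a haz).resolve_left fun h => hna h.1

end TreeEdges

/-! ### Encodings, the size of the input, and the final time bound. -/

section RunningTime

variable {n m : ℕ} {P : Profile n (Fin m)}

theorem Profile.IsRanking.nodup {i : Fin n} {r : List (Fin m)} (h : P.IsRanking i r) : r.Nodup :=
  h.1.imp fun hab => by
    rintro rfl
    exact Profile.prefers_irrefl _ hab

theorem exists_attachmentLists (hn : 0 < n) {rk : Fin n → List (Fin m)}
    (hrk : ∀ i, P.IsRanking i (rk i)) {T : SimpleGraph (Fin m)} (hT : T ∈ P.treeSet) :
    ∃ (A : List (Fin m × List (Fin m))) (D : Digraph (Fin m)),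
      attachmentLists (natRankings rk) = toNatLists A ∧ P.IsAttachmentDigraph D ∧
      Represents Set.univ A D := by
  obtain ⟨hL, hconn⟩ := Profile.locallyPeaked_of_mem_treeSet hT
  have hhead : (natRankings rk).headD [] = toNats (rk ⟨0, hn⟩) := by
    obtain ⟨n, rfl⟩ : ∃ k, n = k + 1 := ⟨n - 1, by omega⟩
    simp [natRankings, List.ofFn_succ]
  have e : {c | c ∈ rk ⟨0, hn⟩} = Set.univ := Set.eq_univ_of_forall (hrk _).2
  obtain ⟨A, D, h1, h2, h3⟩ := exists_represents hn hrk hL (toNats (rk ⟨0, hn⟩))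
    (hrk ⟨0, hn⟩).nodup (by rwa [e]) (by simp [toNats]) []
  rw [e] at h2 h3
  exact ⟨A, D, by rw [attachmentLists, hhead, h1, List.nil_append], h2, h3⟩

theorem encodeRankings_eq (rk : Fin n → List (Fin m)) :
    encodeRankings rk = Coded.code (natRankings rk) := by
  change _ = Data.ofList ((List.ofFn fun i => toNats (rk i)).map Coded.code)
  rw [List.map_ofFn]
  refine congrArg Data.ofList (congrArg List.ofFn (funext fun i => ?_))
  change _ = Data.ofList (((rk i).map Fin.val).map Coded.code)
  -- The coercion inside `encodeRankings` acts on the whole list as a monadic lift, which is the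
  -- same as mapping `Fin.val`.
  have e : (do let a ← rk i; pure (a : ℕ)) = (rk i).map Fin.val := by
    simp only [List.bind_eq_flatMap, List.pure_def]
    induction rk i with
    | nil => rfl
    | cons a l ih => rw [List.flatMap_cons, ih]; rfl
  rw [e]
  rfl

theorem encodeEdges_eq (E : List (Fin m × Fin m)) :
    encodeEdges E = Coded.code (toNatEdges E) := by
  change _ = Data.ofList ((E.map fun e => ((e.1 : ℕ), (e.2 : ℕ))).map Coded.code)
  rw [List.map_map]
  rfl

theorem codeSize_natRankings_le {rk : Fin n → List (Fin m)} (hrk : ∀ i, P.IsRanking i (rk i)) :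
    codeSize (natRankings rk) ≤ (n + m) * ((n + m) * (2 * (n + m) + 2) + 2) + 1 := by
  refine codeSize_list_le (by simp [natRankings]) fun l hl => ?_
  obtain ⟨i, rfl⟩ := List.mem_ofFn.1 hl
  have hlen : (toNats (rk i)).length ≤ n + m := by
    have := (hrk i).nodup.length_le_card
    rw [Fintype.card_fin] at this
    rw [toNats, List.length_map]
    omega
  refine codeSize_list_le (B := 2 * (n + m) + 1) hlen fun x hx => ?_
  obtain ⟨c, -, rfl⟩ := List.mem_map.1 hx
  have := c.2
  rw [codeSize_nat]
  omega

/-- The algorithm can be carried out in polynomial time. -/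
theorem attachment_algorithm_polynomial : ∃ (c : Prog) (q : Polynomial ℕ), ∀ (n m : ℕ)
    (P : Profile n (Fin m)), 0 < n → P.treeSet.Nonempty →
      ∀ rk : Fin n → List (Fin m), (∀ i, P.IsRanking i (rk i)) →
        ∃ (l : List (Fin m × Fin m)) (T : SimpleGraph (Fin m)) (t : ℕ),
          Runs c (encodeRankings rk) (encodeEdges l) t ∧ t ≤ q.eval (n + m) ∧
          ListsEdges l T ∧ IsAlgorithmOutput P T ∧ IsMinPathwidthTree P T := by
  obtain ⟨c, g, ⟨q, hq⟩, hc⟩ : PolyTime fun R : List (List ℕ) => treeEdges (attachmentLists R) :=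
    PolyTime.treeEdges.comp (PolyTime.attachmentLists .id)
  -- The inner polynomial bounds the size of the encoded profile in terms of `n + m`.
  refine ⟨c, q.comp (Polynomial.X * (Polynomial.X * (2 * Polynomial.X + 2) + 2) + 1), ?_⟩
  rintro n m P hn ⟨T, hT⟩ rk hrk
  obtain ⟨A, D, hA, hPD, hAD⟩ := exists_attachmentLists hn hrk hT
  obtain ⟨a⟩ := hT.1.connected.nonempty
  obtain ⟨st, z, hD⟩ := Profile.IsAttachmentDigraph.exists_stagedOn hn hPD a
  obtain ⟨E, h1, h2, h3, h4⟩ := hAD.treeEdges_correct hn hPD hD hT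
  obtain ⟨t, h5, h6⟩ := hc (natRankings rk)
  dsimp only at h5
  rw [hA, h1, ← encodeRankings_eq, ← encodeEdges_eq] at h5
  refine ⟨E, listGraph E, t, h5, h6.trans ((hq _).trans ?_), h2, h3, h4⟩
  rw [Polynomial.eval_comp]
  refine Polynomial.eval_mono_nat q ((codeSize_natRankings_le hrk).trans_eq ?_)
  simp

end RunningTime

theorem mainTheorem10 :
    -- correctness: the algorithm never gets stuck and, whatever it chooses, returns an optimal tree
    (∀ (n : ℕ) (C : Type*) [Finite C] (P : Profile n C), 0 < n → P.treeSet.Nonempty →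
      (∃ D, P.IsAttachmentDigraph D) ∧
      ∀ D, P.IsAttachmentDigraph D →
        (forcedGraph D).IsTree ∧
        (∃ S, IsSlackDecomposition (forcedGraph D) S) ∧
        ∀ S, IsSlackDecomposition (forcedGraph D) S →
          (∃ f, IsAttachmentRun D S f) ∧
          ∀ f, IsAttachmentRun D S f →
            IsMinPathwidthTree P (attachmentGraph D f) ∧
            ∀ a ∈ free D, ((attachmentGraph D f).neighborSet a).ncard = 1) ∧
    -- running time: a program computes an output of the algorithm in polynomially many steps
    (∃ (c : Prog) (q : Polynomial ℕ), ∀ (n m : ℕ) (P : Profile n (Fin m)),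
      0 < n → P.treeSet.Nonempty →
      ∀ rk : Fin n → List (Fin m), (∀ i, P.IsRanking i (rk i)) →
        ∃ (l : List (Fin m × Fin m)) (T : SimpleGraph (Fin m)) (t : ℕ),
          Runs c (encodeRankings rk) (encodeEdges l) t ∧ t ≤ q.eval (n + m) ∧
          ListsEdges l T ∧ IsAlgorithmOutput P T ∧ IsMinPathwidthTree P T) := by
  exact ⟨fun _ _ _ P hn hP => attachment_algorithm_correct P hn hP,
    attachment_algorithm_polynomial⟩
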